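/- **Setting.** Let $\ell^2$ be the real Hilbert space of square summable sequences $\mathbf x=(x_i)_{i\ge 1}$ with standard basis $(\mathbf e_i)$, and fix $a_i>0$ with $\sum_i a_i<\infty$. Let $P$ be the Borel probability measure on $\ell^2$ obtained by restricting to $\ell^2$ the product measure $\prod_i \mathcal N(0,a_i^2)$ on $\mathbb R^{\mathbb N}$. Put $\mathbb H=\{\mathbf x\in\ell^2: x_1>0\}$, and let $D_i$ denote the partial derivative in direction $\mathbf e_i$. For an open set $V\subset\ell^2$: * A function on $V$ is *$F$-continuous* if for every $\mathbf x\in V$ and $n$ the map $(s_1,\dots,s_n)\mapsto f(\mathbf x+\sum_{i\le n} s_i\mathbf e_i)$ is continuous where it is defined. A real function on $V$ is *$F$-smooth* if it and all its iterated partial derivatives exist, are $F$-continuous and Borel measurable on $V$, and each partial derivative of order at least one is bounded on $V$. * $E\stackrel{\circ}{\subset}V$ means that there are $r,R>0$ with $\bigcup_{\mathbf x\in E}B(\mathbf x;r)\subset V$ and $E\subset B(\mathbf 0;R)$. * A *test function* on $V$ is an $F$-smooth $\varphi$ with $\sup_V\big(|\varphi|+\sum_i|D_i\varphi|^2\big)<\infty$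 and $\operatorname{supp}\varphi\stackrel{\circ}{\subset}V$. * For $f\in L^2(V,P)$ (real or complex valued), $D_if=u\in L^2(V,P)$ in the weak sense if $\int_V u\varphi\,dP=\int_V f\,\big(-D_i\varphi+\tfrac{x_i}{a_i^2}\varphi\big)\,dP$ for all test functions $\varphi$ on $V$. The space $W^{1,2}(V)$ consists of the $f\in L^2(V,P)$ all of whose weak derivatives $D_if$ lie in $L^2(V,P)$ and for which $$\|f\|_{W^{1,2}(V)}^2=\int_V|f|^2\,dP+\sum_{i=1}^\infty a_i^2\int_V|D_if|^2\,dP<\infty .$$ Let $g:\ell^2\to\mathbb R$ be a $C^1$ Fréchet differentiable function and let $O=\{g>0\}$; assume $\partial O=\{g=0\}$ and $Dg\ne0$ on $\partial O$. Let $\mathbf x_0\in\partial O$, $r>0$, $U_0=B(\mathbf x_0;r)$, and $$\psi(\mathbf x)=(g(\mathbf x),x_2,x_3,\dots)\quad(\mathbf x\in U_0).$$ Let $h:\psi(U_0)\to\mathbb R$ send $\widehat{\mathbf x}=\psi(\mathbf x)$, $\mathbf x\in U_0$, to $x_1$, suppose $h$ is $C^1$ Fréchet differentiable, and put $\tau(\widehat{\mathbf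 x})=(h(\widehat{\mathbf x}),\widehat x_2,\widehat x_3,\dots)$ on $\psi(U_0)$. (Under the condition below $\psi$ is injective on $U_0$, so that $h$ is well defined.) **Condition.** $g$ is $F$-smooth on $U_0$ and $h$ is $F$-smooth on $\psi(U_0)$, and there is $\delta\in(0,\infty)$ such that for all $\mathbf x\in U_0$ and $\widehat{\mathbf x}\in\psi(U_0)$ $$|x_1|,\ |\widehat x_1|,\ |g(\mathbf x)|,\ |h(\widehat{\mathbf x})|<\delta,\qquad \tfrac1\delta<D_1g(\mathbf x)<\delta,\qquad \tfrac1\delta<D_1h(\widehat{\mathbf x})<\delta,\qquad \sum_{i=1}^\infty a_i^2|D_ih(\widehat{\mathbf x})|^2<\delta .$$ Moreover $\psi(E)\stackrel{\circ}{\subset}\psi(U_0)\cap\mathbb H$ whenever $E\stackrel{\circ}{\subset}U_0\cap O$, and $\tau(E')\stackrel{\circ}{\subset}U_0\cap O$ whenever $E'\stackrel{\circ}{\subset}\psi(U_0)\cap\mathbb H$. **Theorem.** Suppose the Condition holds. Then $\psi$ and $\tau$ restrict to mutually inverse maps between $U_0\cap O$ and $\psi(U_0)\cap\mathbb H$, and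 there is a constant $C\in(0,\infty)$ such that: 1. if $f\in W^{1,2}(U_0\cap O)$, then $f\circ\tau\in W^{1,2}(\psi(U_0)\cap\mathbb H)$ and $$C^{-1}\|f\|_{W^{1,2}(U_0\cap O)}\le\|f\circ\tau\|_{W^{1,2}(\psi(U_0)\cap\mathbb H)}\le C\|f\|_{W^{1,2}(U_0\cap O)};$$ 2. conversely, if $f\in W^{1,2}(\psi(U_0)\cap\mathbb H)$, then $f\circ\psi\in W^{1,2}(U_0\cap O)$ and $$C^{-1}\|f\|_{W^{1,2}(\psi(U_0)\cap\mathbb H)}\le\|f\circ\psi\|_{W^{1,2}(U_0\cap O)}\le C\|f\|_{W^{1,2}(\psi(U_0)\cap\mathbb H)}.$$ -/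

import Mathlib

open MeasureTheory Set

namespace GaussSobolev

/-- The real Hilbert space of square summable sequences. Coordinates are numbered from `0`, so the
first coordinate is `x 0`. -/
abbrev Ell2 : Type := lp (fun _ : ℕ => ℝ) 2

noncomputable instance instMeasurableSpaceEll2 : MeasurableSpace Ell2 := borel Ell2

instance instBorelSpaceEll2 : BorelSpace Ell2 := ⟨rfl⟩

/-- The `i`-th vector of the standard orthonormal basis. -/
noncomputable def stdVec (i : ℕ) : Ell2 := lp.single 2 i (1 : ℝ)

theorem stdVec_apply (i j : ℕ) : stdVec i j = if j = i then (1 : ℝ) else 0 := by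
  by_cases h : j = i
  · subst h
    simp [stdVec]
  · simp [stdVec, h]

/-- The product over `i` of the centred normal laws on the line with standard deviation `a i`. -/
noncomputable def productGaussian (a : ℕ → ℝ) : Measure (ℕ → ℝ) :=
  Measure.infinitePi fun i => ProbabilityTheory.gaussianReal 0 (Real.toNNReal (a i ^ 2))

/-- The Borel measure on the Hilbert space with `P B = productGaussian a B`, a Borel set `B` of the
Hilbert space being regarded as a set of real sequences. -/
noncomputable def gaussP (a : ℕ → ℝ) : Measure Ell2 :=
  Measure.comap (fun (x : Ell2) (i : ℕ) => x i) (productGaussian a)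

/-- The partial derivative `D_i f` (meaningful where the difference quotients converge). -/
noncomputable def pd (i : ℕ) (f : Ell2 → ℝ) (x : Ell2) : ℝ :=
  deriv (fun t : ℝ => f (x + t • stdVec i)) 0

/-- The partial derivative `D_i f` exists at `x`. -/
def HasPD (i : ℕ) (f : Ell2 → ℝ) (x : Ell2) : Prop :=
  DifferentiableAt ℝ (fun t : ℝ => f (x + t • stdVec i)) 0

/-- Iterated partial derivatives; the head of the list is the outermost derivative. -/
noncomputable def iterPD : List ℕ → (Ell2 → ℝ) → Ell2 → ℝ
  | [], f => f
  | i :: l, f => pd i (iterPD l f)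

/-- `F`-continuity on `O`: continuity along all finite-dimensional coordinate slices of `O`. -/
def FContinuousOn (O : Set Ell2) (f : Ell2 → ℝ) : Prop :=
  ∀ x ∈ O, ∀ n : ℕ,
    ContinuousOn (fun s : Fin n → ℝ => f (x + ∑ i : Fin n, s i • stdVec (i : ℕ)))
      {s : Fin n → ℝ | x + ∑ i : Fin n, s i • stdVec (i : ℕ) ∈ O}

/-- `E` is uniformly included in `O`. -/
def UnifIncluded (E O : Set Ell2) : Prop :=
  ∃ r R : ℝ, 0 < r ∧ 0 < R ∧ (∀ x ∈ E, Metric.ball x r ⊆ O) ∧ E ⊆ Metric.ball 0 R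

/-- Infinite-dimensional smoothness on `O` (no support condition): `f` and all its partial
derivatives exist, are `F`-continuous and Borel measurable on `O`, and every partial derivative of
order at least one is bounded on `O`. -/
structure IsFSmooth (O : Set Ell2) (f : Ell2 → ℝ) : Prop where
  exists_pd : ∀ (l : List ℕ) (i : ℕ), ∀ x ∈ O, HasPD i (iterPD l f) x
  fcont : ∀ l : List ℕ, FContinuousOn O (iterPD l f)
  meas : ∀ l : List ℕ, Measurable (O.domRestrict (iterPD l f))
  bdd : ∀ l : List ℕ, l ≠ [] → ∃ M : ℝ, ∀ x ∈ O, |iterPD l f x| ≤ M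

/-- Test functions on `O`. -/
structure IsTestFun (O : Set Ell2) (φ : Ell2 → ℝ) : Prop where
  smooth : IsFSmooth O φ
  bdd_grad : ∃ M : ℝ, ∀ x ∈ O,
    Summable (fun i => pd i φ x ^ 2) ∧ |φ x| + ∑' i, pd i φ x ^ 2 ≤ M
  supp : UnifIncluded (closure {x | x ∈ O ∧ φ x ≠ 0}) O

/-- The formal adjoint `D_i^* φ = - D_i φ + (x_i / a_i ^ 2) φ`. -/
noncomputable def pdAdj (a : ℕ → ℝ) (i : ℕ) (φ : Ell2 → ℝ) (x : Ell2) : ℝ :=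
  -pd i φ x + x i / a i ^ 2 * φ x

section Sobolev

variable {𝕜 : Type*} [RCLike 𝕜]

/-- `g` is an `L²` weak partial derivative `D_i f` on `O`. -/
def IsWeakPD (a : ℕ → ℝ) (O : Set Ell2) (i : ℕ) (f g : Ell2 → 𝕜) : Prop :=
  MemLp g 2 ((gaussP a).restrict O) ∧
    ∀ φ : Ell2 → ℝ, IsTestFun O φ →
      ∫ x in O, φ x • g x ∂(gaussP a) = ∫ x in O, pdAdj a i φ x • f x ∂(gaussP a)

open Classical in
/-- The weak partial derivative `D_i f` on `O` (zero if there is none in `L²`). -/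
noncomputable def weakPD (a : ℕ → ℝ) (O : Set Ell2) (i : ℕ) (f : Ell2 → 𝕜) : Ell2 → 𝕜 :=
  if h : ∃ g : Ell2 → 𝕜, IsWeakPD a O i f g then h.choose else 0

/-- Membership in the Sobolev space `W^{1,2}(O)`. -/
structure MemW12 (a : ℕ → ℝ) (O : Set Ell2) (f : Ell2 → 𝕜) : Prop where
  memLp : MemLp f 2 ((gaussP a).restrict O)
  exists_weakPD : ∀ i : ℕ, ∃ g : Ell2 → 𝕜, IsWeakPD a O i f g
  summable : Summable fun i => a i ^ 2 * ∫ x in O, ‖weakPD a O i f x‖ ^ 2 ∂(gaussP a)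

/-- The norm of `W^{1,2}(O)`. -/
noncomputable def normW12 (a : ℕ → ℝ) (O : Set Ell2) (f : Ell2 → 𝕜) : ℝ :=
  Real.sqrt ((∫ x in O, ‖f x‖ ^ 2 ∂(gaussP a)) +
    ∑' i, a i ^ 2 * ∫ x in O, ‖weakPD a O i f x‖ ^ 2 ∂(gaussP a))

end Sobolev

/-- The open half space. -/
def halfSpace : Set Ell2 := {x | 0 < x 0}

/-- Replace the first coordinate of `x` by `t`. -/
noncomputable def replaceFirst (t : ℝ) (x : Ell2) : Ell2 := x + (t - x 0) • stdVec 0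

theorem replaceFirst_apply (t : ℝ) (x : Ell2) (j : ℕ) :
    replaceFirst t x j = if j = 0 then t else x j := by
  have h : replaceFirst t x j = x j + (t - x 0) * stdVec 0 j := rfl
  rw [h, stdVec_apply]
  by_cases hj : j = 0
  · subst hj
    simp
  · simp [hj]

/-- The flattening map `ψ`. -/
noncomputable def flatten (g : Ell2 → ℝ) (x : Ell2) : Ell2 := replaceFirst (g x) x

/-- The function `h`: the first coordinate of the point of `U` that the flattening map sends to the
given point of its image. -/
noncomputable def firstCoord (g : Ell2 → ℝ) (U : Set Ell2) (y : Ell2) : ℝ :=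
  Function.invFunOn (flatten g) U y 0

/-- The map `τ`. -/
noncomputable def unflatten (g : Ell2 → ℝ) (U : Set Ell2) (y : Ell2) : Ell2 :=
  replaceFirst (firstCoord g U y) y

/-- The condition on `g` and `h` on the neighbourhood `U` and on its image `V = ψ(U)`. -/
structure FlatteningCondition (a : ℕ → ℝ) (O : Set Ell2) (g : Ell2 → ℝ) (U : Set Ell2) :
    Prop where
  smooth_g : IsFSmooth U g
  smooth_h : IsFSmooth (flatten g '' U) (firstCoord g U)
  bounds : ∃ δ : ℝ, 0 < δ ∧
    (∀ x ∈ U, |x 0| < δ ∧ |g x| < δ ∧ 1 / δ < pd 0 g x ∧ pd 0 g x < δ) ∧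
    (∀ y ∈ flatten g '' U, |y 0| < δ ∧ |firstCoord g U y| < δ ∧
      1 / δ < pd 0 (firstCoord g U) y ∧ pd 0 (firstCoord g U) y < δ ∧
      Summable (fun i => a i ^ 2 * |pd i (firstCoord g U) y| ^ 2) ∧
      ∑' i, a i ^ 2 * |pd i (firstCoord g U) y| ^ 2 < δ)
  image_unifIncluded : ∀ E : Set Ell2, UnifIncluded E (U ∩ O) →
    UnifIncluded (flatten g '' E) (flatten g '' U ∩ halfSpace)
  preimage_unifIncluded : ∀ E : Set Ell2, UnifIncluded E (flatten g '' U ∩ halfSpace) →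
    UnifIncluded (unflatten g U '' E) (U ∩ O)

end GaussSobolev

open GaussSobolev

/-!
Composition with the flattening map preserves `W^{1,2}` for the following reasons.

*Change of variables.* The Gaussian measure is invariant under resampling one coordinate from its
law (`measurePreserving_replaceCoord`). On every line of direction `0` the map `flatten g` is a one
dimensional diffeomorphism, so it transports `gaussP a` to a measure with density
`D_0 g * exp ((x_0 ^ 2 - g ^ 2) / (2 a_0 ^ 2))` (`IsFlatPair.map_flatten_restrict`). The bounds in
the condition make this density bounded, hence composition is bounded on `L²`.

*Chain rule.* With `τ` the inverse flattening map, `h = g₂` its first coordinate and `u_i = D_i f`,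
one has `D_i (f ∘ τ) = u_i ∘ τ + (D_i h - δ_{i0}) u_0 ∘ τ` (`IsFlatPair.isWeakPD_comp`). To see
this, test against `φ`, change variables, and move the derivatives off `f` in the two directions
`i` and `0`; the terms with second derivatives of `g` cancel by symmetry. The functions against
which `u_i` and `u_0` are tested are `φ ∘ ψ * D_0 g * ρ` and `φ ∘ ψ * (D_i g - δ_{i0}) * ρ`, where
`ρ` is the exponential factor. These need not be test functions: the unweighted sum of the squares
of their partial derivatives may diverge. They are bounded and continuously differentiable along
the lines of the direction that matters, though, and this suffices for the integration by parts.

*Integration by parts for a single direction.* `IsWeakPD.integral_eq` shows that the identity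
defining `D_i f = u` holds for every function supported well inside the open set that is bounded
and has a bounded derivative in direction `i`, continuous along the lines of that direction.
Products of a function of `x_i` and a function of the other coordinates built from coordinates,
squared distances and smooth real functions are test functions, and such functions separate finite
measures (`ae_eq_zero_on_ball`). Hence the identity holds on almost every line for each of
countably many one-dimensional test functions `κ t * t ^ n` (`IsWeakPD.ae_integral_line_eq_zero`),
and by Weierstrass approximation of the derivative for all `C¹` functions on that line
(`integral_slice_eq_zero`); integrating over the lines gives the claim.

*Norms.* The bound on `∑ a_i ^ 2 (D_i h) ^ 2` and the chain rule give the estimate of the Sobolev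
norm of `f ∘ τ` (`IsFlatPair.memW12_comp`). The implicit relation `h (ψ x) = x_0` expresses `D_i g`
through `D_i h`, so the hypotheses are symmetric in `ψ` and `τ`
(`FlatteningCondition.exists_isFlatPair`), and applying the estimate in both directions gives the
two-sided bounds.
-/

namespace GaussSobolev
open scoped ENNReal Topology
open Filter ProbabilityTheory

variable {𝕜 : Type*} [RCLike 𝕜]

/-! ### Resampling one coordinate of the Gaussian measure -/

theorem continuous_coord (i : ℕ) : Continuous fun x : Ell2 => x i :=
  (continuous_apply i).comp lp.uniformContinuous_coe.continuous

instance : TopologicalSpace.SeparableSpace Ell2 := by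
  have h1 : TopologicalSpace.IsSeparable (Submodule.span ℝ (range stdVec) : Set Ell2) :=
    (countable_range stdVec).isSeparable.span
  have h2 : closure (Submodule.span ℝ (range stdVec) : Set Ell2) = univ := by
    refine eq_univ_of_forall fun x => ?_
    have hx := lp.hasSum_single (E := fun _ : ℕ => ℝ) (p := 2) (by norm_num) x
    refine mem_closure_of_tendsto hx (Eventually.of_forall fun s => ?_)
    refine Submodule.sum_mem _ fun i _ => ?_
    have : (lp.single 2 i (x i) : Ell2) = x i • stdVec i := by
      rw [stdVec, ← lp.single_smul]; simp
    rw [this]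
    exact Submodule.smul_mem _ _ (Submodule.subset_span ⟨i, rfl⟩)
  have h3 := h1.closure
  rw [h2] at h3
  exact TopologicalSpace.isSeparable_univ_iff.1 h3

instance : SecondCountableTopology Ell2 :=
  UniformSpace.secondCountable_of_separable Ell2

theorem measurableEmbedding_coord :
    MeasurableEmbedding fun (x : Ell2) (i : ℕ) => x i := by
  refine Continuous.measurableEmbedding ?_ ?_
  · exact continuous_pi continuous_coord
  · intro x y h
    exact lp.ext h

theorem measurable_coord (i : ℕ) : Measurable fun x : Ell2 => x i :=
  (continuous_coord i).measurable

/-- Replace the coordinate number `i` of `x` by `t`. -/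
noncomputable def replaceCoord (i : ℕ) (t : ℝ) (x : Ell2) : Ell2 := x + (t - x i) • stdVec i

theorem replaceCoord_apply (i : ℕ) (t : ℝ) (x : Ell2) (j : ℕ) :
    replaceCoord i t x j = if j = i then t else x j := by
  have h : replaceCoord i t x j = x j + (t - x i) * stdVec i j := rfl
  rw [h, stdVec_apply]
  by_cases hj : j = i
  · subst hj
    simp
  · simp [hj]

theorem continuous_replaceCoord (i : ℕ) :
    Continuous fun p : ℝ × Ell2 => replaceCoord i p.1 p.2 := by
  unfold replaceCoord
  exact continuous_snd.add ((continuous_fst.sub ((continuous_coord i).comp continuous_snd)).smul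
    continuous_const)

theorem replaceCoord_replaceCoord (i : ℕ) (s t : ℝ) (x : Ell2) :
    replaceCoord i s (replaceCoord i t x) = replaceCoord i s x := by
  refine lp.ext (funext fun j => ?_)
  simp only [replaceCoord_apply]
  split_ifs <;> rfl

theorem replaceCoord_self (i : ℕ) (x : Ell2) : replaceCoord i (x i) x = x := by
  simp [replaceCoord]

theorem replaceCoord_add_smul (i : ℕ) (t s : ℝ) (x : Ell2) :
    replaceCoord i t x + s • stdVec i = replaceCoord i (t + s) x := by
  rw [replaceCoord, replaceCoord, add_assoc, ← add_smul]
  congr 2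
  ring

/-- The law of the coordinate number `i`. -/
noncomputable abbrev coordLaw (a : ℕ → ℝ) (i : ℕ) : Measure ℝ :=
  gaussianReal 0 (Real.toNNReal (a i ^ 2))

/-- Resampling one coordinate of an independent sequence preserves its law. -/
theorem measurePreserving_update (a : ℕ → ℝ) (i : ℕ) :
    MeasurePreserving (fun p : ℝ × (ℕ → ℝ) => Function.update p.2 i p.1)
      ((coordLaw a i).prod (productGaussian a)) (productGaussian a) := by
  have hm : Measurable fun p : ℝ × (ℕ → ℝ) => Function.update p.2 i p.1 := by
    refine measurable_pi_iff.2 fun j => ?_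
    by_cases hj : j = i
    · subst hj; simpa using measurable_fst
    · simp only [Function.update_of_ne hj]
      exact (measurable_pi_apply j).comp measurable_snd
  refine ⟨hm, ?_⟩
  unfold productGaussian
  refine Measure.eq_infinitePi _ fun s t ht => ?_
  rw [Measure.map_apply hm (MeasurableSet.pi s.countable_toSet fun j _ => ht j)]
  by_cases hi : i ∈ s
  · have : (fun p : ℝ × (ℕ → ℝ) => Function.update p.2 i p.1) ⁻¹' (s : Set ℕ).pi t
        = t i ×ˢ ((s.erase i : Finset ℕ) : Set ℕ).pi t := by
      ext ⟨u, z⟩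
      simp only [mem_preimage, Set.mem_pi, mem_prod, Finset.mem_coe, Finset.mem_erase]
      constructor
      · intro h
        refine ⟨by simpa using h i hi, fun j hj => ?_⟩
        simpa [Function.update_of_ne hj.1] using h j hj.2
      · rintro ⟨h1, h2⟩ j hj
        by_cases hji : j = i
        · subst hji; simpa using h1
        · simpa [Function.update_of_ne hji] using h2 j ⟨hji, hj⟩
    rw [this, Measure.prod_prod, Measure.infinitePi_pi _ (fun j _ => ht j),
      Finset.mul_prod_erase s (fun j => (gaussianReal 0 (Real.toNNReal (a j ^ 2))) (t j)) hi]
  · have : (fun p : ℝ × (ℕ → ℝ) => Function.update p.2 i p.1) ⁻¹' (s : Set ℕ).pi t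
        = univ ×ˢ (s : Set ℕ).pi t := by
      ext ⟨u, z⟩
      simp only [mem_preimage, Set.mem_pi, mem_prod, mem_univ, true_and]
      refine forall₂_congr fun j hj => ?_
      have hji : j ≠ i := fun h => hi (h ▸ hj)
      rw [Function.update_of_ne hji]
    rw [this, Measure.prod_prod, Measure.infinitePi_pi _ (fun j _ => ht j)]
    simp

instance (a : ℕ → ℝ) : IsProbabilityMeasure (productGaussian a) := by
  unfold productGaussian; infer_instance

instance (a : ℕ → ℝ) : IsFiniteMeasure (gaussP a) := by
  refine ⟨?_⟩
  rw [gaussP, measurableEmbedding_coord.comap_apply]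
  exact measure_lt_top _ _

/-- Resampling one coordinate from its law preserves the Gaussian measure. -/
theorem measurePreserving_replaceCoord (a : ℕ → ℝ) (i : ℕ) :
    MeasurePreserving (fun p : ℝ × Ell2 => replaceCoord i p.1 p.2)
      ((coordLaw a i).prod (gaussP a)) (gaussP a) := by
  have hm := (continuous_replaceCoord i).measurable
  refine ⟨hm, ?_⟩
  ext A hA
  set ι : Ell2 → ℕ → ℝ := fun x i => x i with hι
  have hA' : MeasurableSet (ι '' A) := measurableEmbedding_coord.measurableSet_image.2 hA
  rw [Measure.map_apply hm hA, Measure.prod_apply (hm hA), gaussP,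
    measurableEmbedding_coord.comap_apply,
    ← (measurePreserving_update a i).measure_preimage hA'.nullMeasurableSet,
    Measure.prod_apply ((measurePreserving_update a i).measurable hA')]
  refine lintegral_congr fun t => ?_
  rw [measurableEmbedding_coord.comap_apply]
  congr 1
  ext z
  simp only [mem_image, mem_preimage]
  constructor
  · rintro ⟨x, hx, rfl⟩
    refine ⟨_, hx, funext fun j => ?_⟩
    exact (replaceCoord_apply i t x j).trans
      (Function.update_apply (fun k : ℕ => (x k : ℝ)) i t j).symm
  · rintro ⟨x, hx, hxz⟩
    refine ⟨replaceCoord i (z i) x, ?_, funext fun j => ?_⟩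
    · have : t = x i := by
        have := congrFun hxz i; simpa using this.symm
      rw [replaceCoord_replaceCoord, this, replaceCoord_self]; exact hx
    · refine (replaceCoord_apply i (z i) x j).trans ?_
      have := congrFun hxz j
      split_ifs with h
      · rw [h]
      · rw [Function.update_of_ne h] at this; exact this

/-- The projection that annihilates the coordinate number `i`. -/
noncomputable abbrev dropCoord (i : ℕ) (x : Ell2) : Ell2 := replaceCoord i 0 x

theorem continuous_dropCoord (i : ℕ) : Continuous (dropCoord i) :=
  (continuous_replaceCoord i).comp (continuous_const.prodMk continuous_id)

/-- The marginal of the Gaussian measure on the hyperplane `x i = 0`. -/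
noncomputable abbrev dropLaw (a : ℕ → ℝ) (i : ℕ) : Measure Ell2 := (gaussP a).map (dropCoord i)

/-- The Gaussian measure is the product of the law of one coordinate and of the marginal on the
complementary hyperplane. -/
theorem measurePreserving_replaceCoord_dropLaw (a : ℕ → ℝ) (i : ℕ) :
    MeasurePreserving (fun p : ℝ × Ell2 => replaceCoord i p.1 p.2)
      ((coordLaw a i).prod (dropLaw a i)) (gaussP a) := by
  have hm := (continuous_replaceCoord i).measurable
  refine ⟨hm, ?_⟩
  have h1 : (coordLaw a i).prod (dropLaw a i) =
      ((coordLaw a i).prod (gaussP a)).map (Prod.map id (dropCoord i)) := by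
    rw [← Measure.map_prod_map _ _ measurable_id (continuous_dropCoord i).measurable, Measure.map_id]
  rw [h1, Measure.map_map hm (measurable_id.prodMap (continuous_dropCoord i).measurable)]
  convert (measurePreserving_replaceCoord a i).map_eq using 2
  ext1 p
  exact replaceCoord_replaceCoord i p.1 0 p.2

theorem ae_dropCoord_eq (a : ℕ → ℝ) (i : ℕ) : ∀ᵐ y ∂(dropLaw a i), dropCoord i y = y := by
  refine (ae_map_iff (continuous_dropCoord i).measurable.aemeasurable
    (measurableSet_eq_fun (continuous_dropCoord i).measurable measurable_id)).2 ?_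
  exact Eventually.of_forall fun y => replaceCoord_replaceCoord i 0 0 y

/-! ### Elementary functions -/

theorem norm_stdVec (i : ℕ) : ‖stdVec i‖ = 1 := by
  simp [stdVec]

theorem inner_stdVec (x : Ell2) (i : ℕ) : inner ℝ x (stdVec i) = x i := by
  rw [stdVec, lp.inner_single_right]
  simp

theorem norm_add_smul_stdVec_sq (x : Ell2) (t : ℝ) (i : ℕ) :
    ‖x + t • stdVec i‖ ^ 2 = ‖x‖ ^ 2 + 2 * t * x i + t ^ 2 := by
  rw [norm_add_sq_real, inner_smul_right, inner_stdVec, norm_smul, norm_stdVec]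
  simp [mul_assoc]

theorem add_smul_stdVec_apply (x : Ell2) (t : ℝ) (i j : ℕ) :
    (x + t • stdVec i) j = x j + if j = i then t else 0 := by
  have h : (x + t • stdVec i) j = x j + t * stdVec i j := rfl
  rw [h, stdVec_apply]
  simp

theorem abs_coord_le_norm (x : Ell2) (i : ℕ) : |x i| ≤ ‖x‖ := by
  have := lp.norm_apply_le_norm (p := 2) (by norm_num) x i
  simpa using this

theorem sum_sq_coord_le (x : Ell2) (s : Finset ℕ) : ∑ i ∈ s, x i ^ 2 ≤ ‖x‖ ^ 2 := by
  have := lp.sum_rpow_le_norm_rpow (p := 2) (by norm_num) x s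
  simpa using this

/-- The algebra of functions generated by the coordinates and by the squared distances to points,
stable under composition with smooth functions of one real variable. It is stable under partial
derivatives and serves as a supply of test functions. -/
inductive IsElementary : (Ell2 → ℝ) → Prop
  | const (c : ℝ) : IsElementary fun _ => c
  | coord (i : ℕ) : IsElementary fun x => x i
  | distSq (c : Ell2) : IsElementary fun x => ‖x - c‖ ^ 2
  | add {f g : Ell2 → ℝ} : IsElementary f → IsElementary g → IsElementary fun x => f x + g x
  | mul {f g : Ell2 → ℝ} : IsElementary f → IsElementary g → IsElementary fun x => f x * g x
  | comp {f : Ell2 → ℝ} (σ : ℝ → ℝ) : ContDiff ℝ (⊤ : ℕ∞) σ → IsElementary f →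
      IsElementary fun x => σ (f x)

namespace IsElementary

variable {f : Ell2 → ℝ}

theorem continuous (hf : IsElementary f) : Continuous f := by
  induction hf with
  | const c => exact continuous_const
  | coord i => exact continuous_coord i
  | distSq c => fun_prop
  | add _ _ h1 h2 => exact h1.add h2
  | mul _ _ h1 h2 => exact h1.mul h2
  | comp σ hσ _ h => exact hσ.continuous.comp h

theorem exists_bound (hf : IsElementary f) (R : ℝ) :
    ∃ M : ℝ, 0 ≤ M ∧ ∀ x, ‖x‖ ≤ R → |f x| ≤ M := by
  induction hf with
  | const c => exact ⟨|c|, abs_nonneg c, fun _ _ => le_rfl⟩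
  | coord i => exact ⟨|R|, abs_nonneg R, fun x hx =>
      (abs_coord_le_norm x i).trans (hx.trans (le_abs_self R))⟩
  | distSq c =>
    refine ⟨(R + ‖c‖) ^ 2, sq_nonneg _, fun x hx => ?_⟩
    rw [abs_of_nonneg (sq_nonneg _)]
    have : ‖x - c‖ ≤ R + ‖c‖ := (norm_sub_le _ _).trans (by gcongr)
    exact pow_le_pow_left₀ (norm_nonneg _) this 2
  | add _ _ h1 h2 =>
    obtain ⟨M, hM0, hM⟩ := h1
    obtain ⟨N, hN0, hN⟩ := h2
    exact ⟨M + N, by positivity, fun x hx =>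
      (abs_add_le _ _).trans (add_le_add (hM x hx) (hN x hx))⟩
  | mul _ _ h1 h2 =>
    obtain ⟨M, hM0, hM⟩ := h1
    obtain ⟨N, hN0, hN⟩ := h2
    refine ⟨M * N, by positivity, fun x hx => ?_⟩
    rw [abs_mul]
    exact mul_le_mul (hM x hx) (hN x hx) (abs_nonneg _) hM0
  | comp σ hσ _ h =>
    obtain ⟨M, hM0, hM⟩ := h
    obtain ⟨C, hC⟩ := (isCompact_Icc (a := -M) (b := M)).exists_bound_of_continuousOn
      hσ.continuous.continuousOn
    exact ⟨|C|, abs_nonneg C, fun x hx =>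
      (hC _ (abs_le.1 (hM x hx))).trans (le_abs_self C)⟩

theorem exists_hasDerivAt (hf : IsElementary f) (i : ℕ) :
    ∃ f' : Ell2 → ℝ, IsElementary f' ∧
      ∀ x, HasDerivAt (fun t : ℝ => f (x + t • stdVec i)) (f' x) 0 := by
  induction hf with
  | const c => exact ⟨_, const 0, fun x => hasDerivAt_const _ _⟩
  | coord j =>
    refine ⟨_, const (if j = i then 1 else 0), fun x => ?_⟩
    simp only [add_smul_stdVec_apply]
    split_ifs
    · exact (hasDerivAt_id (0 : ℝ)).const_add _
    · simpa using hasDerivAt_const (0 : ℝ) (x j)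
  | distSq c =>
    refine ⟨_, ((const 2).mul ((coord i).add (const (-c i)))), fun x => ?_⟩
    have h : ∀ t : ℝ, ‖x + t • stdVec i - c‖ ^ 2
        = ‖x - c‖ ^ 2 + 2 * t * (x i - c i) + t ^ 2 := fun t => by
      rw [add_sub_right_comm, norm_add_smul_stdVec_sq]; rfl
    simp only [h]
    have h1 := ((((hasDerivAt_id (0 : ℝ)).const_mul 2).mul_const (x i - c i)).const_add
      (‖x - c‖ ^ 2)).add ((hasDerivAt_id (0 : ℝ)).pow 2)
    refine h1.congr_deriv ?_
    simp [sub_eq_add_neg]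
  | add _ _ h1 h2 =>
    obtain ⟨f', hf', h⟩ := h1
    obtain ⟨g', hg', k⟩ := h2
    exact ⟨_, hf'.add hg', fun x => (h x).add (k x)⟩
  | @mul f g hf hg h1 h2 =>
    obtain ⟨f', hf', h⟩ := h1
    obtain ⟨g', hg', k⟩ := h2
    refine ⟨_, (hf'.mul hg).add (hf.mul hg'), fun x => ?_⟩
    exact ((h x).mul (k x)).congr_deriv (by simp)
  | @comp f σ hσ hf h1 =>
    obtain ⟨f', hf', h⟩ := h1
    have hσ' := contDiff_infty_iff_deriv.1 hσ
    refine ⟨_, (hf.comp (deriv σ) hσ'.2).mul hf', fun x => ?_⟩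
    have h2 : HasDerivAt σ (deriv σ (f x)) (f (x + (0 : ℝ) • stdVec i)) := by
      simpa using (hσ'.1 (f x)).hasDerivAt
    exact h2.comp 0 (h x)

theorem hasDerivAt (hf : IsElementary f) (i : ℕ) (x : Ell2) :
    HasDerivAt (fun t : ℝ => f (x + t • stdVec i)) (pd i f x) 0 := by
  obtain ⟨f', -, h⟩ := hf.exists_hasDerivAt i
  exact (h x).differentiableAt.hasDerivAt

theorem isElementary_pd (hf : IsElementary f) (i : ℕ) : IsElementary (pd i f) := by
  obtain ⟨f', hf', h⟩ := hf.exists_hasDerivAt i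
  have : pd i f = f' := funext fun x => (h x).deriv
  rwa [this]

theorem isElementary_iterPD (hf : IsElementary f) (l : List ℕ) : IsElementary (iterPD l f) := by
  induction l with
  | nil => exact hf
  | cons i l ih => exact ih.isElementary_pd i

/-- The gradient of an elementary function is bounded on bounded sets. A partial derivative taken
alone is elementary, but the sum over all directions is not covered by the inductive definition. -/
theorem exists_bound_gradient (hf : IsElementary f) (R : ℝ) :
    ∃ M : ℝ, 0 ≤ M ∧ ∀ x, ‖x‖ ≤ R → ∀ s : Finset ℕ, ∑ i ∈ s, pd i f x ^ 2 ≤ M := by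
  induction hf with
  | const c => exact ⟨0, le_rfl, fun x _ s => by simp [pd]⟩
  | coord j =>
    refine ⟨1, zero_le_one, fun x _ s => ?_⟩
    have : ∀ i, pd i (fun x : Ell2 => x j) x ^ 2 = if i = j then 1 else 0 := by
      intro i
      simp only [pd, add_smul_stdVec_apply]
      by_cases h : j = i
      · subst h; simp
      · simp [h, Ne.symm h]
    simp only [this, Finset.sum_ite_eq']
    split_ifs <;> norm_num
  | distSq c =>
    refine ⟨4 * (R + ‖c‖) ^ 2, by positivity, fun x hx s => ?_⟩
    have : ∀ i, pd i (fun x : Ell2 => ‖x - c‖ ^ 2) x = 2 * (x - c) i := by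
      intro i
      have h : ∀ t : ℝ, ‖x + t • stdVec i - c‖ ^ 2
          = ‖x - c‖ ^ 2 + 2 * t * (x - c) i + t ^ 2 := fun t => by
        rw [add_sub_right_comm, norm_add_smul_stdVec_sq]
      simp only [pd, h]
      have h1 := ((((hasDerivAt_id (0 : ℝ)).const_mul 2).mul_const ((x - c) i)).const_add
        (‖x - c‖ ^ 2)).add ((hasDerivAt_id (0 : ℝ)).pow 2)
      refine (h1.congr_deriv ?_).deriv
      simp
    simp only [this, mul_pow, ← Finset.mul_sum]
    have h1 := sum_sq_coord_le (x - c) s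
    have h2 : ‖x - c‖ ≤ R + ‖c‖ := (norm_sub_le _ _).trans (by gcongr)
    have h3 : ‖x - c‖ ^ 2 ≤ (R + ‖c‖) ^ 2 := by gcongr
    linarith
  | @add f g hf hg h1 h2 =>
    obtain ⟨M, hM0, hM⟩ := h1
    obtain ⟨N, hN0, hN⟩ := h2
    refine ⟨2 * M + 2 * N, by positivity, fun x hx s => ?_⟩
    calc ∑ i ∈ s, pd i (fun x => f x + g x) x ^ 2
        ≤ ∑ i ∈ s, (2 * pd i f x ^ 2 + 2 * pd i g x ^ 2) := by
          refine Finset.sum_le_sum fun i _ => ?_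
          rw [show pd i (fun x => f x + g x) x = _ from
            ((hf.hasDerivAt i x).add (hg.hasDerivAt i x)).deriv]
          nlinarith [sq_nonneg (pd i f x - pd i g x)]
      _ ≤ _ := by
          rw [Finset.sum_add_distrib, ← Finset.mul_sum, ← Finset.mul_sum]
          linarith [hM x hx s, hN x hx s]
  | @mul f g hf hg h1 h2 =>
    obtain ⟨M, hM0, hM⟩ := h1
    obtain ⟨N, hN0, hN⟩ := h2
    obtain ⟨A, hA0, hA⟩ := hf.exists_bound R
    obtain ⟨B, hB0, hB⟩ := hg.exists_bound R
    refine ⟨2 * B ^ 2 * M + 2 * A ^ 2 * N, by positivity, fun x hx s => ?_⟩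
    calc ∑ i ∈ s, pd i (fun x => f x * g x) x ^ 2
        ≤ ∑ i ∈ s, (2 * B ^ 2 * pd i f x ^ 2
            + 2 * A ^ 2 * pd i g x ^ 2) := by
          refine Finset.sum_le_sum fun i _ => ?_
          rw [show pd i (fun x => f x * g x) x = _ from
            ((hf.hasDerivAt i x).mul (hg.hasDerivAt i x)).deriv]
          simp only [zero_smul, add_zero]
          have h1 : g x ^ 2 ≤ B ^ 2 := sq_le_sq' (abs_le.1 (hB x hx)).1 (abs_le.1 (hB x hx)).2
          have h2 : f x ^ 2 ≤ A ^ 2 := sq_le_sq' (abs_le.1 (hA x hx)).1 (abs_le.1 (hA x hx)).2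
          have h3 := mul_le_mul_of_nonneg_right h1 (sq_nonneg (pd i f x))
          have h4 := mul_le_mul_of_nonneg_right h2 (sq_nonneg (pd i g x))
          nlinarith [sq_nonneg (pd i f x * g x - f x * pd i g x)]
      _ ≤ _ := by
          rw [Finset.sum_add_distrib, ← Finset.mul_sum, ← Finset.mul_sum]
          have := mul_le_mul_of_nonneg_left (hM x hx s) (by positivity : 0 ≤ 2 * B ^ 2)
          have := mul_le_mul_of_nonneg_left (hN x hx s) (by positivity : 0 ≤ 2 * A ^ 2)
          linarith
  | @comp f σ hσ hf h1 =>
    obtain ⟨M, hM0, hM⟩ := h1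
    have hσ' := contDiff_infty_iff_deriv.1 hσ
    obtain ⟨A, hA0, hA⟩ := (hf.comp (deriv σ) hσ'.2).exists_bound R
    refine ⟨A ^ 2 * M, by positivity, fun x hx s => ?_⟩
    calc ∑ i ∈ s, pd i (fun x => σ (f x)) x ^ 2
        ≤ ∑ i ∈ s, A ^ 2 * pd i f x ^ 2 := by
          refine Finset.sum_le_sum fun i _ => ?_
          have h2 : HasDerivAt σ (deriv σ (f x)) (f (x + (0 : ℝ) • stdVec i)) := by
            simpa using (hσ'.1 (f x)).hasDerivAt
          rw [show pd i (fun x => σ (f x)) x = _ from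
            (h2.comp 0 (hf.hasDerivAt i x)).deriv, mul_pow]
          have h1 := sq_le_sq' (abs_le.1 (hA x hx)).1 (abs_le.1 (hA x hx)).2
          gcongr
      _ ≤ _ := by
          rw [← Finset.mul_sum]
          exact mul_le_mul_of_nonneg_left (hM x hx s) (by positivity)

theorem comp_dropCoord (hf : IsElementary f) (i : ℕ) :
    IsElementary fun x => f (dropCoord i x) := by
  induction hf with
  | const c => exact const c
  | coord j =>
    simp only [dropCoord, replaceCoord_apply]
    by_cases h : j = i
    · simpa [h] using const 0
    · simpa [h] using coord j
  | distSq c =>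
    have : (fun x : Ell2 => ‖dropCoord i x - c‖ ^ 2) = fun x =>
        ‖x - c‖ ^ 2 + (2 * (x i) * (c i) + (-1) * (x i * x i)) := by
      ext x
      rw [dropCoord, replaceCoord, add_sub_right_comm, norm_add_smul_stdVec_sq]
      change _ + 2 * _ * (x i - c i) + _ = _
      ring
    rw [this]
    exact (distSq c).add ((((const 2).mul (coord i)).mul (const (c i))).add
      ((const (-1)).mul ((coord i).mul (coord i))))
  | add _ _ h1 h2 => exact h1.add h2
  | mul _ _ h1 h2 => exact h1.mul h2
  | comp σ hσ _ h => exact h.comp σ hσ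

end IsElementary

theorem iterPD_eq_zero_of_notMem {f : Ell2 → ℝ} {s : Set Ell2} (hs : IsClosed s)
    (h0 : ∀ x, x ∉ s → f x = 0) (l : List ℕ) : ∀ x, x ∉ s → iterPD l f x = 0 := by
  induction l with
  | nil => exact h0
  | cons i l ih =>
    intro x hx
    have hc : Continuous fun t : ℝ => x + t • stdVec i := by fun_prop
    have : ∀ᶠ t : ℝ in 𝓝 0, x + t • stdVec i ∈ sᶜ := by
      refine hc.continuousAt.eventually_mem (hs.isOpen_compl.mem_nhds ?_)
      simpa using hx
    have h2 : (fun t : ℝ => iterPD l f (x + t • stdVec i)) =ᶠ[𝓝 0] fun _ => 0 :=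
      this.mono fun t ht => ih _ ht
    exact h2.deriv_eq.trans (deriv_const _ _)

theorem UnifIncluded.mono {E E' W : Set Ell2} (h : UnifIncluded E W) (hE : E' ⊆ E) :
    UnifIncluded E' W := by
  obtain ⟨r, R, hr, hR, h1, h2⟩ := h
  exact ⟨r, R, hr, hR, fun x hx => h1 x (hE hx), hE.trans h2⟩

/-- An elementary function supported well inside a ball contained in `W` is a test function
on `W`. -/
theorem IsElementary.isTestFun {f : Ell2 → ℝ} (hf : IsElementary f) {W : Set Ell2} {c : Ell2}
    {ρ₁ ρ₂ : ℝ} (hρ : ρ₁ < ρ₂) (hW : Metric.ball c ρ₂ ⊆ W)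
    (h0 : ∀ x, x ∉ Metric.closedBall c ρ₁ → f x = 0) : IsTestFun W f := by
  have hR : ∀ x, x ∈ Metric.closedBall c ρ₁ → ‖x‖ ≤ ‖c‖ + ρ₁ := fun x hx => by
    rw [mem_closedBall_iff_norm] at hx
    calc ‖x‖ = ‖c + (x - c)‖ := by congr 1; abel
      _ ≤ _ := (norm_add_le _ _).trans (by gcongr)
  have hz := fun l => iterPD_eq_zero_of_notMem Metric.isClosed_closedBall h0 l
  have hb : ∀ g : Ell2 → ℝ, IsElementary g → (∀ x, x ∉ Metric.closedBall c ρ₁ → g x = 0) →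
      ∃ M : ℝ, 0 ≤ M ∧ ∀ x, |g x| ≤ M := by
    intro g hg hg0
    obtain ⟨M, hM0, hM⟩ := hg.exists_bound (‖c‖ + ρ₁)
    refine ⟨M, hM0, fun x => ?_⟩
    by_cases hx : x ∈ Metric.closedBall c ρ₁
    · exact hM x (hR x hx)
    · rw [hg0 x hx]; simpa using hM0
  refine ⟨⟨fun l i x _ => ((hf.isElementary_iterPD l).hasDerivAt i x).differentiableAt,
    fun l x _ n => ?_,
    fun l => ?_, fun l _ => ?_⟩, ?_, ?_⟩
  · refine Continuous.continuousOn ((hf.isElementary_iterPD l).continuous.comp ?_)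
    fun_prop
  · exact (hf.isElementary_iterPD l).continuous.measurable.comp measurable_subtype_coe
  · obtain ⟨M, -, hM⟩ := hb _ (hf.isElementary_iterPD l) (hz l)
    exact ⟨M, fun x _ => hM x⟩
  · obtain ⟨M, hM0, hM⟩ := hb f hf h0
    obtain ⟨N, hN0, hN⟩ := hf.exists_bound_gradient (‖c‖ + ρ₁)
    refine ⟨M + N, fun x _ => ?_⟩
    have key : ∀ s : Finset ℕ, ∑ i ∈ s, pd i f x ^ 2 ≤ N := by
      intro s
      by_cases hx : x ∈ Metric.closedBall c ρ₁
      · exact hN x (hR x hx) s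
      · have : ∀ i, pd i f x = 0 := fun i => hz [i] x hx
        simpa [this] using hN0
    have hs : Summable fun i => pd i f x ^ 2 :=
      summable_of_sum_le (fun i => sq_nonneg _) key
    exact ⟨hs, add_le_add (hM x) (hs.tsum_le_of_sum_le key)⟩
  · have h1 : closure {x | x ∈ W ∧ f x ≠ 0} ⊆ Metric.closedBall c ρ₁ := by
      refine closure_minimal (fun x hx => ?_) Metric.isClosed_closedBall
      by_contra h
      exact hx.2 (h0 x h)
    refine UnifIncluded.mono ⟨ρ₂ - ρ₁, ‖c‖ + |ρ₁| + 1, by linarith, by positivity, ?_, ?_⟩ h1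
    · intro x hx
      refine (Metric.ball_subset_ball' ?_).trans hW
      rw [Metric.mem_closedBall] at hx
      linarith
    · intro x hx
      have := hR x hx
      rw [mem_ball_zero_iff]
      linarith [le_abs_self ρ₁]

/-! ### Density of elementary functions and uniqueness of weak derivatives -/

/-- The set `A` is a pointwise limit of elementary functions with values in `[0, 1]`. -/
def IsElementaryLimit (A : Set Ell2) : Prop :=
  ∃ β : ℕ → Ell2 → ℝ, (∀ n, IsElementary (β n)) ∧ (∀ n x, |β n x| ≤ 1) ∧
    ∀ x, Tendsto (fun n => β n x) atTop (𝓝 (A.indicator 1 x))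

theorem exists_elementary_tendsto_indicator_ball (c : Ell2) {ρ : ℝ} (hρ : 0 < ρ) :
    ∃ β : ℕ → Ell2 → ℝ, (∀ n, IsElementary (β n)) ∧ (∀ n x, |β n x| ≤ 1) ∧
      (∀ n x, x ∉ Metric.ball c ρ → β n x = 0) ∧
      ∀ x, Tendsto (fun n => β n x) atTop (𝓝 ((Metric.ball c ρ).indicator 1 x)) := by
  have h0 : ∀ n : ℕ, ∀ x, x ∉ Metric.ball c ρ →
      Real.smoothTransition ((n : ℝ) * (ρ ^ 2 - ‖x - c‖ ^ 2)) = 0 := by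
    intro n x hx
    refine Real.smoothTransition.zero_of_nonpos ?_
    rw [mem_ball_iff_norm, not_lt] at hx
    have : ρ ^ 2 ≤ ‖x - c‖ ^ 2 := by gcongr
    exact mul_nonpos_of_nonneg_of_nonpos n.cast_nonneg (by linarith)
  refine ⟨fun n x => Real.smoothTransition ((n : ℝ) * (ρ ^ 2 - ‖x - c‖ ^ 2)), fun n => ?_,
    fun n x => ?_, h0, fun x => ?_⟩
  · refine IsElementary.comp (fun s => Real.smoothTransition ((n : ℝ) * (ρ ^ 2 - s)))
      (Real.smoothTransition.contDiff.comp ?_) (IsElementary.distSq c)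
    fun_prop
  · rw [abs_of_nonneg (Real.smoothTransition.nonneg _)]
    exact Real.smoothTransition.le_one _
  · by_cases hx : x ∈ Metric.ball c ρ
    · rw [indicator_of_mem hx]
      rw [mem_ball_iff_norm] at hx
      have h1 : 0 < ρ ^ 2 - ‖x - c‖ ^ 2 := by
        have : ‖x - c‖ ^ 2 < ρ ^ 2 := by gcongr
        linarith
      refine tendsto_const_nhds.congr' ?_
      filter_upwards [(tendsto_natCast_atTop_atTop.atTop_mul_const h1).eventually_ge_atTop 1]
        with n hn
      exact (Real.smoothTransition.one_of_one_le hn).symm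
    · rw [indicator_of_notMem hx]
      refine tendsto_const_nhds.congr fun n => (h0 n x hx).symm

/-- Together with `borel_eq_generateFrom_isElementaryLimit` this makes a finite signed measure
determined by its integrals of elementary functions. -/
theorem isPiSystem_isElementaryLimit : IsPiSystem {A | IsElementaryLimit A} := by
  rintro A ⟨β, h1, h2, h3⟩ B ⟨β', h1', h2', h3'⟩ -
  refine ⟨fun n x => β n x * β' n x, fun n => (h1 n).mul (h1' n), fun n x => ?_, fun x => ?_⟩
  · rw [abs_mul]
    exact mul_le_one₀ (h2 n x) (abs_nonneg _) (h2' n x)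
  · have := (h3 x).mul (h3' x)
    rw [← inter_indicator_mul] at this
    have h1 : (fun j : Ell2 => (1 : Ell2 → ℝ) j * (1 : Ell2 → ℝ) j) = 1 := by ext; simp
    rwa [h1] at this

theorem borel_eq_generateFrom_isElementaryLimit :
    (instMeasurableSpaceEll2 : MeasurableSpace Ell2) =
      MeasurableSpace.generateFrom {A | IsElementaryLimit A} := by
  refine le_antisymm ?_ (MeasurableSpace.generateFrom_le ?_)
  · have hb : TopologicalSpace.IsTopologicalBasis
        {A : Set Ell2 | ∃ c : Ell2, ∃ ρ : ℝ, 0 < ρ ∧ A = Metric.ball c ρ} := by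
      refine TopologicalSpace.isTopologicalBasis_of_isOpen_of_nhds ?_ fun x A hx hA => ?_
      · rintro _ ⟨c, ρ, -, rfl⟩
        exact Metric.isOpen_ball
      · obtain ⟨ρ, hρ, h⟩ := Metric.isOpen_iff.1 hA x hx
        exact ⟨_, ⟨x, ρ, hρ, rfl⟩, Metric.mem_ball_self hρ, h⟩
    have : (instMeasurableSpaceEll2 : MeasurableSpace Ell2) = _ := hb.borel_eq_generateFrom
    rw [this]
    refine MeasurableSpace.generateFrom_mono ?_
    rintro _ ⟨c, ρ, hρ, rfl⟩
    obtain ⟨β, h1, h2, -, h3⟩ := exists_elementary_tendsto_indicator_ball c hρ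
    exact ⟨β, h1, h2, h3⟩
  · rintro A ⟨β, h1, -, h3⟩
    have hm : Measurable (A.indicator (1 : Ell2 → ℝ)) :=
      measurable_of_tendsto_metrizable (fun n => (h1 n).continuous.measurable)
        (tendsto_pi_nhds.2 h3)
    exact (measurable_indicator_const_iff (1 : ℝ)).1 hm


/-- A function orthogonal to all elementary functions supported in a ball vanishes almost
everywhere on that ball. -/
theorem ae_eq_zero_on_ball (μ : Measure Ell2) [IsFiniteMeasure μ] {F : Ell2 → 𝕜}
    (hF : Integrable F μ) {c : Ell2} {ρ : ℝ} (hρ : 0 < ρ)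
    (h : ∀ β : Ell2 → ℝ, IsElementary β → (∀ x, x ∉ Metric.ball c ρ → β x = 0) →
      ∫ x, β x • F x ∂μ = 0) :
    ∀ᵐ x ∂μ, x ∈ Metric.ball c ρ → F x = 0 := by
  obtain ⟨θ, hθ1, hθ2, hθ3, hθ4⟩ := exists_elementary_tendsto_indicator_ball c hρ
  set B := Metric.ball c ρ with hB
  have hBm : MeasurableSet B := measurableSet_ball
  have hFB : Integrable (B.indicator F) μ := hF.indicator hBm
  have key : ∀ (β : ℕ → Ell2 → ℝ) (A : Set Ell2), (∀ n, IsElementary (β n)) →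
      (∀ n x, |β n x| ≤ 1) → (∀ x, Tendsto (fun n => β n x) atTop (𝓝 (A.indicator 1 x))) →
      MeasurableSet A → ∫ x in A, B.indicator F x ∂μ = 0 := by
    intro β A h1 h2 h3 hA
    have hlim : Tendsto (fun n => ∫ x, (β n x * θ n x) • F x ∂μ) atTop
        (𝓝 (∫ x in A, B.indicator F x ∂μ)) := by
      rw [← integral_indicator hA]
      refine tendsto_integral_of_dominated_convergence (fun x => ‖F x‖) (fun n => ?_) hF.norm
        (fun n => ?_) ?_
      · exact (((h1 n).mul (hθ1 n)).continuous.aestronglyMeasurable).smul hF.1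
      · refine Eventually.of_forall fun x => ?_
        rw [norm_smul, Real.norm_eq_abs, abs_mul]
        exact mul_le_of_le_one_left (norm_nonneg _)
          (mul_le_one₀ (h2 n x) (abs_nonneg _) (hθ2 n x))
      · refine Eventually.of_forall fun x => ?_
        have := ((h3 x).mul (hθ4 x)).smul_const (F x)
        convert this using 2
        by_cases hxA : x ∈ A <;> by_cases hxB : x ∈ B <;> simp [hxA, hxB]
    have h0 : ∀ n, ∫ x, (β n x * θ n x) • F x ∂μ = 0 := fun n =>
      h _ ((h1 n).mul (hθ1 n)) fun x hx => by rw [hθ3 n x hx, mul_zero]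
    simp only [h0] at hlim
    exact tendsto_nhds_unique hlim tendsto_const_nhds
  have huniv : ∫ x, B.indicator F x ∂μ = 0 := by
    have := key (fun _ _ => 1) univ (fun _ => IsElementary.const 1) (fun _ _ => by simp)
      (fun x => by simp) MeasurableSet.univ
    simpa using this
  have hall : ∀ A, MeasurableSet A → ∫ x in A, B.indicator F x ∂μ = 0 := by
    intro A hA
    induction A, hA using MeasurableSpace.induction_on_inter
      borel_eq_generateFrom_isElementaryLimit isPiSystem_isElementaryLimit with
    | empty => simp
    | basic A hA =>
      have hAm : MeasurableSet A := by
        rw [borel_eq_generateFrom_isElementaryLimit]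
        exact MeasurableSpace.measurableSet_generateFrom hA
      obtain ⟨β, h1, h2, h3⟩ := hA
      exact key β A h1 h2 h3 hAm
    | compl A hA ih => rw [setIntegral_compl hA hFB, ih, huniv, sub_zero]
    | iUnion f hd hf ih =>
      rw [integral_iUnion hf hd hFB.integrableOn]
      simp [ih]
  have hz := hFB.ae_eq_zero_of_forall_setIntegral_eq_zero fun s hs _ => hall s hs
  filter_upwards [hz] with x hx hxB
  rwa [indicator_of_mem hxB] at hx

/-- The weak derivative of a function on an open set is unique up to null sets. -/
theorem IsWeakPD.ae_eq {a : ℕ → ℝ} {W : Set Ell2} (hW : IsOpen W) {i : ℕ} {f u v : Ell2 → 𝕜}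
    (hu : IsWeakPD a W i f u) (hv : IsWeakPD a W i f v) :
    u =ᵐ[(gaussP a).restrict W] v := by
  have hui := hu.1.integrable one_le_two
  have hvi := hv.1.integrable one_le_two
  have hloc : ∀ x : W, ∃ ρ : ℝ, 0 < ρ ∧ Metric.ball x.1 ρ ⊆ W ∧
      ∀ᵐ y ∂((gaussP a).restrict W), y ∈ Metric.ball x.1 ρ → u y - v y = 0 := by
    rintro ⟨x, hx⟩
    obtain ⟨ρ, hρ, hxW⟩ := Metric.isOpen_iff.1 hW x hx
    refine ⟨ρ / 2, by positivity, (Metric.ball_subset_ball (by linarith)).trans hxW, ?_⟩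
    refine ae_eq_zero_on_ball _ (hui.sub hvi) (by positivity) fun β hβ h0 => ?_
    have ht : IsTestFun W β := hβ.isTestFun (ρ₁ := ρ / 2) (by linarith) hxW
      fun y hy => h0 y fun h => hy (Metric.ball_subset_closedBall h)
    obtain ⟨M, hM⟩ := ht.bdd_grad
    have hb : ∀ g : Ell2 → 𝕜, Integrable g ((gaussP a).restrict W) →
        Integrable (fun y => β y • g y) ((gaussP a).restrict W) := by
      intro g hg
      refine hg.bdd_smul M hβ.continuous.aestronglyMeasurable ?_
      filter_upwards [ae_restrict_mem hW.measurableSet] with y hy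
      have h1 := (hM y hy).2
      have h2 : 0 ≤ ∑' i, pd i β y ^ 2 := tsum_nonneg fun i => sq_nonneg _
      rw [Real.norm_eq_abs]
      linarith
    simp only [Pi.sub_apply, smul_sub]
    rw [integral_sub (hb u hui) (hb v hvi), hu.2 β ht, hv.2 β ht, sub_self]
  choose ρ hρ hρW hae using hloc
  -- Countably many of the balls cover `W`, so the exceptional null sets add up to a null set.
  obtain ⟨T, hT, hTW⟩ := TopologicalSpace.isOpen_iUnion_countable
    (fun x : W => Metric.ball x.1 (ρ x)) fun x => Metric.isOpen_ball
  have : ∀ᵐ y ∂((gaussP a).restrict W), ∀ x ∈ T, y ∈ Metric.ball x.1 (ρ x) → u y - v y = 0 :=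
    (ae_ball_iff hT).2 fun x _ => hae x
  filter_upwards [this, ae_restrict_mem hW.measurableSet] with y hy hyW
  have : y ∈ ⋃ x : W, Metric.ball x.1 (ρ x) :=
    mem_iUnion.2 ⟨⟨y, hyW⟩, Metric.mem_ball_self (hρ _)⟩
  rw [← hTW] at this
  obtain ⟨x, hxT, hyx⟩ := mem_iUnion₂.1 this
  exact sub_eq_zero.1 (hy x hxT hyx)

/-! ### Approximation of one-dimensional test functions by polynomials -/

theorem exists_polynomial_derivative_eq (Q : Polynomial ℝ) (c : ℝ) (v : ℝ) :
    ∃ p : Polynomial ℝ, p.derivative = Q ∧ p.eval c = v := by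
  have h : ∃ p : Polynomial ℝ, p.derivative = Q := by
    induction Q using Polynomial.induction_on' with
    | add p q hp hq =>
      obtain ⟨P, rfl⟩ := hp
      obtain ⟨R, rfl⟩ := hq
      exact ⟨P + R, by simp⟩
    | monomial n b =>
      refine ⟨Polynomial.monomial (n + 1) (b / (n + 1)), ?_⟩
      rw [Polynomial.derivative_monomial]
      push_cast
      rw [div_mul_cancel₀ _ (by positivity)]
  obtain ⟨p, rfl⟩ := h
  exact ⟨p + Polynomial.C (v - p.eval c), by simp, by simp⟩

/-- A linear identity between `α` and `α'` that holds for the countably many functions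
`α t = κ t * t ^ n` holds for all continuously differentiable `α` supported where the cutoff `κ`
equals one. -/
theorem integral_smul_add_deriv_smul_eq_zero (ν : Measure ℝ) {m w : ℝ} (hw : 0 < w)
    (hν : ∀ᵐ t ∂ν, t ∈ Icc (m - 2 * w) (m + 2 * w)) {F₀ F₁ : ℝ → 𝕜} (hF₀ : Integrable F₀ ν)
    (hF₁ : Integrable F₁ ν) {κ κ' : ℝ → ℝ} (hκ : ∀ t, HasDerivAt κ (κ' t) t)
    (hκ' : Continuous κ') (hκ1 : ∀ t, |t - m| ≤ w → κ t = 1)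
    (h : ∀ n : ℕ, ∫ t, ((κ t * t ^ n) • F₀ t + (κ' t * t ^ n + κ t * (n * t ^ (n - 1))) • F₁ t) ∂ν
      = 0)
    {α α' : ℝ → ℝ} (hα : ∀ t, HasDerivAt α (α' t) t) (hα' : Continuous α')
    (hα0 : ∀ t, w < |t - m| → α t = 0) :
    ∫ t, (α t • F₀ t + α' t • F₁ t) ∂ν = 0 := by
  set J := Icc (m - 2 * w) (m + 2 * w) with hJ
  have hJc : IsCompact J := isCompact_Icc
  have hκc : Continuous κ := continuous_iff_continuousAt.2 fun t => (hκ t).continuousAt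
  have hαc : Continuous α := continuous_iff_continuousAt.2 fun t => (hα t).continuousAt
  have hint : ∀ (b : ℝ → ℝ) (F : ℝ → 𝕜), Continuous b → Integrable F ν →
      Integrable (fun t => b t • F t) ν := by
    intro b F hb hF
    obtain ⟨C, hC⟩ := hJc.exists_bound_of_continuousOn hb.continuousOn
    exact hF.bdd_smul C hb.aestronglyMeasurable (hν.mono fun t ht => hC t ht)
  have hpoly : ∀ p : Polynomial ℝ,
      ∫ t, ((κ t * p.eval t) • F₀ t + (κ' t * p.eval t + κ t * p.derivative.eval t) • F₁ t) ∂ν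
        = 0 := by
    intro p
    induction p using Polynomial.induction_on' with
    | add p q hp hq =>
      have hp' : Integrable (fun t => (κ t * p.eval t) • F₀ t +
          (κ' t * p.eval t + κ t * p.derivative.eval t) • F₁ t) ν :=
        (hint _ _ (by fun_prop) hF₀).add (hint _ _ (by fun_prop) hF₁)
      have hq' : Integrable (fun t => (κ t * q.eval t) • F₀ t +
          (κ' t * q.eval t + κ t * q.derivative.eval t) • F₁ t) ν :=
        (hint _ _ (by fun_prop) hF₀).add (hint _ _ (by fun_prop) hF₁)
      rw [← add_zero (0 : 𝕜)]
      nth_rewrite 1 [← hp]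
      nth_rewrite 1 [← hq]
      rw [← integral_add hp' hq']
      refine integral_congr_ae (Eventually.of_forall fun t => ?_)
      simp only [Polynomial.eval_add, Polynomial.derivative_add, mul_add, add_smul]
      abel
    | monomial n b =>
      have := congrArg (b • ·) (h n)
      simp only [smul_zero] at this
      rw [← integral_smul] at this
      rw [← this]
      refine integral_congr_ae (Eventually.of_forall fun t => ?_)
      simp only [Polynomial.eval_monomial, Polynomial.derivative_monomial, smul_add, smul_smul]
      congr 2 <;> ring
  obtain ⟨A, hA⟩ := hJc.exists_bound_of_continuousOn hκc.continuousOn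
  obtain ⟨B, hB⟩ := hJc.exists_bound_of_continuousOn hκ'.continuousOn
  -- As `κ = 1` on the support of `α`, one may replace `α` by `κ * α`, and compare with `κ * p`.
  have hκα : ∀ t, κ t * α t = α t := by
    intro t
    rcases le_or_gt (|t - m|) w with ht | ht
    · rw [hκ1 t ht, one_mul]
    · rw [hα0 t ht, mul_zero]
  have hκα' : ∀ t, κ' t * α t + κ t * α' t = α' t := by
    intro t
    have h1 : HasDerivAt (fun t => κ t * α t) _ t := (hκ t).mul (hα t)
    simp only [hκα] at h1
    exact h1.unique (hα t)
  set I₀ := ∫ t, ‖F₀ t‖ ∂ν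
  set I₁ := ∫ t, ‖F₁ t‖ ∂ν
  have hA0 : 0 ≤ A := (norm_nonneg _).trans (hA m ⟨by linarith, by linarith⟩)
  have hB0 : 0 ≤ B := (norm_nonneg _).trans (hB m ⟨by linarith, by linarith⟩)
  have hI₀ : 0 ≤ I₀ := integral_nonneg fun _ => norm_nonneg _
  have hI₁ : 0 ≤ I₁ := integral_nonneg fun _ => norm_nonneg _
  set K := A * (4 * w) * I₀ + (B * (4 * w) + A) * I₁ with hK
  have hest : ∀ ε : ℝ, 0 < ε → ‖∫ t, (α t • F₀ t + α' t • F₁ t) ∂ν‖ ≤ ε * K := by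
    intro ε hε
    -- Approximating `α'` uniformly and integrating gives `C¹` approximation of `α`.
    obtain ⟨Q, hQ⟩ := exists_polynomial_near_of_continuousOn (m - 2 * w) (m + 2 * w) α'
      hα'.continuousOn ε hε
    obtain ⟨p, rfl, hpm⟩ := exists_polynomial_derivative_eq Q (m - 2 * w) (α (m - 2 * w))
    have hdiff : ∀ t ∈ J, |α t - p.eval t| ≤ ε * (4 * w) := by
      intro t ht
      have := Convex.norm_image_sub_le_of_norm_hasDerivWithin_le (s := J)
        (f := fun t => α t - p.eval t) (f' := fun t => α' t - p.derivative.eval t) (C := ε)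
        (x := m - 2 * w) (y := t)
        (fun x _ => ((hα x).sub (p.hasDerivAt x)).hasDerivWithinAt)
        (fun x hx => by
          rw [Real.norm_eq_abs, abs_sub_comm]; exact (hQ x hx).le) (convex_Icc _ _)
        ⟨le_rfl, by linarith⟩ ht
      rw [hpm, sub_self, sub_zero, Real.norm_eq_abs, Real.norm_eq_abs,
        abs_of_nonneg (show 0 ≤ t - (m - 2 * w) by linarith [ht.1])] at this
      refine this.trans ?_
      have := ht.2
      gcongr
      linarith
    have hsub : ∫ t, (α t • F₀ t + α' t • F₁ t) ∂ν =
        ∫ t, ((κ t * (α t - p.eval t)) • F₀ t +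
          (κ' t * (α t - p.eval t) + κ t * (α' t - p.derivative.eval t)) • F₁ t) ∂ν := by
      rw [← sub_zero (∫ t, (α t • F₀ t + α' t • F₁ t) ∂ν), ← hpoly p, ← integral_sub]
      · refine integral_congr_ae (Eventually.of_forall fun t => ?_)
        simp only
        nth_rewrite 1 [← hκα t]
        nth_rewrite 1 [← hκα' t]
        simp only [mul_sub, sub_smul, add_smul]
        abel
      · exact (hint _ _ hαc hF₀).add (hint _ _ hα' hF₁)
      · exact (hint _ _ (by fun_prop) hF₀).add (hint _ _ (by fun_prop) hF₁)
    rw [hsub]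
    refine (norm_integral_le_of_norm_le (g := fun t => ε * (A * (4 * w)) * ‖F₀ t‖ +
      ε * (B * (4 * w) + A) * ‖F₁ t‖) ?_ ?_).trans_eq ?_
    · exact (hF₀.norm.const_mul _).add (hF₁.norm.const_mul _)
    · filter_upwards [hν] with t ht
      have h1 := hdiff t ht
      have h2 : |α' t - p.derivative.eval t| ≤ ε := by
        rw [abs_sub_comm]; exact (hQ t ht).le
      have h3 := hA t ht
      have h4 := hB t ht
      rw [Real.norm_eq_abs] at h3 h4
      refine (norm_add_le _ _).trans ?_
      rw [norm_smul, norm_smul, Real.norm_eq_abs, Real.norm_eq_abs]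
      gcongr
      · rw [abs_mul]
        calc |κ t| * |α t - p.eval t| ≤ A * (ε * (4 * w)) := by gcongr
          _ = _ := by ring
      · refine (abs_add_le _ _).trans ?_
        rw [abs_mul, abs_mul]
        calc |κ' t| * |α t - p.eval t| + |κ t| * |α' t - p.derivative.eval t|
            ≤ B * (ε * (4 * w)) + A * ε := by gcongr
          _ = _ := by ring
    · rw [integral_add (hF₀.norm.const_mul _) (hF₁.norm.const_mul _), integral_const_mul,
        integral_const_mul, hK]
      ring
  have hK0 : 0 ≤ K := by positivity
  refine norm_le_zero_iff.1 (le_of_forall_pos_le_add fun ε hε => ?_)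
  have := hest (ε / (K + 1)) (by positivity)
  rw [zero_add]
  refine this.trans ?_
  rw [div_mul_eq_mul_div, div_le_iff₀ (by positivity)]
  nlinarith

/-! ### Windows and partitions of unity on the line -/

/-- A smooth cutoff equal to one on `[m - w, m + w]` and to zero off `(m - 2 w, m + 2 w)`. -/
noncomputable def windowCutoff (m w t : ℝ) : ℝ :=
  Real.smoothTransition ((4 * w ^ 2 - (t - m) ^ 2) / (3 * w ^ 2))

theorem contDiff_windowCutoff (m w : ℝ) : ContDiff ℝ (⊤ : ℕ∞) (windowCutoff m w) := by
  refine Real.smoothTransition.contDiff.comp ?_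
  fun_prop

theorem windowCutoff_eq_one {m w t : ℝ} (hw : 0 < w) (h : |t - m| ≤ w) :
    windowCutoff m w t = 1 := by
  refine Real.smoothTransition.one_of_one_le ?_
  rw [one_le_div (by positivity)]
  have := sq_le_sq' (abs_le.1 h).1 (abs_le.1 h).2
  linarith

theorem windowCutoff_eq_zero {m w t : ℝ} (hw : 0 < w) (h : 2 * w ≤ |t - m|) :
    windowCutoff m w t = 0 := by
  refine Real.smoothTransition.zero_of_nonpos (div_nonpos_of_nonpos_of_nonneg ?_ (by positivity))
  have : (2 * w) ^ 2 ≤ |t - m| ^ 2 := by gcongr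
  rw [sq_abs] at this
  linarith

theorem hasDerivAt_eq_zero_of_eq_zero_off {b : ℝ → ℝ} {b' t m w : ℝ} (hb : HasDerivAt b b' t)
    (h0 : ∀ s, w < |s - m| → b s = 0) (ht : w < |t - m|) : b' = 0 := by
  have hc : Continuous fun s : ℝ => |s - m| := by fun_prop
  have h1 : b =ᶠ[𝓝 t] fun _ => 0 :=
    (hc.continuousAt.eventually (lt_mem_nhds ht)).mono fun s hs => h0 s hs
  exact (hb.congr_of_eventuallyEq h1.symm).unique (hasDerivAt_const t 0)

/-- The functions `t ↦ κ t * t ^ n`, with `κ` a window cutoff: a countable total family of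
one-dimensional test functions. -/
noncomputable def windowMonomial (m w : ℝ) (n : ℕ) (t : ℝ) : ℝ := windowCutoff m w t * t ^ n

theorem contDiff_windowMonomial (m w : ℝ) (n : ℕ) :
    ContDiff ℝ (⊤ : ℕ∞) (windowMonomial m w n) :=
  (contDiff_windowCutoff m w).mul (contDiff_id.pow n)

theorem windowMonomial_eq_zero {m w t : ℝ} (hw : 0 < w) (n : ℕ) (h : 2 * w < |t - m|) :
    windowMonomial m w n t = 0 := by
  rw [windowMonomial, windowCutoff_eq_zero hw h.le, zero_mul]

theorem abs_sub_le_of_mem_Icc_compl {t m w : ℝ} (h : t ∉ Icc (m - w) (m + w)) :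
    w < |t - m| := by
  by_contra h1
  rw [not_lt, abs_le] at h1
  exact h ⟨by linarith, by linarith⟩

/-- The adjoint identity on one window, extended from window monomials to all continuously
differentiable functions supported in the window. -/
theorem integral_window_eq_zero (γ : Measure ℝ) (v : ℝ) {m w : ℝ} (hw : 0 < w)
    {U F : ℝ → 𝕜} (hU : Integrable U γ) (hF : Integrable F γ)
    (h : ∀ n : ℕ, ∫ t, (windowMonomial m w n t • U t +
      (deriv (windowMonomial m w n) t - t / v * windowMonomial m w n t) • F t) ∂γ = 0)
    {α α' : ℝ → ℝ} (hα : ∀ t, HasDerivAt α (α' t) t) (hα' : Continuous α')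
    (hα0 : ∀ t, w < |t - m| → α t = 0) :
    ∫ t, (α t • U t + (α' t - t / v * α t) • F t) ∂γ = 0 := by
  set J := Icc (m - 2 * w) (m + 2 * w) with hJ
  -- On the compact set `J` the unbounded coefficient `t / v` can be absorbed into `U`.
  have hconv : ∀ b b' : ℝ → ℝ, (∀ t, HasDerivAt b (b' t) t) →
      (∀ t, 2 * w < |t - m| → b t = 0) →
      ∫ t, (b t • U t + (b' t - t / v * b t) • F t) ∂γ =
        ∫ t, (b t • (U t - (t / v) • F t) + b' t • F t) ∂(γ.restrict J) := by
    intro b b' hb hb0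
    rw [← setIntegral_eq_integral_of_forall_compl_eq_zero (s := J)]
    · refine integral_congr_ae (Eventually.of_forall fun t => ?_)
      simp only [smul_sub, sub_smul, smul_smul, mul_comm (b t)]
      abel
    · intro t ht
      have ht' := abs_sub_le_of_mem_Icc_compl ht
      rw [hb0 t ht', hasDerivAt_eq_zero_of_eq_zero_off (hb t) hb0 ht']
      simp
  rw [hconv α α' hα fun t ht => hα0 t (by linarith)]
  have hmem : ∀ᵐ t ∂(γ.restrict J), t ∈ J := ae_restrict_mem measurableSet_Icc
  have hs := contDiff_windowCutoff m w
  have hs' := contDiff_infty_iff_deriv.1 hs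
  have hκ : ∀ t, HasDerivAt (windowCutoff m w) (deriv (windowCutoff m w) t) t := fun t =>
    (hs'.1 t).hasDerivAt
  have hc : Continuous fun t : ℝ => t / v := by fun_prop
  obtain ⟨C, hC⟩ := (isCompact_Icc (a := m - 2 * w) (b := m + 2 * w)).exists_bound_of_continuousOn
    hc.continuousOn
  refine integral_smul_add_deriv_smul_eq_zero (γ.restrict J) hw hmem (hU.restrict.sub ?_)
    hF.restrict hκ hs'.2.continuous (fun t ht => windowCutoff_eq_one hw ht) (fun n => ?_)
    hα hα' hα0
  · exact hF.restrict.bdd_smul C hc.aestronglyMeasurable (hmem.mono fun t ht => hC t ht)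
  · have hd : ∀ t, HasDerivAt (windowMonomial m w n)
        (deriv (windowCutoff m w) t * t ^ n + windowCutoff m w t * (n * t ^ (n - 1))) t :=
      fun t => (hκ t).mul (hasDerivAt_pow n t)
    have h1 := h n
    rw [hconv _ _ (fun t => (hd t).differentiableAt.hasDerivAt)
      fun t ht => windowMonomial_eq_zero hw n ht] at h1
    simp only [fun t => (hd t).deriv] at h1
    exact h1

/-- The `k`-th member of a smooth partition of unity of the line at scale `w`. -/
noncomputable def unitPiece (w : ℝ) (k : ℤ) (t : ℝ) : ℝ :=
  Real.smoothTransition (t / w - k + 1) - Real.smoothTransition (t / w - k)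

theorem contDiff_unitPiece (w : ℝ) (k : ℤ) : ContDiff ℝ (⊤ : ℕ∞) (unitPiece w k) := by
  refine (Real.smoothTransition.contDiff.comp ?_).sub (Real.smoothTransition.contDiff.comp ?_) <;>
  fun_prop

theorem unitPiece_eq_zero {w : ℝ} (hw : 0 < w) {k : ℤ} {t : ℝ} (h : w < |t - k * w|) :
    unitPiece w k t = 0 := by
  have h2 : t / w - k = (t - k * w) / w := by field_simp
  rcases lt_abs.1 h with h | h
  · have : 1 ≤ t / w - k := by rw [h2, one_le_div hw]; exact h.le
    rw [unitPiece, Real.smoothTransition.one_of_one_le this,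
      Real.smoothTransition.one_of_one_le (by linarith), sub_self]
  · have : t / w - k ≤ -1 := by rw [h2, div_le_iff₀ hw]; linarith
    rw [unitPiece, Real.smoothTransition.zero_of_nonpos (by linarith),
      Real.smoothTransition.zero_of_nonpos (by linarith), sub_self]

theorem sum_unitPiece {w R : ℝ} (hw : 0 < w) {N : ℕ} (hN : R ≤ N * w) {t : ℝ} (ht : |t| ≤ R) :
    ∑ j ∈ Finset.range (2 * N + 1), unitPiece w ((j : ℤ) - N) t = 1 := by
  have h1 : ∀ j : ℕ, unitPiece w ((j : ℤ) - N) t =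
      (fun j : ℕ => Real.smoothTransition (t / w + N + 1 - j)) j -
      (fun j : ℕ => Real.smoothTransition (t / w + N + 1 - j)) (j + 1) := by
    intro j
    simp only [unitPiece]
    push_cast
    congr 2 <;> ring
  simp only [h1]
  rw [Finset.sum_range_sub']
  have h2 : -N ≤ t / w := by rw [le_div_iff₀ hw]; linarith [neg_abs_le t]
  have h3 : t / w ≤ N := by rw [div_le_iff₀ hw]; linarith [le_abs_self t]
  rw [Real.smoothTransition.one_of_one_le (by push_cast; linarith),
    Real.smoothTransition.zero_of_nonpos (by push_cast; linarith), sub_zero]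

/-- The one-dimensional adjoint identity is local: it holds for a compactly supported continuously
differentiable function as soon as it holds for the monomials of each window of width `w` that
meets the support. -/
theorem integral_slice_eq_zero (γ : Measure ℝ) (v : ℝ) {w R : ℝ} (hw : 0 < w)
    {U F : ℝ → 𝕜} (hU : Integrable U γ) (hF : Integrable F γ)
    {α α' : ℝ → ℝ} (hα : ∀ t, HasDerivAt α (α' t) t) (hα' : Continuous α')
    (hα0 : ∀ t, α t ≠ 0 → |t| ≤ R)
    (h : ∀ k : ℤ, (∃ t, |t - k * w| ≤ w ∧ α t ≠ 0) → ∀ n : ℕ,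
      ∫ t, (windowMonomial (k * w) w n t • U t +
        (deriv (windowMonomial (k * w) w n) t - t / v * windowMonomial (k * w) w n t) • F t) ∂γ
        = 0) :
    ∫ t, (α t • U t + (α' t - t / v * α t) • F t) ∂γ = 0 := by
  obtain ⟨N, hN⟩ := exists_nat_ge (R / w)
  rw [div_le_iff₀ hw] at hN
  have hαc : Continuous α := continuous_iff_continuousAt.2 fun t => (hα t).continuousAt
  set β : ℕ → ℝ → ℝ := fun j t => unitPiece w ((j : ℤ) - N) t * α t with hβ
  set β' : ℕ → ℝ → ℝ := fun j t => deriv (unitPiece w ((j : ℤ) - N)) t * α t +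
    unitPiece w ((j : ℤ) - N) t * α' t with hβ'
  have hu := fun k => contDiff_infty_iff_deriv.1 (contDiff_unitPiece w k)
  have hd : ∀ j t, HasDerivAt (β j) (β' j t) t := fun j t =>
    ((hu _).1 t).hasDerivAt.mul (hα t)
  have hc' : ∀ j, Continuous (β' j) := fun j =>
    ((hu _).2.continuous.mul hαc).add ((contDiff_unitPiece w _).continuous.mul hα')
  have hsum : ∀ t, ∑ j ∈ Finset.range (2 * N + 1), β j t = α t := by
    intro t
    simp only [hβ, ← Finset.sum_mul]
    by_cases ht : α t = 0
    · rw [ht, mul_zero]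
    · rw [sum_unitPiece hw hN (hα0 t ht), one_mul]
  have hsum' : ∀ t, ∑ j ∈ Finset.range (2 * N + 1), β' j t = α' t := by
    intro t
    have h1 := HasDerivAt.fun_sum (u := Finset.range (2 * N + 1)) fun j _ => hd j t
    simp only [hsum] at h1
    exact h1.unique (hα t)
  have hβ0 : ∀ (j : ℕ) t, w < |t - ((j : ℤ) - N : ℤ) * w| → β j t = 0 := by
    intro j t ht
    simp only [hβ, unitPiece_eq_zero hw ht, zero_mul]
  have hzero : ∀ j : ℕ, ∫ t, (β j t • U t + (β' j t - t / v * β j t) • F t) ∂γ = 0 := by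
    intro j
    by_cases hex : ∃ t, |t - ((j : ℤ) - N : ℤ) * w| ≤ w ∧ α t ≠ 0
    · exact integral_window_eq_zero γ v hw hU hF (h _ hex) (hd j) (hc' j) (hβ0 j)
    · push Not at hex
      have h0 : ∀ t, β j t = 0 := by
        intro t
        rcases lt_or_ge w (|t - ((j : ℤ) - N : ℤ) * w|) with ht | ht
        · exact hβ0 j t ht
        · simp only [hβ, hex t ht, mul_zero]
      have h0' : ∀ t, β' j t = 0 := fun t =>
        hasDerivAt_eq_zero_of_eq_zero_off (m := t) (w := -1) (hd j t) (fun s _ => h0 s)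
          (by simp)
      simp [h0, h0']
  have hint : ∀ j : ℕ, Integrable (fun t => β j t • U t + (β' j t - t / v * β j t) • F t) γ := by
    intro j
    set m : ℝ := ((j : ℤ) - N : ℤ) * w
    have hb : ∀ (b : ℝ → ℝ) (G : ℝ → 𝕜), Continuous b → (∀ t, w < |t - m| → b t = 0) →
        Integrable G γ → Integrable (fun t => b t • G t) γ := by
      intro b G hbc hb0 hG
      obtain ⟨C, hC⟩ := (isCompact_Icc (a := m - w) (b := m + w)).exists_bound_of_continuousOn
        hbc.continuousOn
      refine hG.bdd_smul |C| hbc.aestronglyMeasurable (Eventually.of_forall fun t => ?_)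
      by_cases ht : t ∈ Icc (m - w) (m + w)
      · exact (hC t ht).trans (le_abs_self C)
      · rw [hb0 t (abs_sub_le_of_mem_Icc_compl ht), norm_zero]
        exact abs_nonneg C
    have hβc : Continuous (β j) := continuous_iff_continuousAt.2 fun t => (hd j t).continuousAt
    refine (hb _ _ hβc (hβ0 j) hU).add (hb _ _ ((hc' j).sub (by fun_prop)) (fun t ht => ?_) hF)
    rw [hβ0 j t ht, hasDerivAt_eq_zero_of_eq_zero_off (hd j t) (hβ0 j) ht]
    simp
  have : ∀ t, α t • U t + (α' t - t / v * α t) • F t =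
      ∑ j ∈ Finset.range (2 * N + 1), (β j t • U t + (β' j t - t / v * β j t) • F t) := by
    intro t
    rw [Finset.sum_add_distrib, ← Finset.sum_smul, ← Finset.sum_smul, Finset.sum_sub_distrib,
      ← Finset.mul_sum, hsum, hsum']
  simp only [this]
  rw [integral_finsetSum _ fun j _ => hint j]
  exact Finset.sum_eq_zero fun j _ => hzero j

/-! ### Weak derivatives tested against functions that are smooth in one direction -/

/-- Bounded measurable functions on `W` that are continuously differentiable along the lines of
direction `i`, with bounded derivative `Φ'`. -/
structure IsLineC1 (W : Set Ell2) (i : ℕ) (Φ Φ' : Ell2 → ℝ) : Prop where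
  meas : Measurable (W.indicator Φ)
  meas' : Measurable (W.indicator Φ')
  bdd : ∃ M : ℝ, ∀ x ∈ W, |Φ x| ≤ M ∧ |Φ' x| ≤ M
  hasDeriv : ∀ x ∈ W, HasDerivAt (fun t : ℝ => Φ (x + t • stdVec i)) (Φ' x) 0
  cont : ∀ x ∈ W, ContinuousAt (fun t : ℝ => Φ' (x + t • stdVec i)) 0

/-- Functions on `W` that are admissible in the weak formulation of the single derivative `D_i`:
in addition to `IsLineC1` they are supported well inside `W`, but nothing is required of the other
partial derivatives. -/
structure IsLineTestFun (W : Set Ell2) (i : ℕ) (Φ Φ' : Ell2 → ℝ) : Prop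
    extends IsLineC1 W i Φ Φ' where
  supp : UnifIncluded {x | x ∈ W ∧ Φ x ≠ 0} W

theorem continuous_line (x : Ell2) (i : ℕ) : Continuous fun t : ℝ => x + t • stdVec i := by
  fun_prop

theorem eventually_line_mem {W : Set Ell2} (hW : IsOpen W) {x : Ell2} (hx : x ∈ W) (i : ℕ) :
    ∀ᶠ t : ℝ in 𝓝 0, x + t • stdVec i ∈ W := by
  refine (continuous_line x i).continuousAt.eventually_mem (hW.mem_nhds ?_)
  simpa using hx

theorem norm_smul_stdVec (t : ℝ) (i : ℕ) : ‖t • stdVec i‖ = |t| := by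
  rw [norm_smul, norm_stdVec, mul_one, Real.norm_eq_abs]

namespace IsLineTestFun

variable {W : Set Ell2} {i : ℕ} {Φ Φ' : Ell2 → ℝ}

/-- On every line of direction `i` the extension by zero vanishes near the points outside `W`, with
a uniform margin. Hence the extension is continuously differentiable along whole lines. -/
theorem exists_indicator_eq_zero (hW : IsOpen W) (h : IsLineTestFun W i Φ Φ') :
    ∃ r : ℝ, 0 < r ∧ ∀ x ∉ W, ∀ t : ℝ, |t| < r →
      W.indicator Φ (x + t • stdVec i) = 0 ∧ W.indicator Φ' (x + t • stdVec i) = 0 := by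
  obtain ⟨r, R, hr, -, h1, -⟩ := h.supp
  have key : ∀ x ∉ W, ∀ t : ℝ, |t| < r → W.indicator Φ (x + t • stdVec i) = 0 := by
    intro x hx t ht
    by_contra h0
    have hm : x + t • stdVec i ∈ W := mem_of_indicator_ne_zero h0
    rw [indicator_of_mem hm] at h0
    refine hx (h1 _ ⟨hm, h0⟩ ?_)
    rw [mem_ball_iff_norm]
    simpa [norm_stdVec, norm_smul] using ht
  refine ⟨r, hr, fun x hx t ht => ⟨key x hx t ht, ?_⟩⟩
  by_cases hm : x + t • stdVec i ∈ W
  · rw [indicator_of_mem hm]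
    have hz : (fun s : ℝ => Φ (x + t • stdVec i + s • stdVec i)) =ᶠ[𝓝 0] fun _ => 0 := by
      have hs : ∀ᶠ s : ℝ in 𝓝 0, |t + s| < r := by
        have hc : Continuous fun s : ℝ => |t + s| := by fun_prop
        exact hc.continuousAt.eventually (gt_mem_nhds (by simpa using ht))
      filter_upwards [hs, eventually_line_mem hW hm i] with s hs hb
      rw [add_assoc, ← add_smul] at hb ⊢
      rw [← indicator_of_mem hb Φ]
      exact key x hx (t + s) hs
    exact ((h.hasDeriv _ hm).congr_of_eventuallyEq hz.symm).unique (hasDerivAt_const _ _)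
  · rw [indicator_of_notMem hm]

theorem hasDerivAt_indicator (hW : IsOpen W) (h : IsLineTestFun W i Φ Φ') (x : Ell2) (t : ℝ) :
    HasDerivAt (fun s : ℝ => W.indicator Φ (x + s • stdVec i))
      (W.indicator Φ' (x + t • stdVec i)) t := by
  have h0 : ∀ x : Ell2, HasDerivAt (fun s : ℝ => W.indicator Φ (x + s • stdVec i))
      (W.indicator Φ' x) 0 := by
    intro x
    by_cases hx : x ∈ W
    · rw [indicator_of_mem hx]
      refine (h.hasDeriv x hx).congr_of_eventuallyEq ?_
      filter_upwards [eventually_line_mem hW hx i] with s hs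
      rw [indicator_of_mem hs]
    · rw [indicator_of_notMem hx]
      obtain ⟨r, hr, hr0⟩ := h.exists_indicator_eq_zero hW
      refine (hasDerivAt_const (0 : ℝ) (0 : ℝ)).congr_of_eventuallyEq ?_
      filter_upwards [Metric.ball_mem_nhds (0 : ℝ) hr] with s hs
      exact (hr0 x hx s (by simpa using hs)).1
  have h1 := (h0 (x + t • stdVec i))
  have h2 : HasDerivAt (fun s : ℝ => s - t) 1 t := (hasDerivAt_id t).sub_const t
  have h3 := HasDerivAt.scomp_of_eq t h1 h2 (sub_self t).symm
  simp only [one_smul] at h3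
  refine h3.congr_of_eventuallyEq (Eventually.of_forall fun s => ?_)
  simp only [Function.comp, add_assoc, ← add_smul]
  rw [add_sub_cancel]

theorem continuous_indicator (hW : IsOpen W) (h : IsLineTestFun W i Φ Φ') (x : Ell2) :
    Continuous (fun s : ℝ => W.indicator Φ' (x + s • stdVec i)) := by
  have h0 : ∀ x : Ell2, ContinuousAt (fun s : ℝ => W.indicator Φ' (x + s • stdVec i)) 0 := by
    intro x
    by_cases hx : x ∈ W
    · refine (h.cont x hx).congr ?_
      filter_upwards [eventually_line_mem hW hx i] with s hs
      rw [indicator_of_mem hs]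
    · obtain ⟨r, hr, hr0⟩ := h.exists_indicator_eq_zero hW
      refine (continuousAt_const (y := (0 : ℝ))).congr ?_
      filter_upwards [Metric.ball_mem_nhds (0 : ℝ) hr] with s hs
      exact ((hr0 x hx s (by simpa using hs)).2).symm
  refine continuous_iff_continuousAt.2 fun t => ?_
  have h2 : ContinuousAt (fun s : ℝ => s - t) t := by fun_prop
  have h3 := (h0 (x + t • stdVec i)).comp_of_eq h2 (sub_self t)
  refine h3.congr (Eventually.of_forall fun s => ?_)
  simp only [Function.comp, add_assoc, ← add_smul]
  rw [add_sub_cancel]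

end IsLineTestFun

theorem replaceCoord_eq_dropCoord_add (i : ℕ) (t : ℝ) (z : Ell2) :
    replaceCoord i t z = dropCoord i z + t • stdVec i := by
  rw [dropCoord, replaceCoord_add_smul, zero_add]

theorem replaceCoord_apply_self (i : ℕ) (t : ℝ) (z : Ell2) : replaceCoord i t z i = t := by
  rw [replaceCoord_apply, if_pos rfl]

theorem dropCoord_add_smul (i : ℕ) (z : Ell2) : dropCoord i z + z i • stdVec i = z := by
  rw [← replaceCoord_eq_dropCoord_add, replaceCoord_self]

theorem norm_dropCoord_sub_le (i : ℕ) (x y : Ell2) : ‖dropCoord i x - dropCoord i y‖ ≤ ‖x - y‖ := by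
  have h : dropCoord i x - dropCoord i y = (x - y) + (-((x - y) i)) • stdVec i := by
    simp only [dropCoord, replaceCoord]
    have : (x - y) i = x i - y i := rfl
    rw [this, zero_sub, zero_sub, neg_sub, sub_smul, neg_smul, neg_smul]
    abel
  refine (pow_le_pow_iff_left₀ (norm_nonneg _) (norm_nonneg _) two_ne_zero).1 ?_
  rw [h, norm_add_smul_stdVec_sq]
  nlinarith [sq_nonneg ((x - y) i)]

theorem setIntegral_smul_eq_integral_smul_indicator {W : Set Ell2} (hW : MeasurableSet W)
    (μ : Measure Ell2) (d : Ell2 → ℝ) (g : Ell2 → 𝕜) :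
    ∫ y in W, d y • g y ∂μ = ∫ y, d y • W.indicator g y ∂μ := by
  rw [← integral_indicator hW]
  refine integral_congr_ae (Eventually.of_forall fun y => ?_)
  by_cases hy : y ∈ W <;> simp [hy]

theorem integral_gaussP_eq {a : ℕ → ℝ} (i : ℕ) {G : Ell2 → 𝕜} (hG : Integrable G (gaussP a)) :
    ∫ y, G y ∂(gaussP a) = ∫ z, ∫ t, G (replaceCoord i t z) ∂(coordLaw a i) ∂(dropLaw a i) := by
  have hmp := measurePreserving_replaceCoord_dropLaw a i
  have h1 := integral_prod_symm _ (hmp.integrable_comp_of_integrable hG)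
  simp only [Function.comp] at h1
  rw [← h1, ← hmp.map_eq, integral_map hmp.measurable.aemeasurable
    (by rw [hmp.map_eq]; exact hG.1)]

/-- For almost every line of direction `i` that meets the neighbourhood of a point of `W`, the
adjoint identity holds on that line for every window monomial of a fixed window. -/
theorem IsWeakPD.ae_integral_line_eq_zero {a : ℕ → ℝ} {W : Set Ell2} (hW : IsOpen W) {i : ℕ}
    {f u : Ell2 → 𝕜} (hf : MemLp f 2 ((gaussP a).restrict W)) (hu : IsWeakPD a W i f u)
    {x : Ell2} {r m w : ℝ} (hr : 0 < r) (hx : Metric.ball x r ⊆ W) (hw : 0 < w)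
    (hwr : 12 * w ≤ r) (hm : |x i - m| ≤ w) (n : ℕ) :
    ∀ᵐ z ∂(dropLaw a i), z ∈ Metric.ball (dropCoord i x) (r / 4) →
      ∫ t, (windowMonomial m w n t • W.indicator u (replaceCoord i t z) +
        (deriv (windowMonomial m w n) t - t / a i ^ 2 * windowMonomial m w n t) •
          W.indicator f (replaceCoord i t z)) ∂(coordLaw a i) = 0 := by
  set b := windowMonomial m w n with hb
  have hbs := contDiff_windowMonomial m w n
  have hbs' := contDiff_infty_iff_deriv.1 hbs
  have hbd : ∀ t, HasDerivAt b (deriv b t) t := fun t => (hbs'.1 t).hasDerivAt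
  have hb0 : ∀ t, 2 * w < |t - m| → b t = 0 := fun t ht => windowMonomial_eq_zero hw n ht
  set c : ℝ → ℝ := fun t => deriv b t - t / a i ^ 2 * b t with hc
  have hcc : Continuous c := hbs'.2.continuous.sub (by
    have := hbs.continuous
    fun_prop)
  have hc0 : ∀ t, 2 * w < |t - m| → c t = 0 := fun t ht => by
    rw [hc]; simp only
    rw [hb0 t ht, hasDerivAt_eq_zero_of_eq_zero_off (hbd t) hb0 ht]; simp
  have hui : Integrable (W.indicator u) (gaussP a) :=
    (integrable_indicator_iff hW.measurableSet).2 (hu.1.integrable one_le_two)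
  have hfi : Integrable (W.indicator f) (gaussP a) :=
    (integrable_indicator_iff hW.measurableSet).2 (hf.integrable one_le_two)
  have hbound : ∀ d : ℝ → ℝ, Continuous d → (∀ t, 2 * w < |t - m| → d t = 0) →
      ∃ C : ℝ, ∀ t, ‖d t‖ ≤ C := by
    intro d hd hd0
    obtain ⟨C, hC⟩ := (isCompact_Icc (a := m - 2 * w) (b := m + 2 * w)).exists_bound_of_continuousOn
      hd.continuousOn
    refine ⟨|C|, fun t => ?_⟩
    by_cases ht : t ∈ Icc (m - 2 * w) (m + 2 * w)
    · exact (hC t ht).trans (le_abs_self C)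
    · rw [hd0 t (abs_sub_le_of_mem_Icc_compl ht), norm_zero]
      exact abs_nonneg C
  obtain ⟨B, hB⟩ := hbound b hbs.continuous hb0
  obtain ⟨C, hC⟩ := hbound c hcc hc0
  set H : Ell2 → 𝕜 := fun y => b (y i) • W.indicator u y + c (y i) • W.indicator f y with hH
  have hHi : Integrable H (gaussP a) :=
    (hui.bdd_smul B (hbs.continuous.comp (continuous_coord i)).aestronglyMeasurable
      (Eventually.of_forall fun y => hB _)).add
    (hfi.bdd_smul C (hcc.comp (continuous_coord i)).aestronglyMeasurable
      (Eventually.of_forall fun y => hC _))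
  have hmp := measurePreserving_replaceCoord_dropLaw a i
  have hHp : Integrable (fun p : ℝ × Ell2 => H (replaceCoord i p.1 p.2))
      ((coordLaw a i).prod (dropLaw a i)) := hmp.integrable_comp_of_integrable hHi
  have hHr : ∀ t z, H (replaceCoord i t z) = b t • W.indicator u (replaceCoord i t z) +
      c t • W.indicator f (replaceCoord i t z) := by
    intro t z
    simp only [hH, replaceCoord_apply_self]
  change ∀ᵐ z ∂(dropLaw a i), z ∈ Metric.ball (dropCoord i x) (r / 4) →
      ∫ t, (b t • W.indicator u (replaceCoord i t z) +
        c t • W.indicator f (replaceCoord i t z)) ∂(coordLaw a i) = 0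
  simp only [← hHr]
  refine ae_eq_zero_on_ball (dropLaw a i) hHp.integral_prod_right (by positivity) fun β hβ hβ0 => ?_
  -- The window monomial in the coordinate `i`, times an elementary function of the others.
  have hφ : IsElementary fun y => b (y i) * β (dropCoord i y) :=
    ((IsElementary.coord i).comp b hbs).mul (hβ.comp_dropCoord i)
  have hsupp : ∀ y, y ∉ Metric.closedBall x (r / 2) → b (y i) * β (dropCoord i y) = 0 := by
    intro y hy
    by_contra h0
    have h1 : |y i - m| ≤ 2 * w := not_lt.1 fun h => h0 (by rw [hb0 _ h, zero_mul])
    have h2 : dropCoord i y ∈ Metric.ball (dropCoord i x) (r / 4) :=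
      by_contra fun h => h0 (by rw [hβ0 _ h, mul_zero])
    rw [mem_ball_iff_norm] at h2
    refine hy (mem_closedBall_iff_norm.2 ?_)
    have h3 : y - x = (dropCoord i y - dropCoord i x) + (y i - x i) • stdVec i := by
      nth_rewrite 1 [← dropCoord_add_smul i y, ← dropCoord_add_smul i x]
      rw [sub_smul]
      abel
    rw [h3]
    refine (norm_add_le _ _).trans ?_
    rw [norm_smul_stdVec]
    have h4 : |y i - x i| ≤ |y i - m| + |x i - m| := by
      rw [abs_sub_comm (x i) m]; exact abs_sub_le _ _ _
    linarith
  have ht : IsTestFun W fun y => b (y i) * β (dropCoord i y) :=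
    hφ.isTestFun (by linarith : r / 2 < r) hx hsupp
  have hpd : ∀ y, pd i (fun y => b (y i) * β (dropCoord i y)) y
      = deriv b (y i) * β (dropCoord i y) := by
    intro y
    have h1 : ∀ t : ℝ, dropCoord i (y + t • stdVec i) = dropCoord i y := fun t => by
      conv_lhs => rw [← replaceCoord_self i y, replaceCoord_add_smul]
      rw [dropCoord, replaceCoord_replaceCoord]
    have h2 : ∀ t : ℝ, (y + t • stdVec i) i = y i + t := fun t => by
      rw [add_smul_stdVec_apply, if_pos rfl]
    simp only [pd, h1, h2]
    have h3 : HasDerivAt (fun t : ℝ => b (y i + t)) (deriv b (y i)) 0 := by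
      have := (hbd (y i + 0)).comp_const_add (y i) 0
      simpa using this
    exact (h3.mul_const _).deriv
  have hadj : ∀ y, pdAdj a i (fun y => b (y i) * β (dropCoord i y)) y
      = -(c (y i) * β (dropCoord i y)) := by
    intro y
    rw [pdAdj, hpd, hc]
    ring
  have hid := hu.2 _ ht
  simp only [hadj] at hid
  obtain ⟨M, hM⟩ : ∃ M : ℝ, ∀ y, ‖β (dropCoord i y)‖ ≤ M := by
    obtain ⟨M, hM0, hM⟩ := hβ.exists_bound (‖dropCoord i x‖ + r)
    refine ⟨M, fun y => ?_⟩
    by_cases hy : dropCoord i y ∈ Metric.ball (dropCoord i x) (r / 4)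
    · refine hM _ ?_
      rw [mem_ball_iff_norm] at hy
      have : ‖dropCoord i y‖ ≤ ‖dropCoord i x‖ + ‖dropCoord i y - dropCoord i x‖ := by
        simpa using norm_add_le (dropCoord i x) (dropCoord i y - dropCoord i x)
      linarith
    · rw [hβ0 _ hy, norm_zero]; exact hM0
  have hβm : ∀ (G : Ell2 → 𝕜), Integrable G (gaussP a) →
      Integrable (fun y => β (dropCoord i y) • G y) (gaussP a) := fun G hG =>
    hG.bdd_smul M (hβ.comp_dropCoord i).continuous.aestronglyMeasurable (Eventually.of_forall hM)
  have hzero : ∫ y, β (dropCoord i y) • H y ∂(gaussP a) = 0 := by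
    rw [setIntegral_smul_eq_integral_smul_indicator hW.measurableSet,
      setIntegral_smul_eq_integral_smul_indicator hW.measurableSet, ← sub_eq_zero,
      ← integral_sub] at hid
    · rw [← hid]
      refine integral_congr_ae (Eventually.of_forall fun y => ?_)
      simp only [hH, smul_add, smul_smul, neg_smul, sub_neg_eq_add, mul_comm (β _)]
    · have := hβm _ (hui.bdd_smul B (hbs.continuous.comp (continuous_coord i)).aestronglyMeasurable
        (Eventually.of_forall fun y => hB _))
      refine this.congr (Eventually.of_forall fun y => ?_)
      simp only [Pi.smul_apply', Function.comp, smul_smul, mul_comm (β _), hb]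
    · have := (hβm _ (hfi.bdd_smul C (hcc.comp (continuous_coord i)).aestronglyMeasurable
        (Eventually.of_forall fun y => hC _))).neg
      refine this.congr (Eventually.of_forall fun y => ?_)
      simp only [Pi.neg_apply, Pi.smul_apply', Function.comp, smul_smul, mul_comm (β _), neg_smul]
  rw [← hzero, integral_gaussP_eq i (hβm H hHi)]
  refine integral_congr_ae ?_
  filter_upwards [ae_dropCoord_eq a i] with z hz
  simp only [dropCoord, replaceCoord_replaceCoord]
  rw [integral_smul]
  rw [dropCoord] at hz
  rw [hz]

/-- The defining identity of a weak derivative extends from test functions to all line test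
functions. -/
theorem IsWeakPD.integral_eq {a : ℕ → ℝ} {W : Set Ell2} (hW : IsOpen W) {i : ℕ}
    {f u : Ell2 → 𝕜} (hf : MemLp f 2 ((gaussP a).restrict W)) (hu : IsWeakPD a W i f u)
    {Φ Φ' : Ell2 → ℝ} (hΦ : IsLineTestFun W i Φ Φ') :
    ∫ x in W, Φ x • u x ∂(gaussP a) =
      ∫ x in W, (-Φ' x + x i / a i ^ 2 * Φ x) • f x ∂(gaussP a) := by
  have hui : Integrable (W.indicator u) (gaussP a) :=
    (integrable_indicator_iff hW.measurableSet).2 (hu.1.integrable one_le_two)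
  have hfi : Integrable (W.indicator f) (gaussP a) :=
    (integrable_indicator_iff hW.measurableSet).2 (hf.integrable one_le_two)
  have hmp := measurePreserving_replaceCoord_dropLaw a i
  obtain ⟨r, R, hr, hR, hrW, hER⟩ := hΦ.supp
  obtain ⟨M, hM⟩ := hΦ.bdd
  set E := {x | x ∈ W ∧ Φ x ≠ 0} with hE
  -- With this width, a point of a window and a nearby point of the support stay within the margin
  -- `r` that the support keeps from the complement of `W`.
  set w := r / 12 with hw
  have hw0 : 0 < w := by positivity
  -- For each window a countable dense set of points of the support lying over that window.
  have hdense : ∀ k : ℤ, ∃ D : Set Ell2, D.Countable ∧ D ⊆ {x ∈ E | |x i - k * w| ≤ w} ∧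
      {x ∈ E | |x i - k * w| ≤ w} ⊆ closure D := fun k => by
    obtain ⟨D, hD1, hD2, hD3⟩ :=
      (TopologicalSpace.IsSeparable.of_separableSpace
        {x ∈ E | |x i - k * w| ≤ w}).exists_countable_dense_subset
    exact ⟨D, hD2, hD1, hD3⟩
  choose D hDc hDs hDd using hdense
  have hae : ∀ᵐ z ∂(dropLaw a i), ∀ k : ℤ, ∀ n : ℕ, ∀ x ∈ D k,
      z ∈ Metric.ball (dropCoord i x) (r / 4) →
      ∫ t, (windowMonomial (k * w) w n t • W.indicator u (replaceCoord i t z) +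
        (deriv (windowMonomial (k * w) w n) t - t / a i ^ 2 * windowMonomial (k * w) w n t) •
          W.indicator f (replaceCoord i t z)) ∂(coordLaw a i) = 0 :=
    ae_all_iff.2 fun k => ae_all_iff.2 fun n => (ae_ball_iff (hDc k)).2 fun x hx =>
      hu.ae_integral_line_eq_zero hW hf hr (hrW x (hDs k hx).1) hw0 (by rw [hw]; linarith)
        (hDs k hx).2 n
  have hup := hmp.integrable_comp_of_integrable hui
  have hfp := hmp.integrable_comp_of_integrable hfi
  have hline : ∀ᵐ z ∂(dropLaw a i),
      ∫ t, (W.indicator Φ (replaceCoord i t z) • W.indicator u (replaceCoord i t z) +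
        (W.indicator Φ' (replaceCoord i t z) - t / a i ^ 2 * W.indicator Φ (replaceCoord i t z)) •
          W.indicator f (replaceCoord i t z)) ∂(coordLaw a i) = 0 := by
    filter_upwards [hae, hup.prod_left_ae, hfp.prod_left_ae, ae_dropCoord_eq a i]
      with z hz huz hfz hdz
    refine integral_slice_eq_zero (R := R) (coordLaw a i) (a i ^ 2) hw0 huz hfz
      (fun t => ?_) ?_ (fun t ht => ?_) fun k hk n => ?_
    · rw [funext fun s => congrArg (W.indicator Φ) (replaceCoord_eq_dropCoord_add i s z),
        replaceCoord_eq_dropCoord_add i t z]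
      exact hΦ.hasDerivAt_indicator hW _ _
    · rw [funext fun s => congrArg (W.indicator Φ') (replaceCoord_eq_dropCoord_add i s z)]
      exact hΦ.continuous_indicator hW _
    · have hm := mem_of_indicator_ne_zero ht
      rw [indicator_of_mem hm] at ht
      have h1 := hER ⟨hm, ht⟩
      rw [mem_ball_zero_iff] at h1
      have h2 := abs_coord_le_norm (replaceCoord i t z) i
      rw [replaceCoord_apply_self] at h2
      linarith
    · obtain ⟨t, htk, ht⟩ := hk
      have hm := mem_of_indicator_ne_zero ht
      rw [indicator_of_mem hm] at ht
      have hmem : replaceCoord i t z ∈ {x ∈ E | |x i - k * w| ≤ w} :=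
        ⟨⟨hm, ht⟩, by rw [replaceCoord_apply_self]; exact htk⟩
      obtain ⟨x, hxD, hx⟩ := Metric.mem_closure_iff.1 (hDd k hmem) (r / 4) (by positivity)
      refine hz k n x hxD ?_
      rw [dist_eq_norm] at hx
      rw [mem_ball_iff_norm]
      refine lt_of_le_of_lt ?_ hx
      have := norm_dropCoord_sub_le i (replaceCoord i t z) x
      rwa [dropCoord, replaceCoord_replaceCoord, ← dropCoord, hdz] at this
  have hΦb : ∀ y, ‖W.indicator Φ y‖ ≤ |M| := by
    intro y
    by_cases hy : y ∈ W
    · rw [indicator_of_mem hy]; exact ((hM y hy).1).trans (le_abs_self M)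
    · rw [indicator_of_notMem hy, norm_zero]; exact abs_nonneg M
  have hΦb' : ∀ y, ‖W.indicator Φ' y‖ ≤ |M| := by
    intro y
    by_cases hy : y ∈ W
    · rw [indicator_of_mem hy]; exact ((hM y hy).2).trans (le_abs_self M)
    · rw [indicator_of_notMem hy, norm_zero]; exact abs_nonneg M
  have hyb : ∀ y : Ell2, ‖y i / a i ^ 2 * W.indicator Φ y‖ ≤ R / a i ^ 2 * |M| := by
    intro y
    by_cases hy : W.indicator Φ y = 0
    · rw [hy, mul_zero, norm_zero]; positivity
    · have hm := mem_of_indicator_ne_zero hy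
      rw [norm_mul, norm_div, norm_pow, Real.norm_eq_abs (a i), sq_abs]
      have h1 : y ∈ Metric.ball 0 R := hER ⟨hm, by rwa [indicator_of_mem hm] at hy⟩
      rw [mem_ball_zero_iff] at h1
      have h2 : ‖y i‖ ≤ R := (abs_coord_le_norm y i).trans h1.le
      have h3 := hΦb y
      gcongr
  set H : Ell2 → 𝕜 := fun y => W.indicator Φ y • W.indicator u y +
    (W.indicator Φ' y - y i / a i ^ 2 * W.indicator Φ y) • W.indicator f y with hH
  have hI1 : Integrable (fun y => W.indicator Φ y • W.indicator u y) (gaussP a) :=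
    hui.bdd_smul |M| hΦ.meas.aestronglyMeasurable (Eventually.of_forall hΦb)
  have hI2 : Integrable (fun y => (W.indicator Φ' y - y i / a i ^ 2 * W.indicator Φ y) •
      W.indicator f y) (gaussP a) :=
    hfi.bdd_smul (|M| + R / a i ^ 2 * |M|) (hΦ.meas'.sub
      (((measurable_coord i).div_const _).mul hΦ.meas)).aestronglyMeasurable
      (Eventually.of_forall fun y => (norm_sub_le _ _).trans (add_le_add (hΦb' y) (hyb y)))
  have hHi : Integrable H (gaussP a) := hI1.add hI2
  have hzero : ∫ y, H y ∂(gaussP a) = 0 := by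
    rw [integral_gaussP_eq i hHi]
    refine integral_eq_zero_of_ae ?_
    filter_upwards [hline] with z hz
    simp only [hH, replaceCoord_apply_self]
    exact hz
  rw [hH, integral_add hI1 hI2] at hzero
  rw [setIntegral_smul_eq_integral_smul_indicator hW.measurableSet,
    setIntegral_smul_eq_integral_smul_indicator hW.measurableSet]
  have e1 : ∀ y, W.indicator Φ y • W.indicator u y = Φ y • W.indicator u y := by
    intro y; by_cases hy : y ∈ W <;> simp [hy]
  have e2 : ∀ y, (W.indicator Φ' y - y i / a i ^ 2 * W.indicator Φ y) • W.indicator f y =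
      -((-Φ' y + y i / a i ^ 2 * Φ y) • W.indicator f y) := by
    intro y
    by_cases hy : y ∈ W
    · simp only [indicator_of_mem hy]
      rw [← neg_smul]
      congr 1
      ring
    · simp [hy]
  simp only [e1, e2, integral_neg] at hzero
  exact sub_eq_zero.1 (by rw [sub_eq_add_neg]; exact hzero)

/-! ### Calculus on coordinate planes -/

/-- The point of the coordinate plane through `x`, with directions `0` and `i`, that has affine
coordinates `p`. -/
noncomputable def plane (i : ℕ) (x : Ell2) (p : ℝ × ℝ) : Ell2 :=
  x + p.1 • stdVec 0 + p.2 • stdVec i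

theorem plane_zero (i : ℕ) (x : Ell2) : plane i x 0 = x := by
  simp [plane]

theorem continuous_plane (i : ℕ) (x : Ell2) : Continuous (plane i x) := by
  unfold plane
  fun_prop

theorem FContinuousOn.continuousOn_plane {W : Set Ell2} {f : Ell2 → ℝ} (hf : FContinuousOn W f)
    {x : Ell2} (hx : x ∈ W) (i : ℕ) :
    ContinuousOn (fun p => f (plane i x p)) {p | plane i x p ∈ W} := by
  set L : ℝ × ℝ → Fin (i + 1) → ℝ := fun p j =>
    (if (j : ℕ) = 0 then p.1 else 0) + (if (j : ℕ) = i then p.2 else 0) with hL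
  have hLc : Continuous L := by
    refine continuous_pi fun j => ?_
    refine Continuous.add ?_ ?_ <;> split_ifs <;> fun_prop
  have hLs : ∀ p, x + ∑ j : Fin (i + 1), L p j • stdVec (j : ℕ) = plane i x p := by
    intro p
    rw [Fin.sum_univ_eq_sum_range (fun j : ℕ =>
      ((if j = 0 then p.1 else 0) + (if j = i then p.2 else 0)) • stdVec j) (i + 1)]
    simp only [add_smul, Finset.sum_add_distrib, ite_smul, zero_smul, Finset.sum_ite_eq']
    simp [plane, add_assoc]
  have := (hf x hx (i + 1)).comp (f := L) (s := {p | plane i x p ∈ W}) hLc.continuousOn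
    fun p hp => by rw [mem_ofPred_eq, hLs]; exact hp
  refine this.congr fun p _ => ?_
  simp only [Function.comp, hLs]

theorem HasPD.hasDerivAt_line {i : ℕ} {f : Ell2 → ℝ} {x : Ell2} {t : ℝ}
    (h : HasPD i f (x + t • stdVec i)) :
    HasDerivAt (fun s : ℝ => f (x + s • stdVec i)) (pd i f (x + t • stdVec i)) t := by
  have h1 := h.hasDerivAt
  have h2 : HasDerivAt (fun s : ℝ => s - t) 1 t := (hasDerivAt_id t).sub_const t
  have h3 := HasDerivAt.scomp_of_eq t h1 h2 (sub_self t).symm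
  simp only [one_smul] at h3
  refine h3.congr_of_eventuallyEq (Eventually.of_forall fun s => ?_)
  simp only [Function.comp, add_assoc, ← add_smul]
  rw [add_sub_cancel]

/-- A function with `F`-continuous partial derivatives is differentiable on coordinate planes. -/
theorem hasFDerivAt_plane {W : Set Ell2} (hW : IsOpen W) {f : Ell2 → ℝ} {i : ℕ}
    (h0 : ∀ x ∈ W, HasPD 0 f x) (hi : ∀ x ∈ W, HasPD i f x) (hc0 : FContinuousOn W (pd 0 f))
    (hci : FContinuousOn W (pd i f)) {x : Ell2} (hx : x ∈ W) {p : ℝ × ℝ} (hp : plane i x p ∈ W) :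
    HasFDerivAt (fun p => f (plane i x p))
      (pd 0 f (plane i x p) • ContinuousLinearMap.fst ℝ ℝ ℝ +
        pd i f (plane i x p) • ContinuousLinearMap.snd ℝ ℝ ℝ) p := by
  have hopen : IsOpen {p | plane i x p ∈ W} := hW.preimage (continuous_plane i x)
  have hev : ∀ᶠ q in 𝓝 p, plane i x q ∈ W := hopen.mem_nhds hp
  have key := hasStrictFDerivAt_uncurry_coprod (𝕜 := ℝ) (u := p)
    (f := fun s t => f (plane i x (s, t)))
    (f₁ := fun s t => ContinuousLinearMap.toSpanSingleton ℝ (pd 0 f (plane i x (s, t))))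
    (f₂ := fun s t => ContinuousLinearMap.toSpanSingleton ℝ (pd i f (plane i x (s, t))))
    ?_ ?_ ?_ ?_
  · refine key.hasFDerivAt.congr_fderiv ?_
    ext <;> simp [Function.HasUncurry.uncurry]
  · filter_upwards [hev] with q hq
    have e : ∀ s : ℝ, plane i x (s, q.2) = (x + q.2 • stdVec i) + s • stdVec 0 := fun s => by
      simp only [plane]; abel
    have h1 : HasPD 0 f ((x + q.2 • stdVec i) + q.1 • stdVec 0) := by
      rw [← e]; exact h0 _ hq
    have h2 := h1.hasDerivAt_line
    simp only [← e] at h2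
    exact h2.hasFDerivAt
  · filter_upwards [hev] with q hq
    have h1 : HasPD i f ((x + q.1 • stdVec 0) + q.2 • stdVec i) := hi _ hq
    exact h1.hasDerivAt_line.hasFDerivAt
  · have := (hc0.continuousOn_plane hx i).continuousAt (hopen.mem_nhds hp)
    exact (ContinuousLinearMap.toSpanSingletonCLE (𝕜 := ℝ) (E := ℝ)).continuous.continuousAt.comp
      this
  · have := (hci.continuousOn_plane hx i).continuousAt (hopen.mem_nhds hp)
    exact (ContinuousLinearMap.toSpanSingletonCLE (𝕜 := ℝ) (E := ℝ)).continuous.continuousAt.comp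
      this

namespace IsFSmooth

variable {W : Set Ell2} {f : Ell2 → ℝ}

theorem mono {W' : Set Ell2} (hf : IsFSmooth W f) (h : W' ⊆ W) : IsFSmooth W' f where
  exists_pd l i x hx := hf.exists_pd l i x (h hx)
  fcont l x hx n := (hf.fcont l x (h hx) n).mono fun _ hs => h hs
  meas l := (hf.meas l).comp (measurable_inclusion h)
  bdd l hl := (hf.bdd l hl).imp fun _ hM x hx => hM x (h hx)

theorem pd_smooth (hf : IsFSmooth W f) (i : ℕ) : IsFSmooth W (pd i f) := by
  have h : ∀ l, iterPD l (pd i f) = iterPD (l ++ [i]) f := by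
    intro l
    induction l with
    | nil => rfl
    | cons j l ih => simp only [iterPD, List.cons_append, ih]
  refine ⟨fun l => ?_, fun l => ?_, fun l => ?_, fun l _ => ?_⟩
  · rw [h]; exact hf.exists_pd _
  · rw [h]; exact hf.fcont _
  · rw [h]; exact hf.meas _
  · rw [h]; exact hf.bdd _ (by simp)

theorem measurable_indicator (hW : MeasurableSet W) (hf : IsFSmooth W f) :
    Measurable (W.indicator f) := by
  refine measurable_of_restrict_of_restrict_compl hW ?_ ?_
  · have : W.domRestrict (W.indicator f) = W.domRestrict f :=
      funext fun x => indicator_of_mem x.2 f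
    rw [this]
    exact hf.meas []
  · have : Wᶜ.domRestrict (W.indicator f) = fun _ => 0 :=
      funext fun x => indicator_of_notMem x.2 f
    rw [this]
    exact measurable_const

theorem hasFDerivAt_plane (hW : IsOpen W) (hf : IsFSmooth W f) (i : ℕ) {x : Ell2} (hx : x ∈ W)
    {p : ℝ × ℝ} (hp : plane i x p ∈ W) :
    HasFDerivAt (fun p => f (plane i x p))
      (pd 0 f (plane i x p) • ContinuousLinearMap.fst ℝ ℝ ℝ +
        pd i f (plane i x p) • ContinuousLinearMap.snd ℝ ℝ ℝ) p :=
  GaussSobolev.hasFDerivAt_plane hW (hf.exists_pd [] 0) (hf.exists_pd [] i) (hf.fcont [0])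
    (hf.fcont [i]) hx hp

theorem hasDerivAt (hf : IsFSmooth W f) (i : ℕ) {x : Ell2} (hx : x ∈ W) :
    HasDerivAt (fun t : ℝ => f (x + t • stdVec i)) (pd i f x) 0 :=
  (hf.exists_pd [] i x hx).hasDerivAt

/-- Symmetry of second derivatives. -/
theorem pd_zero_comm (hW : IsOpen W) (hf : IsFSmooth W f) (i : ℕ) {x : Ell2} (hx : x ∈ W) :
    pd 0 (pd i f) x = pd i (pd 0 f) x := by
  have hx0 : plane i x 0 ∈ W := by rwa [plane_zero]
  have hev : ∀ᶠ q in 𝓝 (0 : ℝ × ℝ), plane i x q ∈ W :=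
    (hW.preimage (continuous_plane i x)).mem_nhds hx0
  have h1 := (hf.pd_smooth 0).hasFDerivAt_plane hW i hx hx0
  have h2 := (hf.pd_smooth i).hasFDerivAt_plane hW i hx hx0
  have h3 := (h1.smul_const (ContinuousLinearMap.fst ℝ ℝ ℝ)).add
    (h2.smul_const (ContinuousLinearMap.snd ℝ ℝ ℝ))
  have h4 := second_derivative_symmetric_of_eventually (𝕜 := ℝ)
    (hev.mono fun q hq => hf.hasFDerivAt_plane hW i hx hq) h3 (1, 0) (0, 1)
  simpa [plane_zero] using h4

theorem continuousAt_line (hf : IsFSmooth W f) (i : ℕ) {x : Ell2} (hx : x ∈ W) :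
    ContinuousAt (fun t : ℝ => f (x + t • stdVec i)) 0 :=
  (hf.hasDerivAt i hx).continuousAt

end IsFSmooth

/-- The flattening map sends a line of direction `i` into a coordinate plane. -/
theorem flatten_line (g : Ell2 → ℝ) (x : Ell2) (i : ℕ) (t : ℝ) :
    flatten g (x + t • stdVec i) = plane i (flatten g x)
      (g (x + t • stdVec i) - g x - (if i = 0 then t else 0), t) := by
  have h : (x + t • stdVec i) 0 = x 0 + (if i = 0 then t else 0) := by
    rw [add_smul_stdVec_apply]
    simp only [eq_comm]
  simp only [plane, flatten, replaceFirst, h]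
  module

/-- The chain rule for `F`-smooth functions; only two directions interact, because the line through
`x` is mapped into a coordinate plane. -/
theorem hasDerivAt_comp_flatten {W W' : Set Ell2} (hW' : IsOpen W')
    {φ g : Ell2 → ℝ} (hφ : IsFSmooth W' φ) (hg : IsFSmooth W g) {x : Ell2} (hx : x ∈ W)
    (hx' : flatten g x ∈ W') (i : ℕ) :
    HasDerivAt (fun t : ℝ => φ (flatten g (x + t • stdVec i)))
      (pd 0 φ (flatten g x) * (pd i g x - if i = 0 then 1 else 0) + pd i φ (flatten g x)) 0 := by
  have h1 : HasDerivAt (fun t : ℝ => ((g (x + t • stdVec i) - g x - (if i = 0 then t else 0), t) :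
      ℝ × ℝ)) (pd i g x - (if i = 0 then 1 else 0), 1) 0 := by
    refine HasDerivAt.prodMk (((hg.hasDerivAt i hx).sub_const _).sub ?_) (hasDerivAt_id _)
    split_ifs
    · exact hasDerivAt_id _
    · exact hasDerivAt_const _ _
  have h0 : ((g (x + (0 : ℝ) • stdVec i) - g x - (if i = 0 then (0 : ℝ) else 0), (0 : ℝ)) : ℝ × ℝ)
      = 0 := by
    ext <;> simp
  have h2 := hφ.hasFDerivAt_plane hW' i hx' (p := 0) (by rwa [plane_zero])
  simp only [flatten_line]
  have h3 := HasFDerivAt.comp_hasDerivAt_of_eq 0 h2 h1 h0.symm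
  refine h3.congr_deriv ?_
  simp [plane_zero]

theorem continuousAt_comp_flatten {W W' : Set Ell2} (hW' : IsOpen W')
    {φ g : Ell2 → ℝ} (hφ : IsFSmooth W' φ) (hg : IsFSmooth W g) {x : Ell2} (hx : x ∈ W)
    (hx' : flatten g x ∈ W') (i : ℕ) :
    ContinuousAt (fun t : ℝ => φ (flatten g (x + t • stdVec i))) 0 :=
  (hasDerivAt_comp_flatten hW' hφ hg hx hx' i).continuousAt

/-! ### Change of variables under the flattening map -/

/-- Two open sets exchanged by the mutually inverse maps that replace the first coordinate by `g₁`
and by `g₂`, with the bounds needed to pull Sobolev functions back from `U₁` to `U₂`. -/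
structure IsFlatPair (a : ℕ → ℝ) (δ K : ℝ) (U₁ U₂ : Set Ell2) (g₁ g₂ : Ell2 → ℝ) : Prop where
  isOpen₁ : IsOpen U₁
  isOpen₂ : IsOpen U₂
  mapsTo₁ : ∀ x ∈ U₁, flatten g₁ x ∈ U₂
  mapsTo₂ : ∀ y ∈ U₂, flatten g₂ y ∈ U₁
  left_inv : ∀ x ∈ U₁, g₂ (flatten g₁ x) = x 0
  right_inv : ∀ y ∈ U₂, g₁ (flatten g₂ y) = y 0
  smooth₁ : IsFSmooth U₁ g₁
  smooth₂ : IsFSmooth U₂ g₂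
  abs_coord₁ : ∀ x ∈ U₁, |x 0| ≤ δ
  abs_coord₂ : ∀ y ∈ U₂, |y 0| ≤ δ
  pd_pos : ∀ x ∈ U₁, 0 < pd 0 g₁ x
  pd_le : ∀ x ∈ U₁, pd 0 g₁ x ≤ δ
  gradient_le : ∀ y ∈ U₂, ∀ s : Finset ℕ, ∑ i ∈ s, a i ^ 2 * pd i g₂ y ^ 2 ≤ K
  image_unifIncluded : ∀ E, UnifIncluded E U₂ → UnifIncluded (flatten g₂ '' E) U₁

theorem flatten_eq_replaceCoord (g : Ell2 → ℝ) (x : Ell2) :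
    flatten g x = replaceCoord 0 (g x) x := rfl

theorem flatten_apply_zero (g : Ell2 → ℝ) (x : Ell2) : flatten g x 0 = g x := by
  rw [flatten_eq_replaceCoord, replaceCoord_apply_self]

theorem flatten_apply_of_ne (g : Ell2 → ℝ) (x : Ell2) {i : ℕ} (hi : i ≠ 0) :
    flatten g x i = x i := by
  rw [flatten_eq_replaceCoord, replaceCoord_apply, if_neg hi]

theorem flatten_flatten_eq_self {g g' : Ell2 → ℝ} {x : Ell2} (h : g' (flatten g x) = x 0) :
    flatten g' (flatten g x) = x := by
  rw [flatten_eq_replaceCoord, h, flatten_eq_replaceCoord, replaceCoord_replaceCoord,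
    replaceCoord_self]

theorem measurable_flatten {g : Ell2 → ℝ} (hg : Measurable g) : Measurable (flatten g) :=
  (continuous_replaceCoord 0).measurable.comp (hg.prodMk measurable_id)

theorem flatten_indicator {W : Set Ell2} (g : Ell2 → ℝ) {x : Ell2} (hx : x ∈ W) :
    flatten (W.indicator g) x = flatten g x := by
  rw [flatten_eq_replaceCoord, indicator_of_mem hx, flatten_eq_replaceCoord]

theorem measurable_indicator_comp_flatten {W W' : Set Ell2} (hW : MeasurableSet W)
    {g k : Ell2 → ℝ} (hg : Measurable (W.indicator g)) (hk : Measurable (W'.indicator k))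
    (h : ∀ x ∈ W, flatten g x ∈ W') : Measurable (W.indicator fun x => k (flatten g x)) := by
  have : W.indicator (fun x => k (flatten g x)) =
      W.indicator fun x => W'.indicator k (flatten (W.indicator g) x) := by
    ext x
    by_cases hx : x ∈ W
    · rw [indicator_of_mem hx, indicator_of_mem hx, flatten_indicator g hx,
        indicator_of_mem (h x hx)]
    · rw [indicator_of_notMem hx, indicator_of_notMem hx]
  rw [this]
  exact (hk.comp (measurable_flatten hg)).indicator hW

/-- The Gaussian weight in the Jacobian of the flattening map. -/
noncomputable def gaussRatio (a : ℕ → ℝ) (g : Ell2 → ℝ) (x : Ell2) : ℝ :=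
  Real.exp ((x 0 ^ 2 - g x ^ 2) / (2 * a 0 ^ 2))

/-- The density, with respect to the Gaussian measure on the source, of the pull-back of the
Gaussian measure under the flattening map. -/
noncomputable def flatJacobian (a : ℕ → ℝ) (g : Ell2 → ℝ) (x : Ell2) : ℝ :=
  pd 0 g x * gaussRatio a g x

namespace IsFlatPair

variable {a : ℕ → ℝ} {δ K : ℝ} {U₁ U₂ : Set Ell2} {g₁ g₂ : Ell2 → ℝ}

theorem measurable_indicator_gaussRatio (h : IsFlatPair a δ K U₁ U₂ g₁ g₂) :
    Measurable (U₁.indicator (gaussRatio a g₁)) := by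
  have hm := h.smooth₁.measurable_indicator h.isOpen₁.measurableSet
  have : U₁.indicator (gaussRatio a g₁) = U₁.indicator (gaussRatio a (U₁.indicator g₁)) := by
    ext x
    by_cases hx : x ∈ U₁ <;> simp [hx, gaussRatio]
  rw [this]
  refine Measurable.indicator ?_ h.isOpen₁.measurableSet
  unfold gaussRatio
  exact Real.measurable_exp.comp ((((measurable_coord 0).pow_const 2).sub
    (hm.pow_const 2)).div_const _)

theorem measurable_indicator_flatJacobian (h : IsFlatPair a δ K U₁ U₂ g₁ g₂) :
    Measurable (U₁.indicator (flatJacobian a g₁)) := by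
  have h1 := ((h.smooth₁.pd_smooth 0).measurable_indicator h.isOpen₁.measurableSet).mul
    h.measurable_indicator_gaussRatio
  convert h1 using 1
  ext x
  by_cases hx : x ∈ U₁ <;> simp [hx, flatJacobian]

theorem flatten_left_inv (h : IsFlatPair a δ K U₁ U₂ g₁ g₂) {x : Ell2} (hx : x ∈ U₁) :
    flatten g₂ (flatten g₁ x) = x :=
  flatten_flatten_eq_self (h.left_inv x hx)

theorem flatten_right_inv (h : IsFlatPair a δ K U₁ U₂ g₁ g₂) {y : Ell2} (hy : y ∈ U₂) :
    flatten g₁ (flatten g₂ y) = y :=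
  flatten_flatten_eq_self (h.right_inv y hy)

theorem measurable_flatten₂ (h : IsFlatPair a δ K U₁ U₂ g₁ g₂) :
    Measurable (flatten (U₂.indicator g₂)) :=
  measurable_flatten (h.smooth₂.measurable_indicator h.isOpen₂.measurableSet)

/-- The change of variables on a single line of direction `0`. -/
theorem coordLaw_line (h : IsFlatPair a δ K U₁ U₂ g₁ g₂) (ha : a 0 ≠ 0) {A : Set Ell2}
    (hA : MeasurableSet A) (z : Ell2) :
    coordLaw a 0 {s | replaceCoord 0 s z ∈ U₂ ∧ flatten g₂ (replaceCoord 0 s z) ∈ A} =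
      ∫⁻ t, (U₁ ∩ A).indicator (fun x => ENNReal.ofReal (flatJacobian a g₁ x))
        (replaceCoord 0 t z) ∂(coordLaw a 0) := by
  set v : NNReal := Real.toNNReal (a 0 ^ 2) with hv
  have hv0 : v ≠ 0 := by
    rw [hv]; simpa using ha
  have hva : (v : ℝ) = a 0 ^ 2 := Real.coe_toNNReal _ (sq_nonneg _)
  set T : Set ℝ := {t | replaceCoord 0 t z ∈ U₁ ∩ A} with hT
  have hline : Continuous fun t : ℝ => replaceCoord 0 t z :=
    (continuous_replaceCoord 0).comp (continuous_id.prodMk continuous_const)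
  have hTm : MeasurableSet T := hline.measurable (h.isOpen₁.measurableSet.inter hA)
  set k : ℝ → ℝ := fun t => g₁ (replaceCoord 0 t z) with hk
  have hflat : ∀ t, flatten g₁ (replaceCoord 0 t z) = replaceCoord 0 (k t) z := fun t => by
    rw [flatten_eq_replaceCoord, replaceCoord_replaceCoord]
  have himg : {s | replaceCoord 0 s z ∈ U₂ ∧ flatten g₂ (replaceCoord 0 s z) ∈ A} = k '' T := by
    ext s
    constructor
    · rintro ⟨h1, h2⟩
      have e : replaceCoord 0 (g₂ (replaceCoord 0 s z)) z = flatten g₂ (replaceCoord 0 s z) := by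
        rw [flatten_eq_replaceCoord, replaceCoord_replaceCoord]
      refine ⟨g₂ (replaceCoord 0 s z), ?_, ?_⟩
      · change _ ∈ U₁ ∩ A
        rw [e]
        exact ⟨h.mapsTo₂ _ h1, h2⟩
      · simp only [hk]
        rw [e, h.right_inv _ h1, replaceCoord_apply_self]
    · rintro ⟨t, ⟨h1, h2⟩, rfl⟩
      refine ⟨?_, ?_⟩
      · rw [← hflat]; exact h.mapsTo₁ _ h1
      · rw [← hflat, h.flatten_left_inv h1]; exact h2
  have hderiv : ∀ t ∈ T, HasDerivWithinAt k (pd 0 g₁ (replaceCoord 0 t z)) T t := by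
    intro t ht
    have h1 := h.smooth₁.exists_pd [] 0 _ ht.1
    rw [replaceCoord_eq_dropCoord_add 0 t z] at h1
    have h2 := h1.hasDerivAt_line
    rw [← replaceCoord_eq_dropCoord_add 0 t z] at h2
    refine (h2.congr_of_eventuallyEq (Eventually.of_forall fun s => ?_)).hasDerivWithinAt
    simp only [hk]
    rw [replaceCoord_eq_dropCoord_add 0 s z]
    rfl
  have hinj : InjOn k T := by
    intro t ht t' ht' hkt
    have h1 := h.flatten_left_inv ht.1
    have h2 := h.flatten_left_inv ht'.1
    rw [hflat] at h1 h2
    rw [hkt, h2] at h1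
    have := congrArg (fun x : Ell2 => x 0) h1
    simp only [replaceCoord_apply_self] at this
    exact this.symm
  have hJm : Measurable fun t => (U₁ ∩ A).indicator
      (fun x => ENNReal.ofReal (flatJacobian a g₁ x)) (replaceCoord 0 t z) := by
    have h1 : (U₁ ∩ A).indicator (fun x => ENNReal.ofReal (flatJacobian a g₁ x)) =
        A.indicator fun x => ENNReal.ofReal (U₁.indicator (flatJacobian a g₁) x) := by
      ext x
      by_cases hx : x ∈ U₁ <;> by_cases hx' : x ∈ A <;> simp [hx, hx']
    rw [h1]
    exact ((h.measurable_indicator_flatJacobian.ennreal_ofReal).indicator hA).comp hline.measurable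
  rw [himg, coordLaw, ← hv, gaussianReal_of_var_ne_zero _ hv0, withDensity_apply',
    lintegral_image_eq_lintegral_abs_deriv_mul hTm hderiv hinj,
    lintegral_withDensity_eq_lintegral_mul _ (measurable_gaussianPDF 0 v) hJm,
    ← lintegral_indicator hTm]
  refine lintegral_congr fun t => ?_
  by_cases ht : t ∈ T
  · rw [indicator_of_mem ht, Pi.mul_apply, indicator_of_mem (show _ ∈ U₁ ∩ A from ht),
      abs_of_pos (h.pd_pos _ ht.1), gaussianPDF, gaussianPDF, ← ENNReal.ofReal_mul
      (h.pd_pos _ ht.1).le, ← ENNReal.ofReal_mul (gaussianPDFReal_nonneg _ _ _)]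
    congr 1
    rw [flatJacobian, gaussRatio, gaussianPDFReal, gaussianPDFReal, replaceCoord_apply_self, hva]
    have : Real.exp (-(k t - 0) ^ 2 / (2 * a 0 ^ 2)) = Real.exp (-(t - 0) ^ 2 / (2 * a 0 ^ 2)) *
        Real.exp ((t ^ 2 - g₁ (replaceCoord 0 t z) ^ 2) / (2 * a 0 ^ 2)) := by
      rw [← Real.exp_add]
      congr 1
      simp only [hk]
      ring
    rw [this]
    ring
  · rw [indicator_of_notMem ht, Pi.mul_apply, indicator_of_notMem (show _ ∉ U₁ ∩ A from ht),
      mul_zero]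

/-- The image under the flattening map `U₂ → U₁` of the Gaussian measure on `U₂`. -/
theorem map_flatten_restrict (h : IsFlatPair a δ K U₁ U₂ g₁ g₂) (ha : a 0 ≠ 0) :
    ((gaussP a).restrict U₂).map (flatten (U₂.indicator g₂)) =
      ((gaussP a).restrict U₁).withDensity fun x => ENNReal.ofReal (flatJacobian a g₁ x) := by
  ext A hA
  have hmp := measurePreserving_replaceCoord a 0
  have hJ : (U₁ ∩ A).indicator (fun x => ENNReal.ofReal (flatJacobian a g₁ x)) =
      A.indicator fun x => ENNReal.ofReal (U₁.indicator (flatJacobian a g₁) x) := by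
    ext x
    by_cases hx : x ∈ U₁ <;> by_cases hx' : x ∈ A <;> simp [hx, hx']
  have hJm : Measurable ((U₁ ∩ A).indicator
      (fun x => ENNReal.ofReal (flatJacobian a g₁ x))) := by
    rw [hJ]
    exact (h.measurable_indicator_flatJacobian.ennreal_ofReal).indicator hA
  have hJp : Measurable fun p : ℝ × Ell2 => (U₁ ∩ A).indicator
      (fun x => ENNReal.ofReal (flatJacobian a g₁ x)) (replaceCoord 0 p.1 p.2) :=
    hJm.comp hmp.measurable
  have hS : MeasurableSet (flatten (U₂.indicator g₂) ⁻¹' A ∩ U₂) :=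
    (h.measurable_flatten₂ hA).inter h.isOpen₂.measurableSet
  rw [Measure.map_apply h.measurable_flatten₂ hA,
    Measure.restrict_apply (h.measurable_flatten₂ hA), withDensity_apply _ hA,
    Measure.restrict_restrict hA, inter_comm A U₁,
    ← lintegral_indicator (h.isOpen₁.measurableSet.inter hA), ← hmp.lintegral_comp hJm,
    ← hmp.measure_preimage hS.nullMeasurableSet, Measure.prod_apply_symm (hmp.measurable hS),
    lintegral_prod_symm' _ hJp]
  refine lintegral_congr fun z => ?_
  rw [← h.coordLaw_line ha hA z]
  congr 1
  ext s
  simp only [mem_preimage, mem_inter_iff, mem_ofPred_eq]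
  constructor
  · rintro ⟨h1, h2⟩
    rw [flatten_indicator g₂ h2] at h1
    exact ⟨h2, h1⟩
  · rintro ⟨h1, h2⟩
    rw [flatten_indicator g₂ h1]
    exact ⟨h2, h1⟩

end IsFlatPair

/-! ### Estimates for compositions with the flattening map -/

/-- An upper bound for the Jacobian of the flattening map. -/
noncomputable def jacobianBound (a : ℕ → ℝ) (δ : ℝ) : ℝ :=
  δ * Real.exp (δ ^ 2 / (2 * a 0 ^ 2))

theorem aestronglyMeasurable_restrict_of_measurable_indicator {W : Set Ell2}
    (hW : MeasurableSet W) {k : Ell2 → ℝ} (hk : Measurable (W.indicator k)) (μ : Measure Ell2) :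
    AEStronglyMeasurable k (μ.restrict W) :=
  (aestronglyMeasurable_indicator_iff hW).1 hk.aestronglyMeasurable

namespace IsFlatPair

variable {a : ℕ → ℝ} {δ K : ℝ} {U₁ U₂ : Set Ell2} {g₁ g₂ : Ell2 → ℝ}

theorem abs_le (h : IsFlatPair a δ K U₁ U₂ g₁ g₂) {x : Ell2} (hx : x ∈ U₁) : |g₁ x| ≤ δ := by
  have := h.abs_coord₂ _ (h.mapsTo₁ x hx)
  rwa [flatten_apply_zero] at this

theorem gaussRatio_le (h : IsFlatPair a δ K U₁ U₂ g₁ g₂) {x : Ell2} (hx : x ∈ U₁) :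
    gaussRatio a g₁ x ≤ Real.exp (δ ^ 2 / (2 * a 0 ^ 2)) := by
  refine Real.exp_le_exp.2 ?_
  have h1 : x 0 ^ 2 ≤ δ ^ 2 := by
    rw [← sq_abs]
    exact pow_le_pow_left₀ (abs_nonneg _) (h.abs_coord₁ x hx) 2
  have h2 := sq_nonneg (g₁ x)
  gcongr
  linarith

theorem flatJacobian_nonneg (h : IsFlatPair a δ K U₁ U₂ g₁ g₂) {x : Ell2} (hx : x ∈ U₁) :
    0 ≤ flatJacobian a g₁ x :=
  mul_nonneg (h.pd_pos x hx).le (Real.exp_pos _).le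

theorem flatJacobian_le (h : IsFlatPair a δ K U₁ U₂ g₁ g₂) {x : Ell2} (hx : x ∈ U₁) :
    flatJacobian a g₁ x ≤ jacobianBound a δ :=
  mul_le_mul (h.pd_le x hx) (h.gaussRatio_le hx) (Real.exp_pos _).le
    ((h.pd_pos x hx).le.trans (h.pd_le x hx))

theorem ae_flatten_eq (h : IsFlatPair a δ K U₁ U₂ g₁ g₂) :
    ∀ᵐ y ∂((gaussP a).restrict U₂), flatten (U₂.indicator g₂) y = flatten g₂ y := by
  filter_upwards [ae_restrict_mem h.isOpen₂.measurableSet] with y hy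
  exact flatten_indicator g₂ hy

theorem map_le (h : IsFlatPair a δ K U₁ U₂ g₁ g₂) (ha : a 0 ≠ 0) :
    ((gaussP a).restrict U₂).map (flatten (U₂.indicator g₂)) ≤
      ENNReal.ofReal (jacobianBound a δ) • (gaussP a).restrict U₁ := by
  rw [h.map_flatten_restrict ha, ← withDensity_const]
  refine withDensity_mono ?_
  filter_upwards [ae_restrict_mem h.isOpen₁.measurableSet] with x hx
  exact ENNReal.ofReal_le_ofReal (h.flatJacobian_le hx)

/-- The change of variables formula for the flattening map. -/
theorem integral_comp (h : IsFlatPair a δ K U₁ U₂ g₁ g₂) (ha : a 0 ≠ 0)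
    {G : Ell2 → 𝕜} (hG : AEStronglyMeasurable G ((gaussP a).restrict U₁)) :
    ∫ y in U₂, G (flatten g₂ y) ∂(gaussP a) =
      ∫ x in U₁, flatJacobian a g₁ x • G x ∂(gaussP a) := by
  have h1 : AEStronglyMeasurable G (((gaussP a).restrict U₂).map (flatten (U₂.indicator g₂))) :=
    (hG.smul_measure _).mono_measure (h.map_le ha)
  have h2 := integral_map h.measurable_flatten₂.aemeasurable h1
  have hJ : AEMeasurable (fun x => ENNReal.ofReal (flatJacobian a g₁ x))
      ((gaussP a).restrict U₁) :=
    (aestronglyMeasurable_restrict_of_measurable_indicator h.isOpen₁.measurableSet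
      h.measurable_indicator_flatJacobian _).aemeasurable.ennreal_ofReal
  rw [h.map_flatten_restrict ha, integral_withDensity_eq_integral_toReal_smul₀ hJ
    (Eventually.of_forall fun x => ENNReal.ofReal_lt_top)] at h2
  have h3 : ∫ y in U₂, G (flatten g₂ y) ∂(gaussP a) =
      ∫ y in U₂, G (flatten (U₂.indicator g₂) y) ∂(gaussP a) := by
    refine integral_congr_ae ?_
    filter_upwards [h.ae_flatten_eq] with y hy
    rw [hy]
  rw [h3, ← h2]
  refine setIntegral_congr_fun h.isOpen₁.measurableSet fun x hx => ?_
  simp only [ENNReal.toReal_ofReal (h.flatJacobian_nonneg hx)]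

theorem memLp_comp (h : IsFlatPair a δ K U₁ U₂ g₁ g₂) (ha : a 0 ≠ 0)
    {f : Ell2 → 𝕜} (hf : MemLp f 2 ((gaussP a).restrict U₁)) :
    MemLp (f ∘ flatten g₂) 2 ((gaussP a).restrict U₂) := by
  have h1 : MemLp f 2 (((gaussP a).restrict U₂).map (flatten (U₂.indicator g₂))) :=
    (hf.smul_measure ENNReal.ofReal_ne_top).mono_measure (h.map_le ha)
  refine (h1.comp_of_map h.measurable_flatten₂.aemeasurable).ae_eq ?_
  filter_upwards [h.ae_flatten_eq] with y hy
  simp only [Function.comp, hy]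

theorem integral_norm_sq_comp_le (h : IsFlatPair a δ K U₁ U₂ g₁ g₂) (ha : a 0 ≠ 0)
    {f : Ell2 → 𝕜} (hf : MemLp f 2 ((gaussP a).restrict U₁)) :
    ∫ y in U₂, ‖f (flatten g₂ y)‖ ^ 2 ∂(gaussP a) ≤
      jacobianBound a δ * ∫ x in U₁, ‖f x‖ ^ 2 ∂(gaussP a) := by
  have hi := hf.norm.integrable_sq
  rw [h.integral_comp (𝕜 := ℝ) (G := fun x => ‖f x‖ ^ 2) ha hi.1, ← integral_const_mul]
  refine integral_mono_of_nonneg ?_ (hi.const_mul _) ?_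
  · filter_upwards [ae_restrict_mem h.isOpen₁.measurableSet] with x hx
    exact mul_nonneg (h.flatJacobian_nonneg hx) (sq_nonneg _)
  · filter_upwards [ae_restrict_mem h.isOpen₁.measurableSet] with x hx
    exact mul_le_mul_of_nonneg_right (h.flatJacobian_le hx) (sq_nonneg _)

/-- The chain rule for the relation `g₂ (flatten g₁ x) = x 0`. -/
theorem pd_comp (h : IsFlatPair a δ K U₁ U₂ g₁ g₂) (i : ℕ) {x : Ell2} (hx : x ∈ U₁) :
    pd 0 g₂ (flatten g₁ x) * (pd i g₁ x - if i = 0 then 1 else 0) + pd i g₂ (flatten g₁ x) =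
      if i = 0 then 1 else 0 := by
  have h1 := hasDerivAt_comp_flatten h.isOpen₂ h.smooth₂ h.smooth₁ hx (h.mapsTo₁ x hx) i
  have h2 : HasDerivAt (fun t : ℝ => x 0 + if i = 0 then t else 0) (if i = 0 then 1 else 0) 0 := by
    refine HasDerivAt.const_add _ ?_
    split_ifs
    · exact hasDerivAt_id _
    · exact hasDerivAt_const _ _
  refine h1.unique (h2.congr_of_eventuallyEq ?_)
  filter_upwards [eventually_line_mem h.isOpen₁ hx i] with t ht
  rw [h.left_inv _ ht, add_smul_stdVec_apply]
  simp only [eq_comm]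

theorem pd_zero_comp (h : IsFlatPair a δ K U₁ U₂ g₁ g₂) {x : Ell2} (hx : x ∈ U₁) :
    pd 0 g₂ (flatten g₁ x) * pd 0 g₁ x = 1 := by
  have := h.pd_comp 0 hx
  simp only [if_true] at this
  linarith

end IsFlatPair

theorem IsLineC1.mul {W : Set Ell2} {i : ℕ} {Φ Φ' Ψ Ψ' : Ell2 → ℝ} (h : IsLineC1 W i Φ Φ')
    (k : IsLineC1 W i Ψ Ψ') :
    IsLineC1 W i (fun x => Φ x * Ψ x) (fun x => Φ' x * Ψ x + Φ x * Ψ' x) where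
  meas := by
    have := h.meas.mul k.meas
    convert this using 1
    ext x
    by_cases hx : x ∈ W <;> simp [hx]
  meas' := by
    have := (h.meas'.mul k.meas).add (h.meas.mul k.meas')
    convert this using 1
    ext x
    by_cases hx : x ∈ W <;> simp [hx]
  bdd := by
    obtain ⟨M, hM⟩ := h.bdd
    obtain ⟨N, hN⟩ := k.bdd
    refine ⟨|M| * |N| + |M| * |N|, fun x hx => ?_⟩
    have h1 := (hM x hx).1.trans (le_abs_self M)
    have h2 := (hM x hx).2.trans (le_abs_self M)
    have h3 := (hN x hx).1.trans (le_abs_self N)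
    have h4 := (hN x hx).2.trans (le_abs_self N)
    constructor
    · rw [abs_mul]
      have : |Φ x| * |Ψ x| ≤ |M| * |N| := by gcongr
      have h5 : 0 ≤ |M| * |N| := by positivity
      linarith
    · refine (abs_add_le _ _).trans ?_
      rw [abs_mul, abs_mul]
      gcongr
  hasDeriv x hx := ((h.hasDeriv x hx).mul (k.hasDeriv x hx)).congr_deriv (by simp)
  cont x hx := ((h.cont x hx).mul (k.hasDeriv x hx).continuousAt).add
    ((h.hasDeriv x hx).continuousAt.mul (k.cont x hx))

theorem IsFSmooth.isLineC1 {W : Set Ell2} (hW : IsOpen W) {k : Ell2 → ℝ} (hk : IsFSmooth W k)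
    (hb : ∃ M : ℝ, ∀ x ∈ W, |k x| ≤ M) (i : ℕ) : IsLineC1 W i k (pd i k) where
  meas := hk.measurable_indicator hW.measurableSet
  meas' := (hk.pd_smooth i).measurable_indicator hW.measurableSet
  bdd := by
    obtain ⟨M, hM⟩ := hb
    obtain ⟨N, hN⟩ := hk.bdd [i] (by simp)
    exact ⟨max M N, fun x hx => ⟨(hM x hx).trans (le_max_left _ _),
      (hN x hx).trans (le_max_right _ _)⟩⟩
  hasDeriv x hx := hk.hasDerivAt i hx
  cont x hx := (hk.pd_smooth i).continuousAt_line i hx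

theorem IsLineC1.add_const {W : Set Ell2} (hW : MeasurableSet W) {i : ℕ} {Φ Φ' : Ell2 → ℝ}
    (h : IsLineC1 W i Φ Φ') (c : ℝ) : IsLineC1 W i (fun x => Φ x + c) Φ' where
  meas := by
    have := h.meas.add (measurable_const (a := c).indicator hW)
    convert this using 1
    ext x
    by_cases hx : x ∈ W <;> simp [hx]
  meas' := h.meas'
  bdd := by
    obtain ⟨M, hM⟩ := h.bdd
    refine ⟨M + |c|, fun x hx => ⟨(abs_add_le _ _).trans (by linarith [(hM x hx).1]), ?_⟩⟩
    linarith [(hM x hx).2, abs_nonneg c]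
  hasDeriv x hx := (h.hasDeriv x hx).add_const c
  cont := h.cont

/-- The coefficient of the adjoint derivative is bounded: the coordinate `x i` is unbounded, but
only its values on the bounded support matter. -/
theorem IsLineTestFun.exists_bound_adjoint {W : Set Ell2} {i : ℕ} {Φ Φ' : Ell2 → ℝ}
    (h : IsLineTestFun W i Φ Φ') (v : ℝ) :
    ∃ M : ℝ, ∀ x ∈ W, ‖-Φ' x + x i / v * Φ x‖ ≤ M := by
  obtain ⟨r, R, hr, hR, h1, h2⟩ := h.supp
  obtain ⟨M, hM⟩ := h.bdd
  refine ⟨M + R / |v| * M, fun x hx => (norm_add_le _ _).trans (add_le_add ?_ ?_)⟩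
  · rw [norm_neg]; exact (hM x hx).2
  · have hM0 : 0 ≤ M := (abs_nonneg _).trans (hM x hx).1
    by_cases h0 : Φ x = 0
    · rw [h0, mul_zero, norm_zero]; positivity
    · have h3 := h2 ⟨hx, h0⟩
      rw [mem_ball_zero_iff] at h3
      have h4 : |x i| ≤ R := (abs_coord_le_norm x i).trans h3.le
      have h5 := (hM x hx).1
      rw [norm_mul, norm_div, Real.norm_eq_abs, Real.norm_eq_abs, Real.norm_eq_abs]
      gcongr

/-! ### The chain rule for weak derivatives -/

theorem IsTestFun.exists_bound {W : Set Ell2} {φ : Ell2 → ℝ} (h : IsTestFun W φ) :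
    ∃ M : ℝ, ∀ x ∈ W, |φ x| ≤ M := by
  obtain ⟨M, hM⟩ := h.bdd_grad
  refine ⟨M, fun x hx => ?_⟩
  have h1 := (hM x hx).2
  have h2 : 0 ≤ ∑' i, pd i φ x ^ 2 := tsum_nonneg fun i => sq_nonneg _
  linarith

namespace IsFlatPair

variable {a : ℕ → ℝ} {δ K : ℝ} {U₁ U₂ : Set Ell2} {g₁ g₂ : Ell2 → ℝ}

theorem isLineC1_comp_flatten (h : IsFlatPair a δ K U₁ U₂ g₁ g₂) {φ : Ell2 → ℝ}
    (hφ : IsTestFun U₂ φ) (i : ℕ) :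
    IsLineC1 U₁ i (fun x => φ (flatten g₁ x)) (fun x =>
      pd 0 φ (flatten g₁ x) * (pd i g₁ x - if i = 0 then 1 else 0) + pd i φ (flatten g₁ x)) where
  meas := measurable_indicator_comp_flatten h.isOpen₁.measurableSet
    (h.smooth₁.measurable_indicator h.isOpen₁.measurableSet)
    (hφ.smooth.measurable_indicator h.isOpen₂.measurableSet) h.mapsTo₁
  meas' := by
    have hg := h.smooth₁.measurable_indicator h.isOpen₁.measurableSet
    have h1 := fun j => measurable_indicator_comp_flatten h.isOpen₁.measurableSet hg
      ((hφ.smooth.pd_smooth j).measurable_indicator h.isOpen₂.measurableSet) h.mapsTo₁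
    have h2 := (h.smooth₁.pd_smooth i).measurable_indicator h.isOpen₁.measurableSet
    have := ((h1 0).mul (h2.sub (measurable_const (a := if i = 0 then (1 : ℝ) else 0)))).add (h1 i)
    convert this using 1
    ext x
    by_cases hx : x ∈ U₁ <;> simp [hx]
  bdd := by
    obtain ⟨M, hM⟩ := hφ.exists_bound
    obtain ⟨M₀, hM₀⟩ := hφ.smooth.bdd [0] (by simp)
    obtain ⟨M₁, hM₁⟩ := hφ.smooth.bdd [i] (by simp)
    obtain ⟨N, hN⟩ := h.smooth₁.bdd [i] (by simp)
    refine ⟨max M (M₀ * (N + 1) + M₁), fun x hx => ⟨(hM _ (h.mapsTo₁ x hx)).trans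
      (le_max_left _ _), le_trans ?_ (le_max_right _ _)⟩⟩
    have h1 := hM₀ _ (h.mapsTo₁ x hx)
    have h2 := hM₁ _ (h.mapsTo₁ x hx)
    have h3 := hN x hx
    simp only [iterPD] at h1 h2 h3
    have h4 : |pd i g₁ x - if i = 0 then 1 else 0| ≤ N + 1 := by
      refine (abs_sub _ _).trans (add_le_add h3 ?_)
      split_ifs <;> simp
    refine (abs_add_le _ _).trans (add_le_add ?_ h2)
    rw [abs_mul]
    exact mul_le_mul h1 h4 (abs_nonneg _) ((abs_nonneg _).trans h1)
  hasDeriv x hx := hasDerivAt_comp_flatten h.isOpen₂ hφ.smooth h.smooth₁ hx (h.mapsTo₁ x hx) i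
  cont x hx := by
    have h1 := fun j => continuousAt_comp_flatten h.isOpen₂ (hφ.smooth.pd_smooth j) h.smooth₁ hx
      (h.mapsTo₁ x hx) i
    exact ((h1 0).mul (((h.smooth₁.pd_smooth i).continuousAt_line i hx).sub_const _)).add (h1 i)

theorem isLineC1_gaussRatio (h : IsFlatPair a δ K U₁ U₂ g₁ g₂) (i : ℕ) :
    IsLineC1 U₁ i (gaussRatio a g₁) (fun x => gaussRatio a g₁ x *
      (((if i = 0 then x 0 else 0) - g₁ x * pd i g₁ x) / a 0 ^ 2)) where
  meas := h.measurable_indicator_gaussRatio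
  meas' := by
    have h1 := h.smooth₁.measurable_indicator h.isOpen₁.measurableSet
    have h2 := (h.smooth₁.pd_smooth i).measurable_indicator h.isOpen₁.measurableSet
    have h3 : Measurable fun x : Ell2 => if i = 0 then x 0 else 0 := by
      split_ifs
      · exact measurable_coord 0
      · exact measurable_const
    have := h.measurable_indicator_gaussRatio.mul ((h3.sub (h1.mul h2)).div_const (a 0 ^ 2))
    convert this using 1
    ext x
    by_cases hx : x ∈ U₁ <;> simp [hx]
  bdd := by
    obtain ⟨N, hN⟩ := h.smooth₁.bdd [i] (by simp)
    set E := Real.exp (δ ^ 2 / (2 * a 0 ^ 2)) with hE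
    refine ⟨max E (E * ((δ + δ * N) / a 0 ^ 2)), fun x hx => ?_⟩
    have h0 : |gaussRatio a g₁ x| ≤ E := by
      rw [abs_of_pos (show 0 < gaussRatio a g₁ x from Real.exp_pos _)]
      exact h.gaussRatio_le hx
    refine ⟨h0.trans (le_max_left _ _), le_trans ?_ (le_max_right _ _)⟩
    have h1 := h.abs_coord₁ x hx
    have h2 := h.abs_le hx
    have h3 := hN x hx
    simp only [iterPD] at h3
    have hδ : 0 ≤ δ := (abs_nonneg _).trans h1
    have h4 : |if i = 0 then x 0 else 0| ≤ δ := by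
      split_ifs
      · exact h1
      · simpa using hδ
    rw [abs_mul, abs_div, abs_of_nonneg (sq_nonneg (a 0))]
    have h5 : |(if i = 0 then x 0 else 0) - g₁ x * pd i g₁ x| ≤ δ + δ * N := by
      refine (abs_sub _ _).trans (add_le_add h4 ?_)
      rw [abs_mul]
      gcongr
    gcongr
  hasDeriv x hx := by
    have h1 : ∀ t : ℝ, (x + t • stdVec i) 0 = x 0 + if i = 0 then t else 0 := fun t => by
      rw [add_smul_stdVec_apply]
      simp only [eq_comm]
    have h2 : HasDerivAt (fun t : ℝ => x 0 + if i = 0 then t else 0)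
        (if i = 0 then 1 else 0) 0 := by
      refine HasDerivAt.const_add _ ?_
      split_ifs
      · exact hasDerivAt_id _
      · exact hasDerivAt_const _ _
    have h3 := (((h2.pow 2).sub ((h.smooth₁.hasDerivAt i hx).pow 2)).div_const (2 * a 0 ^ 2)).exp
    simp only [gaussRatio, h1]
    refine h3.congr_deriv ?_
    simp only [Pi.sub_apply, Pi.pow_apply, zero_smul, add_zero, ite_self]
    congr 1
    split_ifs <;> field_simp <;> simp <;> ring
  cont x hx := by
    have h1 : ∀ t : ℝ, (x + t • stdVec i) 0 = x 0 + if i = 0 then t else 0 := fun t => by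
      rw [add_smul_stdVec_apply]
      simp only [eq_comm]
    have h2 : ContinuousAt (fun t : ℝ => x 0 + if i = 0 then t else 0) 0 := by
      split_ifs <;> fun_prop
    have h3 := h.smooth₁.continuousAt_line i hx
    have h4 : ContinuousAt (fun t : ℝ => if i = 0 then x 0 + (if i = 0 then t else 0) else 0) 0 := by
      split_ifs <;> fun_prop
    simp only [gaussRatio, h1]
    exact (Real.continuous_exp.continuousAt.comp
      (((h2.pow 2).sub (h3.pow 2)).div_const (2 * a 0 ^ 2))).mul
      ((h4.sub (h3.mul ((h.smooth₁.pd_smooth i).continuousAt_line i hx))).div_const _)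

theorem unifIncluded_support_comp (h : IsFlatPair a δ K U₁ U₂ g₁ g₂) {φ : Ell2 → ℝ}
    (hφ : IsTestFun U₂ φ) : UnifIncluded {x | x ∈ U₁ ∧ φ (flatten g₁ x) ≠ 0} U₁ := by
  refine UnifIncluded.mono (h.image_unifIncluded _ (hφ.supp.mono subset_closure)) ?_
  rintro x ⟨hx, h0⟩
  exact ⟨flatten g₁ x, ⟨h.mapsTo₁ x hx, h0⟩, h.flatten_left_inv hx⟩

/-- A test function carried over by the flattening map and multiplied by the Gaussian weight and by
a function that is smooth in direction `i` is a line test function. -/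
theorem isLineTestFun (h : IsFlatPair a δ K U₁ U₂ g₁ g₂) {φ : Ell2 → ℝ}
    (hφ : IsTestFun U₂ φ) {i : ℕ} {k k' : Ell2 → ℝ} (hk : IsLineC1 U₁ i k k') :
    IsLineTestFun U₁ i (fun x => φ (flatten g₁ x) * k x * gaussRatio a g₁ x) (fun x =>
      ((pd 0 φ (flatten g₁ x) * (pd i g₁ x - if i = 0 then 1 else 0) + pd i φ (flatten g₁ x)) *
        k x + φ (flatten g₁ x) * k' x) * gaussRatio a g₁ x + φ (flatten g₁ x) * k x *
        (gaussRatio a g₁ x * (((if i = 0 then x 0 else 0) - g₁ x * pd i g₁ x) / a 0 ^ 2))) where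
  toIsLineC1 := ((h.isLineC1_comp_flatten hφ i).mul hk).mul (h.isLineC1_gaussRatio i)
  supp := (h.unifIncluded_support_comp hφ).mono fun x hx =>
    ⟨hx.1, fun h0 => hx.2 (by simp only [h0, zero_mul])⟩

/-- The chain rule for weak derivatives under the flattening map: if `u₀`, `u` are the weak
derivatives of `f` in the directions `0` and `i`, then `D_i (f ∘ τ) = u ∘ τ + (D_i g₂ - δ_{i0})
u₀ ∘ τ` for `τ = flatten g₂`. -/
theorem isWeakPD_comp (h : IsFlatPair a δ K U₁ U₂ g₁ g₂) (ha : ∀ i, a i ≠ 0) {i : ℕ}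
    {f u₀ u : Ell2 → 𝕜} (hf : MemLp f 2 ((gaussP a).restrict U₁)) (hu₀ : IsWeakPD a U₁ 0 f u₀)
    (hu : IsWeakPD a U₁ i f u) :
    IsWeakPD a U₂ i (f ∘ flatten g₂) (fun y => u (flatten g₂ y) +
      (pd i g₂ y - if i = 0 then 1 else 0) • u₀ (flatten g₂ y)) := by
  have hm₁ := h.isOpen₁.measurableSet
  have hm₂ := h.isOpen₂.measurableSet
  set d : ℝ := if i = 0 then 1 else 0 with hd
  obtain ⟨N, hN⟩ := h.smooth₂.bdd [i] (by simp)
  have hmeas₂ : Measurable (U₂.indicator fun y => pd i g₂ y - d) := by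
    have := ((h.smooth₂.pd_smooth i).measurable_indicator hm₂).sub
      ((measurable_const (a := d)).indicator hm₂)
    convert this using 1
    ext x
    by_cases hx : x ∈ U₂ <;> simp [hx]
  refine ⟨?_, fun φ hφ => ?_⟩
  · refine (h.memLp_comp (ha 0) hu.1).add ?_
    refine MemLp.of_le_mul (c := N + 1) (h.memLp_comp (ha 0) hu₀.1)
      ((aestronglyMeasurable_restrict_of_measurable_indicator hm₂ hmeas₂ _).smul
        (h.memLp_comp (ha 0) hu₀.1).1) ?_
    filter_upwards [ae_restrict_mem hm₂] with y hy
    rw [norm_smul]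
    refine mul_le_mul_of_nonneg_right ?_ (norm_nonneg _)
    refine (norm_sub_le _ _).trans (add_le_add (hN y hy) ?_)
    rw [hd]
    split_ifs <;> simp
  -- The two line test functions that carry `φ` over to `U₁`.
  have hk0 : IsLineC1 U₁ i (fun x => pd 0 g₁ x) (pd i (pd 0 g₁)) :=
    (h.smooth₁.pd_smooth 0).isLineC1 h.isOpen₁ (h.smooth₁.bdd [0] (by simp)) i
  have hki : IsLineC1 U₁ 0 (fun x => pd i g₁ x + -d) (pd 0 (pd i g₁)) :=
    ((h.smooth₁.pd_smooth i).isLineC1 h.isOpen₁ (h.smooth₁.bdd [i] (by simp)) 0).add_const hm₁ _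
  have T₁ := h.isLineTestFun hφ hk0
  have T₂ := h.isLineTestFun hφ hki
  have I₁ := hu.integral_eq h.isOpen₁ hf T₁
  have I₂ := hu₀.integral_eq h.isOpen₁ hf T₂
  have hint : ∀ {b : Ell2 → ℝ} {G : Ell2 → 𝕜} {M : ℝ}, Measurable (U₁.indicator b) →
      (∀ x ∈ U₁, ‖b x‖ ≤ M) → MemLp G 2 ((gaussP a).restrict U₁) →
      Integrable (fun x => b x • G x) ((gaussP a).restrict U₁) := by
    intro b G M hb hM hG
    refine (hG.integrable one_le_two).bdd_smul M
      (aestronglyMeasurable_restrict_of_measurable_indicator hm₁ hb _) ?_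
    filter_upwards [ae_restrict_mem hm₁] with x hx
    exact hM x hx
  have hadj : ∀ {j : ℕ} {Φ Φ' : Ell2 → ℝ}, IsLineTestFun U₁ j Φ Φ' →
      Integrable (fun x => (-Φ' x + x j / a j ^ 2 * Φ x) • f x) ((gaussP a).restrict U₁) := by
    intro j Φ Φ' hΦ
    obtain ⟨M, hM⟩ := hΦ.exists_bound_adjoint (a j ^ 2)
    refine hint ?_ hM hf
    have := hΦ.meas'.neg.add (((measurable_coord j).div_const (a j ^ 2)).mul hΦ.meas)
    convert this using 1
    ext x
    by_cases hx : x ∈ U₁ <;> simp [hx]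
  have hside : ∀ {j : ℕ} {Φ Φ' : Ell2 → ℝ} {G : Ell2 → 𝕜}, IsLineTestFun U₁ j Φ Φ' →
      MemLp G 2 ((gaussP a).restrict U₁) →
      Integrable (fun x => Φ x • G x) ((gaussP a).restrict U₁) := by
    intro j Φ Φ' G hΦ hG
    obtain ⟨M, hM⟩ := hΦ.bdd
    exact hint hΦ.meas (fun x hx => (hM x hx).1) hG
  have hφm : AEStronglyMeasurable (fun x => φ (flatten g₁ x)) ((gaussP a).restrict U₁) :=
    aestronglyMeasurable_restrict_of_measurable_indicator hm₁ (h.isLineC1_comp_flatten hφ 0).meas _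
  have hcoef : Measurable (U₁.indicator fun x => pd i g₂ (flatten g₁ x) - d) :=
    measurable_indicator_comp_flatten hm₁ (h.smooth₁.measurable_indicator hm₁)
      (k := fun y => pd i g₂ y - d) hmeas₂ h.mapsTo₁
  have hadjm : Measurable (U₁.indicator fun x => pdAdj a i φ (flatten g₁ x)) := by
    refine measurable_indicator_comp_flatten hm₁ (h.smooth₁.measurable_indicator hm₁)
      (k := pdAdj a i φ) ?_ h.mapsTo₁
    have := ((hφ.smooth.pd_smooth i).measurable_indicator hm₂).neg.add
      (((measurable_coord i).div_const (a i ^ 2)).mul (hφ.smooth.measurable_indicator hm₂))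
    convert this using 1
    ext x
    by_cases hx : x ∈ U₂ <;> simp [hx, pdAdj]
  calc ∫ y in U₂, φ y • (u (flatten g₂ y) + (pd i g₂ y - d) • u₀ (flatten g₂ y)) ∂(gaussP a)
      = ∫ y in U₂, (fun x => φ (flatten g₁ x) • (u x + (pd i g₂ (flatten g₁ x) - d) • u₀ x))
          (flatten g₂ y) ∂(gaussP a) := by
        refine setIntegral_congr_fun hm₂ fun y hy => ?_
        simp only [h.flatten_right_inv hy]
    _ = ∫ x in U₁, flatJacobian a g₁ x • (φ (flatten g₁ x) • (u x +
          (pd i g₂ (flatten g₁ x) - d) • u₀ x)) ∂(gaussP a) := by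
        have hc := aestronglyMeasurable_restrict_of_measurable_indicator hm₁ hcoef (gaussP a)
        exact h.integral_comp (ha 0) (hφm.smul (hu.1.1.add (hc.smul hu₀.1.1)))
    _ = ∫ x in U₁, ((φ (flatten g₁ x) * pd 0 g₁ x * gaussRatio a g₁ x) • u x -
          (φ (flatten g₁ x) * (pd i g₁ x + -d) * gaussRatio a g₁ x) • u₀ x) ∂(gaussP a) := by
        refine setIntegral_congr_fun hm₁ fun x hx => ?_
        -- `D_0 g₁ * ((D_i g₂) ∘ ψ - d) = -(D_i g₁ - d)`, from the relation `g₂ (ψ x) = x 0`.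
        have h1 := h.pd_comp i hx
        have h2 := h.pd_zero_comp hx
        rw [← hd] at h1
        have e : pd 0 g₁ x * gaussRatio a g₁ x * (φ (flatten g₁ x) *
            (pd i g₂ (flatten g₁ x) - d)) =
            -(φ (flatten g₁ x) * (pd i g₁ x + -d) * gaussRatio a g₁ x) := by
          linear_combination (gaussRatio a g₁ x * φ (flatten g₁ x)) *
            (pd 0 g₁ x * h1 - (pd i g₁ x - d) * h2)
        simp only [flatJacobian, smul_add, smul_smul]
        rw [e, neg_smul, ← sub_eq_add_neg]
        congr 2
        ring
    _ = ∫ x in U₁, (flatJacobian a g₁ x) • (pdAdj a i φ (flatten g₁ x) • f x) ∂(gaussP a) := by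
        rw [integral_sub (hside T₁ hu.1) (hside T₂ hu₀.1), I₁, I₂,
          ← integral_sub (hadj T₁) (hadj T₂)]
        refine setIntegral_congr_fun hm₁ fun x hx => ?_
        -- The terms with `D_0 φ` cancel, and those with second derivatives of `g₁` by symmetry.
        have hsymm := h.smooth₁.pd_zero_comm h.isOpen₁ i hx
        have ha0 := ha 0
        simp only [flatJacobian, pdAdj, ← sub_smul, smul_smul]
        congr 1
        rw [hsymm]
        by_cases hi : i = 0
        · subst hi
          simp only [flatten_apply_zero, if_true, hd]
          field_simp
          ring
        · have hai := ha i
          simp only [flatten_apply_of_ne g₁ x hi, if_true, if_neg hi, hd]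
          field_simp
          ring
    _ = ∫ y in U₂, (fun x => pdAdj a i φ (flatten g₁ x) • f x) (flatten g₂ y) ∂(gaussP a) :=
        (h.integral_comp (ha 0) ((aestronglyMeasurable_restrict_of_measurable_indicator hm₁
          hadjm _).smul hf.1)).symm
    _ = ∫ y in U₂, pdAdj a i φ y • (f ∘ flatten g₂) y ∂(gaussP a) := by
        refine setIntegral_congr_fun hm₂ fun y hy => ?_
        simp only [h.flatten_right_inv hy, Function.comp]

end IsFlatPair

/-! ### Boundedness between Sobolev spaces -/

theorem weakPD_spec {a : ℕ → ℝ} {W : Set Ell2} {i : ℕ} {f : Ell2 → 𝕜}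
    (h : ∃ u, IsWeakPD a W i f u) : IsWeakPD a W i f (weakPD a W i f) := by
  rw [weakPD, dif_pos h]
  exact h.choose_spec

/-- The norm depends only on the values on `W`, although `weakPD` is chosen for a function on the
whole space: equal predicates lead to the same choice. -/
theorem normW12_congr {a : ℕ → ℝ} {W : Set Ell2} (hW : MeasurableSet W) {f f' : Ell2 → 𝕜}
    (h : EqOn f f' W) : normW12 a W f = normW12 a W f' := by
  classical
  have h1 : ∀ i, IsWeakPD a W i f = IsWeakPD a W i f' := by
    intro i
    ext u
    refine and_congr_right fun _ => forall₂_congr fun φ _ => ?_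
    have : ∫ x in W, pdAdj a i φ x • f x ∂(gaussP a) = ∫ x in W, pdAdj a i φ x • f' x ∂(gaussP a) :=
      setIntegral_congr_fun hW fun x hx => by simp only [h hx]
    rw [this]
  have h2 : ∀ i, weakPD a W i f = weakPD a W i f' := by
    intro i
    have key : ∀ p q : (Ell2 → 𝕜) → Prop, p = q →
        (if h : ∃ u, p u then h.choose else 0) = if h : ∃ u, q u then h.choose else 0 := by
      rintro p _ rfl
      rfl
    exact key _ _ (h1 i)
  have h3 : ∫ x in W, ‖f x‖ ^ 2 ∂(gaussP a) = ∫ x in W, ‖f' x‖ ^ 2 ∂(gaussP a) :=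
    setIntegral_congr_fun hW fun x hx => by simp only [h hx]
  simp only [normW12, h2, h3]

/-- The constant in the comparison of squared Sobolev norms. -/
noncomputable def transferConst (a : ℕ → ℝ) (δ K : ℝ) : ℝ :=
  jacobianBound a δ * (3 + 2 * (2 * K + 2 * a 0 ^ 2) / a 0 ^ 2)

namespace IsFlatPair

variable {a : ℕ → ℝ} {δ K : ℝ} {U₁ U₂ : Set Ell2} {g₁ g₂ : Ell2 → ℝ}

/-- The weighted square sum of the coefficients `D_i g₂ - δ_{i0}` of the chain rule. -/
theorem sum_coef_sq_le (h : IsFlatPair a δ K U₁ U₂ g₁ g₂) {y : Ell2} (hy : y ∈ U₂)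
    (s : Finset ℕ) :
    ∑ i ∈ s, a i ^ 2 * (pd i g₂ y - if i = 0 then 1 else 0) ^ 2 ≤ 2 * K + 2 * a 0 ^ 2 := by
  calc ∑ i ∈ s, a i ^ 2 * (pd i g₂ y - if i = 0 then 1 else 0) ^ 2
      ≤ ∑ i ∈ s, (2 * (a i ^ 2 * pd i g₂ y ^ 2) + if i = 0 then 2 * a 0 ^ 2 else 0) := by
        refine Finset.sum_le_sum fun i _ => ?_
        split_ifs with hi
        · subst hi
          nlinarith [sq_nonneg (a 0 * (pd 0 g₂ y + 1))]
        · nlinarith [sq_nonneg (a i * pd i g₂ y)]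
    _ ≤ _ := by
        rw [Finset.sum_add_distrib, ← Finset.mul_sum, Finset.sum_ite_eq']
        have h1 := h.gradient_le y hy s
        have h2 := sq_nonneg (a 0)
        split_ifs <;> linarith

/-- Composition with the flattening map is bounded between Sobolev spaces. -/
theorem memW12_comp (h : IsFlatPair a δ K U₁ U₂ g₁ g₂) (ha : ∀ i, a i ≠ 0) (hδ : 0 ≤ δ)
    (hK : 0 ≤ K) {f : Ell2 → 𝕜} (hf : MemW12 a U₁ f) :
    MemW12 a U₂ (f ∘ flatten g₂) ∧
      normW12 a U₂ (f ∘ flatten g₂) ≤ Real.sqrt (transferConst a δ K) * normW12 a U₁ f := by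
  have hm₂ := h.isOpen₂.measurableSet
  have hJ : 0 ≤ jacobianBound a δ := mul_nonneg hδ (Real.exp_pos _).le
  have hu := fun i => weakPD_spec (hf.exists_weakPD i)
  set u := fun i => weakPD a U₁ i f
  set c : ℕ → Ell2 → ℝ := fun i y => pd i g₂ y - if i = 0 then 1 else 0 with hc
  have hw := fun i => h.isWeakPD_comp ha hf.memLp (hu 0) (hu i)
  have hv := fun i => weakPD_spec ⟨_, hw i⟩
  have hae : ∀ i, ∫ y in U₂, ‖weakPD a U₂ i (f ∘ flatten g₂) y‖ ^ 2 ∂(gaussP a) =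
      ∫ y in U₂, ‖u i (flatten g₂ y) + c i y • u 0 (flatten g₂ y)‖ ^ 2 ∂(gaussP a) := by
    intro i
    refine integral_congr_ae ?_
    filter_upwards [(hv i).ae_eq h.isOpen₂ (hw i)] with y hy
    rw [hy]
  set B : ℕ → ℝ := fun i => ∫ x in U₁, ‖u i x‖ ^ 2 ∂(gaussP a) with hB
  set T := ∑' i, a i ^ 2 * B i with hT
  have hB0 : ∀ i, 0 ≤ B i := fun i => integral_nonneg fun x => sq_nonneg _
  have hsumm : Summable fun i => a i ^ 2 * B i := hf.summable
  have hterm0 : ∀ i, 0 ≤ a i ^ 2 * B i := fun i => mul_nonneg (sq_nonneg _) (hB0 i)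
  have hT0 : 0 ≤ T := tsum_nonneg hterm0
  have hui : ∀ i, Integrable (fun y => ‖u i (flatten g₂ y)‖ ^ 2) ((gaussP a).restrict U₂) :=
    fun i => (h.memLp_comp (ha 0) (hu i).1).norm.integrable_sq
  obtain ⟨K', hK'⟩ : ∃ K', K' = 2 * K + 2 * a 0 ^ 2 := ⟨_, rfl⟩
  have hK'0 : 0 ≤ K' := by rw [hK']; positivity
  have hfin : ∀ s : Finset ℕ, ∑ i ∈ s, a i ^ 2 *
      ∫ y in U₂, ‖weakPD a U₂ i (f ∘ flatten g₂) y‖ ^ 2 ∂(gaussP a) ≤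
        jacobianBound a δ * (2 * T + 2 * K' * (T / a 0 ^ 2)) := by
    intro s
    simp only [hae]
    calc ∑ i ∈ s, a i ^ 2 *
          ∫ y in U₂, ‖u i (flatten g₂ y) + c i y • u 0 (flatten g₂ y)‖ ^ 2 ∂(gaussP a)
        = ∫ y in U₂, ∑ i ∈ s, a i ^ 2 *
            ‖u i (flatten g₂ y) + c i y • u 0 (flatten g₂ y)‖ ^ 2 ∂(gaussP a) := by
          rw [integral_finsetSum]
          · simp only [integral_const_mul]
          · exact fun i _ => ((hw i).1.norm.integrable_sq).const_mul _
      _ ≤ ∫ y in U₂, (∑ i ∈ s, 2 * a i ^ 2 * ‖u i (flatten g₂ y)‖ ^ 2 +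
            2 * K' * ‖u 0 (flatten g₂ y)‖ ^ 2) ∂(gaussP a) := by
          refine integral_mono_ae (integrable_finsetSum _ fun i _ =>
            ((hw i).1.norm.integrable_sq).const_mul _) ((integrable_finsetSum _ fun i _ =>
            (hui i).const_mul _).add ((hui 0).const_mul _)) ?_
          filter_upwards [ae_restrict_mem hm₂] with y hy
          calc ∑ i ∈ s, a i ^ 2 * ‖u i (flatten g₂ y) + c i y • u 0 (flatten g₂ y)‖ ^ 2
              ≤ ∑ i ∈ s, (2 * a i ^ 2 * ‖u i (flatten g₂ y)‖ ^ 2 +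
                  2 * (a i ^ 2 * c i y ^ 2) * ‖u 0 (flatten g₂ y)‖ ^ 2) := by
                refine Finset.sum_le_sum fun i _ => ?_
                have h1 := norm_add_le (u i (flatten g₂ y)) (c i y • u 0 (flatten g₂ y))
                rw [norm_smul, Real.norm_eq_abs] at h1
                have h2 := pow_le_pow_left₀ (norm_nonneg _) h1 2
                have h3 := sq_nonneg (‖u i (flatten g₂ y)‖ - |c i y| * ‖u 0 (flatten g₂ y)‖)
                have h4 : ‖u i (flatten g₂ y) + c i y • u 0 (flatten g₂ y)‖ ^ 2 ≤
                    2 * ‖u i (flatten g₂ y)‖ ^ 2 + 2 * c i y ^ 2 * ‖u 0 (flatten g₂ y)‖ ^ 2 := by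
                  rw [← sq_abs (c i y)]
                  nlinarith
                have h5 := mul_le_mul_of_nonneg_left h4 (sq_nonneg (a i))
                linarith
            _ ≤ _ := by
                rw [Finset.sum_add_distrib, ← Finset.sum_mul, ← Finset.mul_sum]
                have h1 := h.sum_coef_sq_le hy s
                rw [← hK'] at h1
                gcongr
      _ = ∑ i ∈ s, 2 * a i ^ 2 * ∫ y in U₂, ‖u i (flatten g₂ y)‖ ^ 2 ∂(gaussP a) +
            2 * K' * ∫ y in U₂, ‖u 0 (flatten g₂ y)‖ ^ 2 ∂(gaussP a) := by
          rw [integral_add (integrable_finsetSum _ fun i _ => (hui i).const_mul _)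
            ((hui 0).const_mul _), integral_finsetSum _ fun i _ => (hui i).const_mul _]
          simp only [integral_const_mul]
      _ ≤ ∑ i ∈ s, 2 * a i ^ 2 * (jacobianBound a δ * B i) +
            2 * K' * (jacobianBound a δ * B 0) := by
          gcongr with i
          · exact h.integral_norm_sq_comp_le (ha 0) (hu i).1
          · exact h.integral_norm_sq_comp_le (ha 0) (hu 0).1
      _ = jacobianBound a δ * (2 * ∑ i ∈ s, a i ^ 2 * B i + 2 * K' * B 0) := by
          have : ∑ i ∈ s, 2 * a i ^ 2 * (jacobianBound a δ * B i) =
              jacobianBound a δ * (2 * ∑ i ∈ s, a i ^ 2 * B i) := by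
            rw [Finset.mul_sum, Finset.mul_sum]
            exact Finset.sum_congr rfl fun i _ => by ring
          rw [this]
          ring
      _ ≤ _ := by
          have h1 : ∑ i ∈ s, a i ^ 2 * B i ≤ T := hsumm.sum_le_tsum s fun i _ => hterm0 i
          have h2 : a 0 ^ 2 * B 0 ≤ T := hsumm.le_tsum 0 fun i _ => hterm0 i
          have h3 : B 0 ≤ T / a 0 ^ 2 := by
            rw [le_div_iff₀ (pow_pos (abs_pos.2 (ha 0)) 2 |>.trans_eq (sq_abs _))]
            linarith
          gcongr
  have hnn : ∀ i, 0 ≤ a i ^ 2 *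
      ∫ y in U₂, ‖weakPD a U₂ i (f ∘ flatten g₂) y‖ ^ 2 ∂(gaussP a) := fun i =>
    mul_nonneg (sq_nonneg _) (integral_nonneg fun x => sq_nonneg _)
  have hs := summable_of_sum_le hnn hfin
  refine ⟨⟨h.memLp_comp (ha 0) hf.memLp, fun i => ⟨_, hw i⟩, hs⟩, ?_⟩
  have hF0 : 0 ≤ ∫ x in U₁, ‖f x‖ ^ 2 ∂(gaussP a) := integral_nonneg fun x => sq_nonneg _
  rw [normW12, normW12, ← Real.sqrt_mul']
  · refine Real.sqrt_le_sqrt ?_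
    have h1 := h.integral_norm_sq_comp_le (ha 0) hf.memLp
    have h2 := hs.tsum_le_of_sum_le hfin
    refine (add_le_add h1 h2).trans ?_
    change _ ≤ transferConst a δ K * ((∫ x in U₁, ‖f x‖ ^ 2 ∂(gaussP a)) + T)
    rw [transferConst, ← hK', ← mul_add, mul_assoc (jacobianBound a δ)]
    refine mul_le_mul_of_nonneg_left ?_ hJ
    have h3 : 0 ≤ 2 * K' / a 0 ^ 2 := by positivity
    have h4 : 2 * K' * (T / a 0 ^ 2) = 2 * K' / a 0 ^ 2 * T := by ring
    rw [h4]
    nlinarith [mul_nonneg h3 hF0]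
  · exact add_nonneg hF0 hT0

end IsFlatPair

/-! ### Invertibility of the flattening map -/

section Flattening

variable {g : Ell2 → ℝ} {x₀ : Ell2} {r : ℝ}

theorem convex_line_preimage_ball (x₀ : Ell2) (r : ℝ) (z : Ell2) :
    Convex ℝ {t : ℝ | replaceCoord 0 t z ∈ Metric.ball x₀ r} := by
  intro s hs t ht p q hp hq hpq
  have h := convex_ball x₀ r hs ht hp hq hpq
  have e : p • replaceCoord 0 s z + q • replaceCoord 0 t z =
      replaceCoord 0 (p • s + q • t) z := by
    obtain rfl : q = 1 - p := by linarith
    simp only [replaceCoord, smul_eq_mul]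
    module
  rw [e] at h
  exact h

/-- Along the lines of direction `0` the function `g` is strictly increasing inside the ball. -/
theorem strictMonoOn_line (hg : IsFSmooth (Metric.ball x₀ r) g)
    (hpos : ∀ x ∈ Metric.ball x₀ r, 0 < pd 0 g x) (z : Ell2) :
    StrictMonoOn (fun t : ℝ => g (replaceCoord 0 t z))
      {t : ℝ | replaceCoord 0 t z ∈ Metric.ball x₀ r} := by
  have hd : ∀ t, replaceCoord 0 t z ∈ Metric.ball x₀ r →
      HasDerivAt (fun t : ℝ => g (replaceCoord 0 t z)) (pd 0 g (replaceCoord 0 t z)) t := by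
    intro t ht
    have h1 := hg.exists_pd [] 0 _ ht
    rw [replaceCoord_eq_dropCoord_add 0 t z] at h1
    have h2 := h1.hasDerivAt_line
    rw [← replaceCoord_eq_dropCoord_add 0 t z] at h2
    refine h2.congr_of_eventuallyEq (Eventually.of_forall fun s => ?_)
    simp only
    rw [replaceCoord_eq_dropCoord_add 0 s z]
    rfl
  refine strictMonoOn_of_deriv_pos (convex_line_preimage_ball x₀ r z)
    (fun t ht => (hd t ht).continuousAt.continuousWithinAt) fun t ht => ?_
  have ht' : replaceCoord 0 t z ∈ Metric.ball x₀ r :=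
    interior_subset (s := {t : ℝ | replaceCoord 0 t z ∈ Metric.ball x₀ r}) ht
  rw [(hd t ht').deriv]
  exact hpos _ ht'

theorem flatten_replaceCoord (g : Ell2 → ℝ) (t : ℝ) (z : Ell2) :
    flatten g (replaceCoord 0 t z) = replaceCoord 0 (g (replaceCoord 0 t z)) z := by
  rw [flatten_eq_replaceCoord, replaceCoord_replaceCoord]

theorem injOn_flatten (hg : IsFSmooth (Metric.ball x₀ r) g)
    (hpos : ∀ x ∈ Metric.ball x₀ r, 0 < pd 0 g x) : InjOn (flatten g) (Metric.ball x₀ r) := by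
  intro x hx x' hx' h
  have h0 : g x = g x' := by
    have := congrArg (fun y : Ell2 => y 0) h
    simpa only [flatten_apply_zero] using this
  have h1 : x' = replaceCoord 0 (x' 0) x := by
    have := congrArg (replaceCoord 0 (x' 0)) h
    rw [flatten_eq_replaceCoord, flatten_eq_replaceCoord, replaceCoord_replaceCoord,
      replaceCoord_replaceCoord, replaceCoord_self] at this
    exact this.symm
  have h2 := (strictMonoOn_line hg hpos x).injOn (x₁ := x 0) (x₂ := x' 0)
    (by rw [mem_ofPred_eq, replaceCoord_self]; exact hx) (by rw [mem_ofPred_eq, ← h1]; exact hx')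
    (by simp only [replaceCoord_self, ← h1]; exact h0)
  rw [h1, ← h2, replaceCoord_self]

/-- The image of the ball under the flattening map is open, by the intermediate value theorem on
the lines of direction `0`. -/
theorem isOpen_flatten_image (hgc : Continuous g) (hg : IsFSmooth (Metric.ball x₀ r) g)
    (hpos : ∀ x ∈ Metric.ball x₀ r, 0 < pd 0 g x) : IsOpen (flatten g '' Metric.ball x₀ r) := by
  refine isOpen_iff_mem_nhds.2 ?_
  rintro _ ⟨x, hx, rfl⟩
  have hline : ∀ z : Ell2, Continuous fun t : ℝ => replaceCoord 0 t z := fun z =>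
    (continuous_replaceCoord 0).comp (continuous_id.prodMk continuous_const)
  have hslice : ∀ t : ℝ, Continuous fun y : Ell2 => replaceCoord 0 t y := fun t =>
    (continuous_replaceCoord 0).comp (continuous_const.prodMk continuous_id)
  have hT : IsOpen {t : ℝ | replaceCoord 0 t x ∈ Metric.ball x₀ r} :=
    Metric.isOpen_ball.preimage (hline x)
  have hx0 : replaceCoord 0 (x 0) x ∈ Metric.ball x₀ r := by rwa [replaceCoord_self]
  obtain ⟨ε, hε, hεT⟩ := Metric.isOpen_iff.1 hT (x 0) hx0
  have hmem : ∀ t, |t - x 0| < ε → replaceCoord 0 t x ∈ Metric.ball x₀ r := fun t ht =>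
    hεT (by rwa [Metric.mem_ball, Real.dist_eq])
  have hm := strictMonoOn_line hg hpos x
  have hl := hmem (x 0 - ε / 2) (by rw [abs_lt]; constructor <;> linarith)
  have hr := hmem (x 0 + ε / 2) (by rw [abs_lt]; constructor <;> linarith)
  have hlt := hm hl hx0 (by linarith)
  have hgt := hm hx0 hr (by linarith)
  simp only [replaceCoord_self] at hlt hgt
  have hflat : ∀ t, replaceCoord 0 t (flatten g x) = replaceCoord 0 t x := fun t => by
    rw [flatten_eq_replaceCoord, replaceCoord_replaceCoord]
  have e1 : ∀ᶠ y in 𝓝 (flatten g x), replaceCoord 0 (x 0 - ε / 2) y ∈ Metric.ball x₀ r :=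
    (hslice _).continuousAt.eventually_mem (Metric.isOpen_ball.mem_nhds (by rwa [hflat]))
  have e2 : ∀ᶠ y in 𝓝 (flatten g x), replaceCoord 0 (x 0 + ε / 2) y ∈ Metric.ball x₀ r :=
    (hslice _).continuousAt.eventually_mem (Metric.isOpen_ball.mem_nhds (by rwa [hflat]))
  have e3 : ∀ᶠ y : Ell2 in 𝓝 (flatten g x), g (replaceCoord 0 (x 0 - ε / 2) y) < y 0 :=
    (hgc.comp (hslice _)).continuousAt.eventually_lt (continuous_coord 0).continuousAt
      (by
        change g (replaceCoord 0 _ (flatten g x)) < flatten g x 0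
        rw [hflat, flatten_apply_zero]
        exact hlt)
  have e4 : ∀ᶠ y : Ell2 in 𝓝 (flatten g x), y 0 < g (replaceCoord 0 (x 0 + ε / 2) y) :=
    (continuous_coord 0).continuousAt.eventually_lt (hgc.comp (hslice _)).continuousAt
      (by
        change flatten g x 0 < g (replaceCoord 0 _ (flatten g x))
        rw [hflat, flatten_apply_zero]
        exact hgt)
  filter_upwards [e1, e2, e3, e4] with y h1 h2 h3 h4
  have hle : x 0 - ε / 2 ≤ x 0 + ε / 2 := by linarith
  obtain ⟨t, ht, hty⟩ := intermediate_value_Icc hle (hgc.comp (hline y)).continuousOn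
    ⟨h3.le, h4.le⟩
  refine ⟨replaceCoord 0 t y, ?_, ?_⟩
  · exact (convex_line_preimage_ball x₀ r y).ordConnected.out h1 h2 ht
  · rw [flatten_replaceCoord]
    have hty' : g (replaceCoord 0 t y) = y 0 := hty
    rw [hty', replaceCoord_self]

/-- On the image of the ball the choice made in `firstCoord` is the only possible one. -/
theorem firstCoord_flatten (hinj : InjOn (flatten g) (Metric.ball x₀ r)) {x : Ell2}
    (hx : x ∈ Metric.ball x₀ r) : firstCoord g (Metric.ball x₀ r) (flatten g x) = x 0 := by
  rw [firstCoord, hinj.leftInvOn_invFunOn hx]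

theorem unflatten_eq_flatten (g : Ell2 → ℝ) (U : Set Ell2) :
    unflatten g U = flatten (firstCoord g U) := rfl

end Flattening

/-- The flattening map and its inverse form a flat pair, in both directions. -/
theorem FlatteningCondition.exists_isFlatPair {a : ℕ → ℝ} {O : Set Ell2} {g : Ell2 → ℝ}
    (hg : Continuous g) (hO : O = {x | 0 < g x}) {x₀ : Ell2} {r : ℝ}
    (h : FlatteningCondition a O g (Metric.ball x₀ r)) :
    ∃ δ K K' : ℝ, 0 ≤ δ ∧ 0 ≤ K ∧ 0 ≤ K' ∧
      IsFlatPair a δ K (Metric.ball x₀ r ∩ O) (flatten g '' Metric.ball x₀ r ∩ halfSpace) g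
        (firstCoord g (Metric.ball x₀ r)) ∧
      IsFlatPair a δ K' (flatten g '' Metric.ball x₀ r ∩ halfSpace) (Metric.ball x₀ r ∩ O)
        (firstCoord g (Metric.ball x₀ r)) g := by
  obtain ⟨δ, hδ, hU, hV⟩ := h.bounds
  set U := Metric.ball x₀ r with hUdef
  set V := flatten g '' U with hVdef
  set k := firstCoord g U with hk
  have hδ' : 0 < 1 / δ := by positivity
  have hpos : ∀ x ∈ U, 0 < pd 0 g x := fun x hx => hδ'.trans (hU x hx).2.2.1
  have hinj := injOn_flatten h.smooth_g hpos
  have hleft : ∀ x ∈ U, k (flatten g x) = x 0 := fun x hx => firstCoord_flatten hinj hx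
  have hτ : ∀ x ∈ U, flatten k (flatten g x) = x := fun x hx => flatten_flatten_eq_self (hleft x hx)
  have hoU : IsOpen (U ∩ O) := by
    rw [hO]
    exact Metric.isOpen_ball.inter (isOpen_lt continuous_const hg)
  have hoV : IsOpen (V ∩ halfSpace) :=
    (isOpen_flatten_image hg h.smooth_g hpos).inter
      (isOpen_lt continuous_const (continuous_coord 0))
  have hmaps₁ : ∀ x ∈ U ∩ O, flatten g x ∈ V ∩ halfSpace := by
    rintro x ⟨hx, hxO⟩
    refine ⟨mem_image_of_mem _ hx, ?_⟩
    rw [hO] at hxO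
    change 0 < flatten g x 0
    rw [flatten_apply_zero]
    exact hxO
  have hmaps₂ : ∀ y ∈ V ∩ halfSpace, flatten k y ∈ U ∩ O := by
    rintro _ ⟨⟨x, hx, rfl⟩, hy⟩
    rw [hτ x hx, hO]
    refine ⟨hx, ?_⟩
    change 0 < flatten g x 0 at hy
    rwa [flatten_apply_zero] at hy
  have hright : ∀ y ∈ V ∩ halfSpace, g (flatten k y) = y 0 := by
    rintro _ ⟨⟨x, hx, rfl⟩, -⟩
    rw [hτ x hx, flatten_apply_zero]
  have hgrad : ∀ y ∈ V, ∀ s : Finset ℕ, ∑ i ∈ s, a i ^ 2 * pd i k y ^ 2 ≤ δ := by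
    intro y hy s
    obtain ⟨-, -, -, -, hs, hle⟩ := hV y hy
    simp only [sq_abs] at hs hle
    exact (hs.sum_le_tsum s fun i _ => by positivity).trans hle.le
  have P : IsFlatPair a δ δ (U ∩ O) (V ∩ halfSpace) g k :=
    { isOpen₁ := hoU
      isOpen₂ := hoV
      mapsTo₁ := hmaps₁
      mapsTo₂ := hmaps₂
      left_inv := fun x hx => hleft x hx.1
      right_inv := hright
      smooth₁ := h.smooth_g.mono inter_subset_left
      smooth₂ := h.smooth_h.mono inter_subset_left
      abs_coord₁ := fun x hx => (hU x hx.1).1.le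
      abs_coord₂ := fun y hy => (hV y hy.1).1.le
      pd_pos := fun x hx => hpos x hx.1
      pd_le := fun x hx => (hU x hx.1).2.2.2.le
      gradient_le := fun y hy => hgrad y hy.1
      image_unifIncluded := h.preimage_unifIncluded }
  -- In the second pair the gradient bound has to be derived: `D_i g = -(D_0 g) (D_i h) ∘ ψ` for
  -- `i ≠ 0`, while for `i = 0` the bound `D_0 g < δ` is enough.
  refine ⟨δ, δ, 2 * δ ^ 2 * δ + 2 * (1 + δ) ^ 2 * a 0 ^ 2, hδ.le, hδ.le, by positivity, P, ?_⟩
  exact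
    { isOpen₁ := hoV
      isOpen₂ := hoU
      mapsTo₁ := hmaps₂
      mapsTo₂ := hmaps₁
      left_inv := hright
      right_inv := fun x hx => hleft x hx.1
      smooth₁ := h.smooth_h.mono inter_subset_left
      smooth₂ := h.smooth_g.mono inter_subset_left
      abs_coord₁ := fun y hy => (hV y hy.1).1.le
      abs_coord₂ := fun x hx => (hU x hx.1).1.le
      pd_pos := fun y hy => hδ'.trans (hV y hy.1).2.2.1
      pd_le := fun y hy => (hV y hy.1).2.2.2.1.le
      gradient_le := by
        intro x hx s
        have hD := hgrad _ (hmaps₁ x hx).1 s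
        have h0 := P.pd_zero_comp hx
        have hp := hpos x hx.1
        have hpδ := (hU x hx.1).2.2.2.le
        have hterm : ∀ i ∈ s, a i ^ 2 * pd i g x ^ 2 ≤
            2 * δ ^ 2 * (a i ^ 2 * pd i k (flatten g x) ^ 2) +
              if i = 0 then 2 * (1 + δ) ^ 2 * a 0 ^ 2 else 0 := by
          intro i _
          have h1 := P.pd_comp i hx
          have hp2 : pd 0 g x ^ 2 ≤ δ ^ 2 := by gcongr
          split_ifs at h1 ⊢ with hi
          · subst hi
            have hp3 : pd 0 g x ^ 2 ≤ (1 + δ) ^ 2 := by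
              have : pd 0 g x ≤ 1 + δ := by linarith
              gcongr
            have h2 : 0 ≤ 2 * δ ^ 2 * (a 0 ^ 2 * pd 0 k (flatten g x) ^ 2) := by positivity
            have h3 := mul_le_mul_of_nonneg_left hp3 (sq_nonneg (a 0))
            have h4 : 0 ≤ (1 + δ) ^ 2 * a 0 ^ 2 := by positivity
            linarith
          · have h2 : pd i g x = -(pd 0 g x * pd i k (flatten g x)) := by
              linear_combination pd 0 g x * h1 - pd i g x * h0
            rw [h2, neg_sq, mul_pow, add_zero]
            have h3 := mul_le_mul_of_nonneg_right hp2
              (by positivity : 0 ≤ a i ^ 2 * pd i k (flatten g x) ^ 2)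
            have h4 : 0 ≤ δ ^ 2 * (a i ^ 2 * pd i k (flatten g x) ^ 2) := by positivity
            linarith
        refine (Finset.sum_le_sum hterm).trans ?_
        rw [Finset.sum_add_distrib, ← Finset.mul_sum, Finset.sum_ite_eq']
        have h5 : 0 ≤ 2 * (1 + δ) ^ 2 * a 0 ^ 2 := by positivity
        have h6 := mul_le_mul_of_nonneg_left hD (by positivity : 0 ≤ 2 * δ ^ 2)
        split_ifs <;> linarith
      image_unifIncluded := h.image_unifIncluded }

end GaussSobolev

theorem mainTheorem10 {𝕜 : Type*} [RCLike 𝕜]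
    (a : ℕ → ℝ) (ha_pos : ∀ i, 0 < a i) (ha_sum : Summable a)
    (O : Set Ell2) (g : Ell2 → ℝ) (hg : ContDiff ℝ 1 g)
    (hO : O = {x | 0 < g x}) (hfr : frontier O = {x | g x = 0})
    (hDg : ∀ x ∈ frontier O, fderiv ℝ g x ≠ 0)
    (x₀ : Ell2) (hx₀ : x₀ ∈ frontier O) (r : ℝ) (hr : 0 < r)
    (U₀ : Set Ell2) (hU₀ : U₀ = Metric.ball x₀ r)
    (hh : ContDiffOn ℝ 1 (firstCoord g U₀) (flatten g '' U₀))
    (hcond : FlatteningCondition a O g U₀) :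
    (MapsTo (flatten g) (U₀ ∩ O) (flatten g '' U₀ ∩ halfSpace) ∧
      MapsTo (unflatten g U₀) (flatten g '' U₀ ∩ halfSpace) (U₀ ∩ O) ∧
      InvOn (unflatten g U₀) (flatten g) (U₀ ∩ O) (flatten g '' U₀ ∩ halfSpace)) ∧
    ∃ C : ℝ, 0 < C ∧
      (∀ f : Ell2 → 𝕜, MemW12 a (U₀ ∩ O) f →
        MemW12 a (flatten g '' U₀ ∩ halfSpace) (f ∘ unflatten g U₀) ∧
        C⁻¹ * normW12 a (U₀ ∩ O) f ≤
          normW12 a (flatten g '' U₀ ∩ halfSpace) (f ∘ unflatten g U₀) ∧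
        normW12 a (flatten g '' U₀ ∩ halfSpace) (f ∘ unflatten g U₀) ≤
          C * normW12 a (U₀ ∩ O) f) ∧
      (∀ F : Ell2 → 𝕜, MemW12 a (flatten g '' U₀ ∩ halfSpace) F →
        MemW12 a (U₀ ∩ O) (F ∘ flatten g) ∧
        C⁻¹ * normW12 a (flatten g '' U₀ ∩ halfSpace) F ≤
          normW12 a (U₀ ∩ O) (F ∘ flatten g) ∧
        normW12 a (U₀ ∩ O) (F ∘ flatten g) ≤
          C * normW12 a (flatten g '' U₀ ∩ halfSpace) F) := by
  subst hU₀
  obtain ⟨δ, K, K', hδ, hK, hK', P, Q⟩ := hcond.exists_isFlatPair hg.continuous hO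
  have ha : ∀ i, a i ≠ 0 := fun i => (ha_pos i).ne'
  have hU := P.isOpen₁.measurableSet
  have hV := P.isOpen₂.measurableSet
  simp only [unflatten_eq_flatten]
  refine ⟨⟨P.mapsTo₁, P.mapsTo₂, fun x hx => P.flatten_left_inv hx,
    fun y hy => P.flatten_right_inv hy⟩, ?_⟩
  set C₁ := Real.sqrt (transferConst a δ K)
  set C₂ := Real.sqrt (transferConst a δ K')
  have hC₁ : 0 ≤ C₁ := Real.sqrt_nonneg _
  have hC₂ : 0 ≤ C₂ := Real.sqrt_nonneg _
  have hC : 0 < C₁ + C₂ + 1 := by positivity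
  refine ⟨C₁ + C₂ + 1, hC, fun f hf => ?_, fun F hF => ?_⟩
  · obtain ⟨h1, h2⟩ := P.memW12_comp ha hδ hK hf
    obtain ⟨-, h3⟩ := Q.memW12_comp ha hδ hK' h1
    rw [normW12_congr (f' := f) hU fun x hx => by
      simp only [Function.comp, P.flatten_left_inv hx]] at h3
    refine ⟨h1, ?_, h2.trans ?_⟩
    · rw [inv_mul_le_iff₀ hC]
      refine h3.trans (mul_le_mul_of_nonneg_right (by linarith) (Real.sqrt_nonneg _))
    · exact mul_le_mul_of_nonneg_right (by linarith) (Real.sqrt_nonneg _)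
  · obtain ⟨h1, h2⟩ := Q.memW12_comp ha hδ hK' hF
    obtain ⟨-, h3⟩ := P.memW12_comp ha hδ hK h1
    rw [normW12_congr (f' := F) hV fun y hy => by
      simp only [Function.comp, P.flatten_right_inv hy]] at h3
    refine ⟨h1, ?_, h2.trans ?_⟩
    · rw [inv_mul_le_iff₀ hC]
      refine h3.trans (mul_le_mul_of_nonneg_right (by linarith) (Real.sqrt_nonneg _))
    · exact mul_le_mul_of_nonneg_right (by linarith) (Real.sqrt_nonneg _)
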